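/- **Theorem (ZO-RSMD convergence in expectation).** Let $d\ge 2$, $\kappa\in(0,1]$, $p\in[1,2]$, and let $q\in[2,\infty]$ be given by $\frac1p+\frac1q=1$. Let $\mathcal X\subset\mathbb R^d$ be compact and convex, let $\tau>0$, and put $\mathcal X_\tau=\mathcal X+\tau B$, where $B$ is the closed Euclidean unit ball. *Objective.* Let $\xi$ be a random variable with distribution $\mathcal D$, and let $f(x)=\mathbb E_{\xi\sim\mathcal D}[f(x,\xi)]$, where $f(x,\xi)$ is measurable in $\xi$ for $x\in\mathcal X_\tau$ and has finite expectation for $x\in\mathcal X$. Assume that for every $\xi$ the function $f(\cdot,\xi)$ is convex on $\mathcal X_\tau$ and $$|f(x,\xi)-f(y,\xi)|\le M_2(\xi)\|x-y\|_2\qquad(x,y\in\mathcal X_\tau),$$ and that $\mathbb E[M_2(\xi)^{1+\kappa}]\le M_2^{1+\kappa}<\infty$ for a constant $M_2\ge 0$. Let $x^*\in\arg\min_{\mathcal X}f$. *Oracle.* The values $\phi(x,\xi)=f(x,\xi)+\delta(x)$ are available, where the deterministic measurable noise satisfies $|\delta(x)|\le\Delta$ for all $x\in\mathcal X_\tau$,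 with $\Delta\ge 0$. *Prox-function.* Let $\Psi:\mathbb R^d\to\mathbb R$ be differentiable, convex and $(1,\frac{1+\kappa}\kappa)$-uniformly convex with respect to $\|\cdot\|_p$; that is, with $D_\Psi(y,x)=\Psi(y)-\Psi(x)-\langle\nabla\Psi(x),y-x\rangle$, $$D_\Psi(y,x)\ge\tfrac{\kappa}{1+\kappa}\|x-y\|_p^{\frac{1+\kappa}{\kappa}}\qquad(x,y\in\mathbb R^d).$$ Let $\Psi^*(y)=\sup_{x\in\mathbb R^d}\{\langle x,y\rangle-\Psi(x)\}$. *Algorithm ZO-RSMD* with $T\ge 1$ iterations and stepsize $\nu$. Start from $x_0=\arg\min_{\mathcal X}\Psi$. Let $(\mathbf e_k,\xi_k)$, $k=0,\dots,T-1$, be i.i.d., with $\mathbf e_k$ uniform on the Euclidean unit sphere, $\xi_k\sim\mathcal D$, and $\mathbf e_k,\xi_k$ independent. For $k=0,\dots,T-1$ set $$g_{k+1}=\tfrac{d}{2\tau}\big(\phi(x_k+\tau\mathbf e_k,\xi_k)-\phi(x_k-\tau\mathbf e_k,\xi_k)\big)\mathbf e_k,$$ $$y_{k+1}=\nabla\Psi^*(\nabla\Psi(x_k)-\nu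 g_{k+1}),\qquad x_{k+1}=\arg\min_{x\in\mathcal X}D_\Psi(x,y_{k+1}),$$ and output $\bar x_T=\frac1T\sum_{k=0}^{T-1}x_k$. *Constants.* Let $$a_q=d^{\frac1q-\frac12}\min\{\sqrt{32\ln d-8},\sqrt{2q-1}\}$$ (for $q=\infty$ the second term is infinite and $\frac1q=0$), and let $\sigma_q,R_0,\mathcal D_\Psi\ge 0$ be defined by $$\sigma_q^{1+\kappa}=2^\kappa\Big(\tfrac{\sqrt d}{2^{1/4}}a_qM_2\Big)^{1+\kappa}+2^\kappa\Big(\tfrac{d\,a_q\Delta}{\tau}\Big)^{1+\kappa},$$ $$R_0^{\frac{1+\kappa}\kappa}=\tfrac{1+\kappa}\kappa D_\Psi(x^*,x_0),\qquad \mathcal D_\Psi^{\frac{1+\kappa}\kappa}=\tfrac{1+\kappa}\kappa\sup_{x,y\in\mathcal X}D_\Psi(x,y).$$ Let the stepsize be $\nu=\frac{R_0^{1/\kappa}}{\sigma_q}T^{-\frac1{1+\kappa}}$ (read as $\nu=0$ if $\sigma_q=0$). Then $f(\bar x_T)$ is integrable, and the following hold. 1. $$\mathbb E[f(\bar x_T)]-f(x^*)\le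 2M_2\tau+\frac{\sqrt d\,\Delta}{\tau}\mathcal D_\Psi+\frac{R_0\sigma_q}{T^{\frac{\kappa}{1+\kappa}}}.$$ 2. If $M_2>0$ and $\tau=\sqrt{\dfrac{\sqrt d\,\Delta\mathcal D_\Psi+4R_0d\,a_q\Delta T^{-\frac{\kappa}{1+\kappa}}}{2M_2}}$ (assumed positive), then $$\mathbb E[f(\bar x_T)]-f(x^*)\le\sqrt{8M_2\sqrt d\,\Delta\mathcal D_\Psi}+\sqrt{\frac{32M_2R_0d\,a_q\Delta}{T^{\frac{\kappa}{1+\kappa}}}}+\frac{2\sqrt d\,a_qM_2R_0}{T^{\frac{\kappa}{1+\kappa}}}.$$ 3. (Complexity.) Let $\varepsilon>0$ and $M_2>0$. If $\tau=\frac{\varepsilon}{6M_2}$, the noise level satisfies $36\,M_2\sqrt d\,\mathcal D_\Psi\,\Delta\le\varepsilon^2$, and $$T\ge\Big(\frac{6\sqrt d\,a_qM_2R_0}{\varepsilon}\Big)^{\frac{1+\kappa}\kappa},$$ then $\mathbb E[f(\bar x_T)]-f(x^*)\le\varepsilon$. -/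

import Mathlib

open MeasureTheory ProbabilityTheory
open scoped ENNReal Pointwise

noncomputable section

namespace ZORSMD

/-- The `ℓ_p`-norm `(∑ |x_i|^p)^(1/p)` on `ℝ^d`, for a finite exponent `p ≥ 1`. -/
def pNorm {d : ℕ} (p : ℝ) (x : EuclideanSpace ℝ (Fin d)) : ℝ :=
  (∑ i, |x i| ^ p) ^ (1 / p)

/-- The enlarged set `X_τ = X + τ B`, with `B` the closed Euclidean unit ball. -/
def enlarged {d : ℕ} (X : Set (EuclideanSpace ℝ (Fin d))) (τ : ℝ) :
    Set (EuclideanSpace ℝ (Fin d)) :=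
  X + τ • Metric.closedBall (0 : EuclideanSpace ℝ (Fin d)) 1

/-- The objective `f(x) = E_{ξ ∼ 𝒟} f(x, ξ)`. -/
def objective {d : ℕ} {Ξ : Type*} [MeasurableSpace Ξ] (𝒟 : Measure Ξ)
    (f : EuclideanSpace ℝ (Fin d) → Ξ → ℝ) (x : EuclideanSpace ℝ (Fin d)) : ℝ :=
  ∫ s, f x s ∂𝒟

/-- The Bregman divergence `D_Ψ(y, x) = Ψ(y) - Ψ(x) - ⟨∇Ψ(x), y - x⟩`. -/
def bregman {d : ℕ} (Ψ : EuclideanSpace ℝ (Fin d) → ℝ)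
    (y x : EuclideanSpace ℝ (Fin d)) : ℝ :=
  Ψ y - Ψ x - inner ℝ (gradient Ψ x) (y - x)

/-- The Fenchel conjugate `Ψ^*(y) = sup_x {⟨x, y⟩ - Ψ(x)}`. The supremum is finite for the
uniformly convex functions defined below. -/
def fenchelConj {d : ℕ} (Ψ : EuclideanSpace ℝ (Fin d) → ℝ)
    (y : EuclideanSpace ℝ (Fin d)) : ℝ :=
  ⨆ x : EuclideanSpace ℝ (Fin d), (inner ℝ x y - Ψ x)

/-- `(K, r)`-uniform convexity with respect to the `ℓ_p`-norm of a differentiable convex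
function on the whole of `ℝ^d`. -/
structure IsUniformlyConvex {d : ℕ} (K r p : ℝ) (Ψ : EuclideanSpace ℝ (Fin d) → ℝ) : Prop where
  differentiable : Differentiable ℝ Ψ
  convex : ConvexOn ℝ Set.univ Ψ
  le_bregman : ∀ x y, K / r * pNorm p (x - y) ^ r ≤ bregman Ψ y x

/-- The uniform probability distribution on the Euclidean unit sphere of `ℝ^d`: the normalised
surface measure, viewed as a measure on `ℝ^d`. -/
def uniformSphere (d : ℕ) : Measure (EuclideanSpace ℝ (Fin d)) :=
  ((volume : Measure (EuclideanSpace ℝ (Fin d))).toSphere Set.univ)⁻¹ •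
    ((volume : Measure (EuclideanSpace ℝ (Fin d))).toSphere).map Subtype.val

/-- The noisy zeroth-order oracle `φ(x, ξ) = f(x, ξ) + δ(x)`. -/
def oracle {d : ℕ} {Ξ : Type*} (f : EuclideanSpace ℝ (Fin d) → Ξ → ℝ)
    (δ : EuclideanSpace ℝ (Fin d) → ℝ) (x : EuclideanSpace ℝ (Fin d)) (s : Ξ) : ℝ :=
  f x s + δ x

/-- The two-point gradient estimate
`g(x, ξ, e) = d / (2τ) (φ(x + τ e, ξ) - φ(x - τ e, ξ)) e`. -/
def gradEst {d : ℕ} {Ξ : Type*} (f : EuclideanSpace ℝ (Fin d) → Ξ → ℝ)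
    (δ : EuclideanSpace ℝ (Fin d) → ℝ) (τ : ℝ)
    (x : EuclideanSpace ℝ (Fin d)) (s : Ξ) (e : EuclideanSpace ℝ (Fin d)) :
    EuclideanSpace ℝ (Fin d) :=
  ((d : ℝ) / (2 * τ) * (oracle f δ (x + τ • e) s - oracle f δ (x - τ • e) s)) • e

/-- The dual step `∇Ψ^*(∇Ψ(x) - ν g)`. -/
def mirrorStep {d : ℕ} (Ψ : EuclideanSpace ℝ (Fin d) → ℝ) (ν : ℝ)
    (x g : EuclideanSpace ℝ (Fin d)) : EuclideanSpace ℝ (Fin d) :=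
  gradient (fenchelConj Ψ) (gradient Ψ x - ν • g)

/-- `x_0, …, x_T` are the iterates of `T` steps of ZO-RSMD, run on the feasible set `X` from the
starting point `x₀`, with stepsize `ν`, smoothing radius `τ` and prox-function `Ψ`, for the
sampled directions `e_0, …, e_{T-1}` and the sampled data `ξ_0, …, ξ_{T-1}`. -/
structure IsRun {d : ℕ} {Ξ : Type*} (X : Set (EuclideanSpace ℝ (Fin d)))
    (f : EuclideanSpace ℝ (Fin d) → Ξ → ℝ) (δ Ψ : EuclideanSpace ℝ (Fin d) → ℝ)
    (τ ν : ℝ) (T : ℕ) (x₀ : EuclideanSpace ℝ (Fin d))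
    (e : ℕ → EuclideanSpace ℝ (Fin d)) (ξ : ℕ → Ξ)
    (x : ℕ → EuclideanSpace ℝ (Fin d)) : Prop where
  start_mem : x₀ ∈ X
  start_min : IsMinOn Ψ X x₀
  zero : x 0 = x₀
  succ_mem : ∀ k < T, x (k + 1) ∈ X
  succ_min : ∀ k < T,
    IsMinOn (fun z => bregman Ψ z (mirrorStep Ψ ν (x k) (gradEst f δ τ (x k) (ξ k) (e k))))
      X (x (k + 1))

/-- The output `x̄_T = (1/T) ∑_{k < T} x_k`. -/
def average {d : ℕ} (T : ℕ) (x : ℕ → EuclideanSpace ℝ (Fin d)) : EuclideanSpace ℝ (Fin d) :=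
  (T : ℝ)⁻¹ • ∑ k ∈ Finset.range T, x k

/-- `a_q = d^(1/q - 1/2) min {√(32 ln d - 8), √(2q - 1)}` for `q ∈ [2, ∞]`; for `q = ∞` one has
`1/q = 0` and the second term of the minimum is infinite. -/
def aConst (d : ℕ) (q : ℝ≥0∞) : ℝ :=
  (d : ℝ) ^ ((q⁻¹).toReal - 1 / 2) *
    (if q = ∞ then √(32 * Real.log d - 8)
      else min √(32 * Real.log d - 8) √(2 * q.toReal - 1))

/-- `σ_q`, that is, `σ_q^(1+κ) = 2^κ (√d a_q M₂ / 2^(1/4))^(1+κ) + 2^κ (d a_q Δ / τ)^(1+κ)`. -/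
def sigmaConst (d : ℕ) (q : ℝ≥0∞) (κ M₂ Δ τ : ℝ) : ℝ :=
  ((2 : ℝ) ^ κ * (√d / (2 : ℝ) ^ (1 / 4 : ℝ) * aConst d q * M₂) ^ (1 + κ) +
    (2 : ℝ) ^ κ * (d * aConst d q * Δ / τ) ^ (1 + κ)) ^ (1 / (1 + κ))

/-- `R_0`, that is, `R_0^((1+κ)/κ) = (1+κ)/κ · D_Ψ(x^*, x_0)`. -/
def initialDist {d : ℕ} (κ : ℝ) (Ψ : EuclideanSpace ℝ (Fin d) → ℝ)
    (xs x₀ : EuclideanSpace ℝ (Fin d)) : ℝ :=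
  ((1 + κ) / κ * bregman Ψ xs x₀) ^ (κ / (1 + κ))

/-- `𝒟_Ψ`, that is, `𝒟_Ψ^((1+κ)/κ) = (1+κ)/κ · sup_{x, y ∈ X} D_Ψ(x, y)`. -/
def bregmanDiam {d : ℕ} (κ : ℝ) (Ψ : EuclideanSpace ℝ (Fin d) → ℝ)
    (X : Set (EuclideanSpace ℝ (Fin d))) : ℝ :=
  ((1 + κ) / κ * sSup (Set.image2 (bregman Ψ) X X)) ^ (κ / (1 + κ))

/-- The stepsize `ν = R_0^(1/κ) / σ_q · T^(-1/(1+κ))`. -/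
def stepSize (κ R₀ σ : ℝ) (T : ℕ) : ℝ :=
  R₀ ^ (1 / κ) / σ * (T : ℝ) ^ (-(1 / (1 + κ)))

end ZORSMD

end

/-! Mirror descent reduces the theorem to two facts about one stochastic gradient `g` at a point `x`
of `X`: on average `⟨g, x - z⟩` is at least `f(x) - f(z)` up to a bias of `2 M₂ τ` plus a noise
term, and `E ‖g‖_q^(1+κ) ≤ σ_q^(1+κ)`. Uniform convexity of order `(1+κ)/κ` absorbs exactly the term
that Young's inequality pairs with `‖g‖_q^(1+κ)`, so a moment of order `1+κ` suffices
(`IsUniformlyConvex.mirror_descent_step`). Telescoping, taking expectations and applying Jensen to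
the average give `IsRegular.regret_le`, and the prescribed stepsize balances its two terms
(`le_of_stepSize`).

The bias bound (`sub_le_integral_two_point`) needs no smoothed objective and no divergence theorem.
In the integral of `(φ(x+τe) - φ(x-τe)) ⟨e, v⟩` the point `-e` may be replaced by the mirror image
of `e` in the hyperplane orthogonal to `v`: this keeps the uniform law and the value of `⟨e, v⟩`.
The two evaluation points then differ by a multiple of `v`, so convexity along a line compares the
difference with `φ(x) - φ(x-v)`, moving the base point costs `2Lτ`, and `E⟨e, v⟩² = ‖v‖²/d` fixes
the scale.

The moment bound rests on `E[A(e)² ‖e‖_q²]`, where `A(e) = f(x+τe, ξ) - f(x-τe, ξ)` is odd and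
Lipschitz on the sphere. In high dimension it is estimated through second and fourth moments of `A`
and of `‖e‖_q`; for `d ≤ 5` the second moment of `A` and `‖e‖_q ≤ 1` suffice. Moments of `A` come
from a Poincaré inequality on the sphere (`poincare_uniformSphere`) applied to `A` and to `A|A|`,
both of which are odd. That inequality is the Gaussian one (`integral_sq_le_integral_fderiv_sq`) for
the extension of degree one: the radial derivative uses up one of the `d` copies of `∫ v²` and
leaves `d - 1`. The Gaussian inequality follows from the symmetry and the semigroup law of the
Mehler operators: log-convexity of the correlation, together with its linear decay for odd Lipschitz
functions, bounds it by `s` times its value at `1`, and rotating by a small angle turns this into a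
derivative. Moments of `‖e‖_q` are compared with Gaussian ones and bounded by a Stirling estimate;
the logarithmic branch of `a_q` comes from passing to the exponent `4 ln d`.

Since minimisers of the proximal step are unique, a run agrees almost surely with a measurable
recursion driven by the samples, so each iterate is independent of the next sample. The objective is
controlled only on `X_τ`, so it is first precomposed with a retraction onto that set. -/

noncomputable section

namespace ZORSMD

/-! ### Polar coordinates for the standard Gaussian measure. -/

section Gaussian

variable {V : Type*} [NormedAddCommGroup V] [InnerProductSpace ℝ V] [FiniteDimensional ℝ V]
  [MeasurableSpace V] [BorelSpace V]

/-- The density of the standard Gaussian measure as a function of the norm. -/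
def gaussDensity (n : ℕ) (r : ℝ) : ℝ :=
  ((2 * Real.pi) ^ ((n : ℝ) / 2))⁻¹ * Real.exp (-(1 / 2) * r ^ 2)

lemma gaussDensity_nonneg (n : ℕ) (r : ℝ) : 0 ≤ gaussDensity n r := by
  unfold gaussDensity; positivity

lemma measurable_gaussDensity (n : ℕ) : Measurable (gaussDensity n) := by
  unfold gaussDensity; fun_prop

/-- Both sides have the same characteristic function, by the Fourier transform of the Gaussian. The
total mass is computed first because characteristic functions only separate finite measures. -/
lemma stdGaussian_eq_withDensity :
    stdGaussian V = (volume : Measure V).withDensity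
      (fun x => ENNReal.ofReal (gaussDensity (Module.finrank ℝ V) ‖x‖)) := by
  have hpi : (0 : ℝ) < (2 * Real.pi) ^ ((Module.finrank ℝ V : ℝ) / 2) := by positivity
  have hint : ∫ x : V, gaussDensity (Module.finrank ℝ V) ‖x‖ = 1 := by
    unfold gaussDensity
    rw [integral_const_mul, GaussianFourier.integral_rexp_neg_mul_sq_norm (by norm_num)]
    rw [show Real.pi / (1 / 2) = 2 * Real.pi by ring]
    exact inv_mul_cancel₀ hpi.ne'
  have hintg : Integrable (fun x : V => gaussDensity (Module.finrank ℝ V) ‖x‖) := by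
    by_contra h
    rw [integral_undef h] at hint
    exact zero_ne_one hint
  have hfin : IsFiniteMeasure ((volume : Measure V).withDensity
      (fun x => ENNReal.ofReal (gaussDensity (Module.finrank ℝ V) ‖x‖))) :=
    isFiniteMeasure_withDensity_ofReal hintg.2
  apply Measure.ext_of_charFun
  ext t
  rw [charFun_stdGaussian, charFun_apply]
  rw [integral_withDensity_eq_integral_toReal_smul
    (f := fun x : V => ENNReal.ofReal (gaussDensity (Module.finrank ℝ V) ‖x‖))
    ((measurable_gaussDensity _).comp measurable_norm).ennreal_ofReal
    (Filter.Eventually.of_forall fun _ => ENNReal.ofReal_lt_top)]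
  have h := GaussianFourier.integral_cexp_neg_mul_sq_norm_add (V := V) (b := (1 / 2 : ℂ))
    (by norm_num) Complex.I t
  have h2 : (fun x : V => (ENNReal.ofReal (gaussDensity (Module.finrank ℝ V) ‖x‖)).toReal •
      Complex.exp ((inner ℝ x t : ℝ) * Complex.I)) =
      fun x => ((((2 * Real.pi) ^ ((Module.finrank ℝ V : ℝ) / 2))⁻¹ : ℝ) : ℂ) *
        Complex.exp (-(1 / 2) * ‖x‖ ^ 2 + Complex.I * (inner ℝ t x : ℝ)) := by
    ext x
    rw [ENNReal.toReal_ofReal (gaussDensity_nonneg _ _), Complex.exp_add, gaussDensity,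
      real_inner_comm, Complex.real_smul, mul_comm Complex.I]
    push_cast
    ring
  rw [h2, integral_const_mul, h, ← mul_assoc]
  have h3 : (((((2 * Real.pi) ^ ((Module.finrank ℝ V : ℝ) / 2))⁻¹ : ℝ) : ℂ)) *
      ((Real.pi : ℂ) / (1 / 2)) ^ ((Module.finrank ℝ V : ℂ) / 2) = 1 := by
    rw [show ((Real.pi : ℂ) / (1 / 2)) = ((2 * Real.pi : ℝ) : ℂ) by push_cast; ring,
      show ((Module.finrank ℝ V : ℂ) / 2) = (((Module.finrank ℝ V : ℝ) / 2 : ℝ) : ℂ) by push_cast; rfl,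
      ← Complex.ofReal_cpow (by positivity), ← Complex.ofReal_mul, inv_mul_cancel₀ hpi.ne',
      Complex.ofReal_one]
  rw [h3, one_mul, Complex.I_sq]
  congr 1
  ring

open Metric in
/-- In polar coordinates the standard Gaussian measure is a product measure. -/
lemma exists_stdGaussian_polar [Nontrivial V] : ∃ ν : Measure ℝ, ∀ (A : Set V) (B : Set ℝ),
    MeasurableSet A → MeasurableSet B →
    stdGaussian V {x | ‖x‖⁻¹ • x ∈ A ∧ ‖x‖ ∈ B} =
      (volume : Measure V).toSphere.map Subtype.val A * ν B := by
  set g : ℝ → ℝ≥0∞ := fun r => ENNReal.ofReal (gaussDensity (Module.finrank ℝ V) r) with hg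
  have hgm : Measurable g := (measurable_gaussDensity _).ennreal_ofReal
  -- The radial factor is the polar weight `r^(n-1)` times the Gaussian density. As `toSphere` is
  -- not normalised, this factor need not be a probability measure.
  refine ⟨((Measure.volumeIoiPow (Module.finrank ℝ V - 1)).withDensity
    (fun r => g r.1)).map Subtype.val, fun A B hA hB => ?_⟩
  have hS : MeasurableSet {x : V | ‖x‖⁻¹ • x ∈ A ∧ ‖x‖ ∈ B} := by
    apply MeasurableSet.inter
    · exact (by fun_prop : Measurable fun x : V => ‖x‖⁻¹ • x) hA
    · exact measurable_norm hB
  have hprod : ∀ y : ({0}ᶜ : Set V),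
      ({x : V | ‖x‖⁻¹ • x ∈ A ∧ ‖x‖ ∈ B}.indicator fun x => g ‖x‖) y =
      (fun p : sphere (0 : V) 1 × Set.Ioi (0 : ℝ) =>
        (Subtype.val ⁻¹' A).indicator 1 p.1 *
          ((Subtype.val ⁻¹' B).indicator (fun r => g r.1)) p.2) (homeomorphUnitSphereProd V y) := by
    intro y
    have e1 : (Subtype.val ⁻¹' A).indicator (1 : sphere (0 : V) 1 → ℝ≥0∞)
        (homeomorphUnitSphereProd V y).1 = A.indicator 1 (‖y.1‖⁻¹ • y.1) := by
      rw [← homeomorphUnitSphereProd_apply_fst_coe]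
      rfl
    have e2 : (Subtype.val ⁻¹' B).indicator (fun r : Set.Ioi (0 : ℝ) => g r.1)
        (homeomorphUnitSphereProd V y).2 = B.indicator g ‖y.1‖ := by
      rw [← homeomorphUnitSphereProd_apply_snd_coe]
      rfl
    simp only [e1, e2]
    by_cases h1 : ‖y.1‖⁻¹ • y.1 ∈ A <;> by_cases h2 : ‖y.1‖ ∈ B <;> simp [Set.indicator, h1, h2]
  have hgm' : Measurable fun r : Set.Ioi (0 : ℝ) => g r.1 := hgm.comp measurable_subtype_coe
  have hA' : MeasurableSet (Subtype.val ⁻¹' A : Set (sphere (0 : V) 1)) := measurable_subtype_coe hA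
  have hB' : MeasurableSet (Subtype.val ⁻¹' B : Set (Set.Ioi (0 : ℝ))) := measurable_subtype_coe hB
  rw [stdGaussian_eq_withDensity, withDensity_apply _ hS, ← lintegral_indicator hS]
  -- The polar homeomorphism lives off the origin, which Lebesgue measure does not charge.
  conv_lhs => rw [← restrict_compl_singleton (μ := (volume : Measure V)) 0]
  rw [← lintegral_subtype_comap (measurableSet_singleton _).compl, lintegral_congr hprod,
    ((volume : Measure V).measurePreserving_homeomorphUnitSphereProd).lintegral_comp_emb
      (Homeomorph.measurableEmbedding _)
      (fun p : sphere (0 : V) 1 × Set.Ioi (0 : ℝ) =>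
        (Subtype.val ⁻¹' A).indicator 1 p.1 *
          ((Subtype.val ⁻¹' B).indicator (fun r => g r.1)) p.2),
    lintegral_prod_mul (measurable_one.indicator hA').aemeasurable
      (hgm'.indicator hB').aemeasurable,
    lintegral_indicator_one hA', lintegral_indicator hB', Measure.map_apply measurable_subtype_coe hA,
    Measure.map_apply measurable_subtype_coe hB, withDensity_apply _ hB']

end Gaussian

/-! ### The uniform law on the sphere and its moments. -/

section Sphere

variable {d : ℕ}

lemma uniformSphere_univ (hd : 0 < d) : uniformSphere d Set.univ = 1 := by
  have : Nonempty (Fin d) := ⟨⟨0, hd⟩⟩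
  rw [uniformSphere, Measure.smul_apply, Measure.map_apply measurable_subtype_coe .univ,
    Set.preimage_univ, smul_eq_mul]
  refine ENNReal.inv_mul_cancel ?_ (measure_ne_top _ _)
  exact (Measure.measure_univ_ne_zero).2 (Measure.toSphere_ne_zero _)

/-- The direction and the norm of a standard Gaussian vector are independent, and the direction
is uniformly distributed on the sphere. -/
lemma stdGaussian_map_polar (hd : 0 < d) :
    (stdGaussian (EuclideanSpace ℝ (Fin d))).map (fun x => (‖x‖⁻¹ • x, ‖x‖)) =
      (uniformSphere d).prod ((stdGaussian (EuclideanSpace ℝ (Fin d))).map norm) := by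
  have : Nonempty (Fin d) := ⟨⟨0, hd⟩⟩
  obtain ⟨ν, hν⟩ := exists_stdGaussian_polar (V := EuclideanSpace ℝ (Fin d))
  set S := (volume : Measure (EuclideanSpace ℝ (Fin d))).toSphere.map Subtype.val with hS
  have hSu : S Set.univ = (volume : Measure (EuclideanSpace ℝ (Fin d))).toSphere Set.univ := by
    rw [hS, Measure.map_apply measurable_subtype_coe .univ, Set.preimage_univ]
  have hS0 : S Set.univ ≠ 0 := by
    rw [hSu]; exact (Measure.measure_univ_ne_zero).2 (Measure.toSphere_ne_zero _)
  have hSt : S Set.univ ≠ ∞ := measure_ne_top _ _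
  have hu : IsProbabilityMeasure (uniformSphere d) := ⟨uniformSphere_univ hd⟩
  have hm : Measurable fun x : EuclideanSpace ℝ (Fin d) => (‖x‖⁻¹ • x, ‖x‖) := by fun_prop
  have : IsProbabilityMeasure ((stdGaussian (EuclideanSpace ℝ (Fin d))).map norm) :=
    Measure.isProbabilityMeasure_map (by fun_prop)
  symm
  refine Measure.prod_eq fun A B hA hB => ?_
  -- Taking the whole sphere shows that the radial factor is the law of the norm divided by the
  -- total surface mass, which is the constant that normalises the direction.
  have h1 := hν Set.univ B .univ hB
  simp only [Set.mem_univ, true_and] at h1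
  rw [Measure.map_apply hm (hA.prod hB), Measure.map_apply measurable_norm hB]
  change stdGaussian _ {x | ‖x‖⁻¹ • x ∈ A ∧ ‖x‖ ∈ B} = _ * stdGaussian _ {x | ‖x‖ ∈ B}
  rw [hν A B hA hB, h1, uniformSphere, Measure.smul_apply, smul_eq_mul, ← hSu, ← hS]
  rw [mul_comm _ (S A), mul_assoc, ← mul_assoc _ _ (ν B), ENNReal.inv_mul_cancel hS0 hSt, one_mul]

instance isProbabilityMeasure_uniformSphere [NeZero d] : IsProbabilityMeasure (uniformSphere d) :=
  ⟨uniformSphere_univ (NeZero.pos d)⟩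

lemma stdGaussian_map_direction [NeZero d] :
    (stdGaussian (EuclideanSpace ℝ (Fin d))).map (fun x => ‖x‖⁻¹ • x) = uniformSphere d := by
  have h := congrArg Measure.fst (stdGaussian_map_polar (NeZero.pos d))
  have : IsProbabilityMeasure ((stdGaussian (EuclideanSpace ℝ (Fin d))).map norm) :=
    Measure.isProbabilityMeasure_map (by fun_prop)
  rw [Measure.fst_prod, Measure.fst, Measure.map_map measurable_fst (by fun_prop)] at h
  exact h

lemma ae_uniformSphere_norm_eq_one (d : ℕ) : ∀ᵐ e ∂(uniformSphere d), ‖e‖ = 1 := by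
  refine Measure.ae_smul_measure ?_ _
  rw [ae_map_iff (by fun_prop) (measurableSet_eq_fun measurable_norm measurable_const)]
  exact Filter.Eventually.of_forall fun e => by simp

/-- Normalising a vector commutes with linear isometries, so the invariance of the Gaussian law
passes to the law of its direction. -/
lemma uniformSphere_map_isometry [NeZero d]
    (R : EuclideanSpace ℝ (Fin d) ≃ₗᵢ[ℝ] EuclideanSpace ℝ (Fin d)) :
    (uniformSphere d).map R = uniformSphere d := by
  conv_lhs => rw [← stdGaussian_map_direction]
  rw [Measure.map_map (by fun_prop) (by fun_prop)]
  have : (R ∘ fun x : EuclideanSpace ℝ (Fin d) => ‖x‖⁻¹ • x) = (fun x => ‖x‖⁻¹ • x) ∘ R := by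
    ext1 x; simp
  rw [this, ← Measure.map_map (by fun_prop) (by fun_prop), stdGaussian_map,
    stdGaussian_map_direction]

lemma integral_uniformSphere_comp_isometry [NeZero d]
    (R : EuclideanSpace ℝ (Fin d) ≃ₗᵢ[ℝ] EuclideanSpace ℝ (Fin d))
    (F : EuclideanSpace ℝ (Fin d) → ℝ) :
    ∫ e, F (R e) ∂(uniformSphere d) = ∫ e, F e ∂(uniformSphere d) := by
  conv_rhs => rw [← uniformSphere_map_isometry R]
  exact (R.toHomeomorph.measurableEmbedding.integral_map F).symm

/-- Functions of direction and norm factorise under the standard Gaussian measure. -/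
lemma integral_stdGaussian_polar [NeZero d] (F : EuclideanSpace ℝ (Fin d) → ℝ) (k : ℝ → ℝ)
    (hF : Measurable F) (hk : Measurable k) :
    ∫ x, F (‖x‖⁻¹ • x) * k ‖x‖ ∂(stdGaussian (EuclideanSpace ℝ (Fin d))) =
      (∫ e, F e ∂(uniformSphere d)) *
        ∫ x, k ‖x‖ ∂(stdGaussian (EuclideanSpace ℝ (Fin d))) := by
  have : IsProbabilityMeasure ((stdGaussian (EuclideanSpace ℝ (Fin d))).map norm) :=
    Measure.isProbabilityMeasure_map (by fun_prop)
  have h1 : ∫ x, F (‖x‖⁻¹ • x) * k ‖x‖ ∂(stdGaussian (EuclideanSpace ℝ (Fin d))) =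
      ∫ z, F z.1 * k z.2 ∂((stdGaussian (EuclideanSpace ℝ (Fin d))).map
        (fun x => (‖x‖⁻¹ • x, ‖x‖))) := by
    rw [integral_map (by fun_prop)]
    exact ((hF.comp measurable_fst).mul (hk.comp measurable_snd)).aestronglyMeasurable
  rw [h1, stdGaussian_map_polar (NeZero.pos d), integral_prod_mul,
    integral_map (by fun_prop) hk.aestronglyMeasurable]

lemma integrable_uniformSphere_of_bound [NeZero d] {F : EuclideanSpace ℝ (Fin d) → ℝ}
    (hF : AEStronglyMeasurable F (uniformSphere d)) (C : ℝ) (hC : ∀ e, ‖e‖ = 1 → |F e| ≤ C) :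
    Integrable F (uniformSphere d) := by
  refine Integrable.of_bound hF C ?_
  filter_upwards [ae_uniformSphere_norm_eq_one d] with e he using hC e he

/-- The second moments of the uniform distribution on the sphere. -/
lemma integral_inner_sq_uniformSphere [NeZero d] (a : EuclideanSpace ℝ (Fin d)) :
    ∫ e, (inner ℝ e a) ^ 2 ∂(uniformSphere d) = ‖a‖ ^ 2 / d := by
  -- The reflection that exchanges two vectors of equal norm preserves the law, so the second moment
  -- depends on the norm alone. It can then be averaged over the coordinate axes, where the squares
  -- sum to one.
  have key : ∀ a b : EuclideanSpace ℝ (Fin d), ‖a‖ = ‖b‖ →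
      ∫ e, (inner ℝ e a) ^ 2 ∂(uniformSphere d) = ∫ e, (inner ℝ e b) ^ 2 ∂(uniformSphere d) := by
    intro a b hab
    rw [← integral_uniformSphere_comp_isometry (Submodule.reflection (ℝ ∙ (a - b))ᗮ)
      (fun e => (inner ℝ e b) ^ 2)]
    congr 1; ext e
    have h := LinearIsometryEquiv.inner_map_map (Submodule.reflection (ℝ ∙ (a - b))ᗮ) e a
    rw [Submodule.reflection_sub hab] at h
    rw [h]
  have h1 : ∀ i : Fin d, ∫ e, (inner ℝ e a) ^ 2 ∂(uniformSphere d) =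
      ∫ e : EuclideanSpace ℝ (Fin d), ‖a‖ ^ 2 * (e i) ^ 2 ∂(uniformSphere d) := by
    intro i
    rw [key a (‖a‖ • EuclideanSpace.single i 1) (by simp [norm_smul])]
    congr 1; ext e
    simp [inner_smul_right, EuclideanSpace.inner_single_right, mul_pow]
  have h2 : (d : ℝ) * ∫ e, (inner ℝ e a) ^ 2 ∂(uniformSphere d) = ‖a‖ ^ 2 := by
    calc (d : ℝ) * ∫ e, (inner ℝ e a) ^ 2 ∂(uniformSphere d)
        = ∑ i : Fin d, ∫ e, (inner ℝ e a) ^ 2 ∂(uniformSphere d) := by simp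
      _ = ∑ i : Fin d, ∫ e : EuclideanSpace ℝ (Fin d), ‖a‖ ^ 2 * (e i) ^ 2 ∂(uniformSphere d) :=
          Finset.sum_congr rfl fun i _ => h1 i
      _ = ∫ e : EuclideanSpace ℝ (Fin d), ∑ i, ‖a‖ ^ 2 * (e i) ^ 2 ∂(uniformSphere d) := by
          rw [integral_finsetSum]
          intro i _
          refine integrable_uniformSphere_of_bound (by fun_prop) (‖a‖ ^ 2) fun e he => ?_
          rw [abs_of_nonneg (by positivity)]
          have : |e i| ≤ 1 := by simpa [he] using PiLp.norm_apply_le e i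
          have := sq_le_one_iff_abs_le_one (e i) |>.2 this
          nlinarith [sq_nonneg ‖a‖]
      _ = ∫ e : EuclideanSpace ℝ (Fin d), ‖a‖ ^ 2 ∂(uniformSphere d) := by
          refine integral_congr_ae ?_
          filter_upwards [ae_uniformSphere_norm_eq_one d] with e he
          rw [← Finset.mul_sum, ← EuclideanSpace.real_norm_sq_eq, he]
          ring
      _ = ‖a‖ ^ 2 := by simp
  have hd : (d : ℝ) ≠ 0 := Nat.cast_ne_zero.2 (NeZero.ne d)
  field_simp
  linarith

lemma integrable_norm_rpow_stdGaussian {q : ℝ} (hq : 0 ≤ q) :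
    Integrable (fun x : EuclideanSpace ℝ (Fin d) => ‖x‖ ^ q)
      (stdGaussian (EuclideanSpace ℝ (Fin d))) := by
  have := (IsGaussian.memLp_id (stdGaussian (EuclideanSpace ℝ (Fin d))) (ENNReal.ofReal q)
    ENNReal.ofReal_ne_top).integrable_norm_rpow'
  simpa [ENNReal.toReal_ofReal hq] using this

lemma integral_inner_sq_stdGaussian (a : EuclideanSpace ℝ (Fin d)) :
    ∫ x, (inner ℝ a x) ^ 2 ∂(stdGaussian (EuclideanSpace ℝ (Fin d))) = ‖a‖ ^ 2 := by
  have h := variance_dual_stdGaussian (innerSL ℝ a)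
  rw [variance_of_integral_eq_zero (by fun_prop) (integral_strongDual_stdGaussian _)] at h
  simpa using h

lemma integral_norm_sq_stdGaussian :
    ∫ x, ‖x‖ ^ 2 ∂(stdGaussian (EuclideanSpace ℝ (Fin d))) = d := by
  simp_rw [EuclideanSpace.real_norm_sq_eq]
  rw [integral_finsetSum]
  · have : ∀ i : Fin d, ∫ x : EuclideanSpace ℝ (Fin d), x i ^ 2
        ∂(stdGaussian (EuclideanSpace ℝ (Fin d))) = 1 := fun i => by
      simpa [EuclideanSpace.inner_single_left] using
        integral_inner_sq_stdGaussian (EuclideanSpace.single i (1 : ℝ))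
    simp [this]
  · intro i _
    refine Integrable.mono' (integrable_norm_rpow_stdGaussian (q := 2) (by norm_num))
      (by fun_prop) (Filter.Eventually.of_forall fun x => ?_)
    have := PiLp.norm_apply_le x i
    rw [Real.norm_eq_abs, abs_pow, Real.rpow_two]
    exact pow_le_pow_left₀ (abs_nonneg _) (by simpa using this) 2

/-- The Gaussian pair is invariant under planar rotations. -/
lemma integral_stdGaussian_prod_rotation (θ : ℝ)
    (F : EuclideanSpace ℝ (Fin d) × EuclideanSpace ℝ (Fin d) → ℝ) (hF : Measurable F) :
    ∫ z, F (Real.cos θ • z.1 + Real.sin θ • z.2, -Real.sin θ • z.1 + Real.cos θ • z.2)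
      ∂((stdGaussian (EuclideanSpace ℝ (Fin d))).prod (stdGaussian (EuclideanSpace ℝ (Fin d)))) =
    ∫ z, F z
      ∂((stdGaussian (EuclideanSpace ℝ (Fin d))).prod (stdGaussian (EuclideanSpace ℝ (Fin d)))) := by
  conv_rhs => rw [← IsGaussian.map_rotation_eq_self
    (μ := stdGaussian (EuclideanSpace ℝ (Fin d))) (by simp) θ]
  rw [integral_map (by fun_prop) hF.aestronglyMeasurable]
  rfl

/-- The coordinates of a standard Gaussian vector are standard Gaussian. -/
lemma stdGaussian_map_eval (i : Fin d) :
    (stdGaussian (EuclideanSpace ℝ (Fin d))).map (fun x => x i) = gaussianReal 0 1 := by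
  have h := (measurePreserving_eval_multivariateGaussian (μ := (0 : EuclideanSpace ℝ (Fin d)))
    (S := (1 : Matrix (Fin d) (Fin d) ℝ)) Matrix.PosSemidef.one (i := i)).map_eq
  simpa using h

/-- Absolute moments of a standard Gaussian variable. -/
lemma integral_abs_rpow_gaussianReal {q : ℝ} (hq : 0 ≤ q) :
    ∫ x, |x| ^ q ∂(gaussianReal 0 1) = 2 ^ (q / 2) * Real.Gamma ((q + 1) / 2) / √Real.pi := by
  rw [integral_gaussianReal_eq_integral_smul (by norm_num)]
  have h1 : ∀ x : ℝ, gaussianPDFReal 0 1 x • |x| ^ q =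
      (fun y => (√(2 * Real.pi))⁻¹ * (y ^ q * Real.exp (-(1 / 2) * y ^ (2 : ℝ)))) |x| := by
    intro x
    simp only [gaussianPDFReal, Real.rpow_two, sq_abs, smul_eq_mul, NNReal.coe_one, mul_one, sub_zero]
    rw [show -x ^ 2 / 2 = -(1 / 2) * x ^ 2 by ring]
    ring
  simp_rw [h1]
  rw [integral_comp_abs (f := fun y => (√(2 * Real.pi))⁻¹ *
    (y ^ q * Real.exp (-(1 / 2) * y ^ (2 : ℝ)))), integral_const_mul,
    integral_rpow_mul_exp_neg_mul_rpow (by norm_num) (by linarith) (by norm_num)]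
  rw [one_div, Real.inv_rpow (by norm_num), show -(q + 1) / 2 = -(q / 2 + 1 / 2) by ring,
    Real.rpow_neg (by norm_num), inv_inv, Real.rpow_add (by norm_num), ← Real.sqrt_eq_rpow,
    Real.sqrt_mul (by norm_num)]
  field_simp

lemma integral_abs_coord_rpow_stdGaussian (i : Fin d) {q : ℝ} (hq : 0 ≤ q) :
    ∫ x, |x i| ^ q ∂(stdGaussian (EuclideanSpace ℝ (Fin d))) =
      2 ^ (q / 2) * Real.Gamma ((q + 1) / 2) / √Real.pi := by
  rw [← integral_abs_rpow_gaussianReal hq, ← stdGaussian_map_eval i,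
    integral_map (by fun_prop)]
  exact Measurable.aestronglyMeasurable (by fun_prop)

/-- Absolute moments of the coordinates of a uniform vector on the sphere. -/
lemma integral_abs_coord_rpow_uniformSphere_le [NeZero d] (i : Fin d) {q : ℝ} (hq : 2 ≤ q) :
    ∫ e, |e i| ^ q ∂(uniformSphere d) ≤
      (d : ℝ) ^ (-(q / 2)) * (2 ^ (q / 2) * Real.Gamma ((q + 1) / 2) / √Real.pi) := by
  have hd : (0 : ℝ) < d := Nat.cast_pos.2 (NeZero.pos d)
  -- A Gaussian coordinate is the product of an independent direction coordinate and the norm, so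
  -- the spherical moment is the Gaussian one divided by `E ‖x‖^q`.
  have h1 := integral_stdGaussian_polar (d := d) (fun e => |e i| ^ q) (fun r => r ^ q)
    (by fun_prop) (by fun_prop)
  have h2 : ∫ x, |(‖x‖⁻¹ • x) i| ^ q * ‖x‖ ^ q ∂(stdGaussian (EuclideanSpace ℝ (Fin d))) =
      ∫ x, |x i| ^ q ∂(stdGaussian (EuclideanSpace ℝ (Fin d))) := by
    congr 1; ext x
    rw [← Real.mul_rpow (abs_nonneg _) (norm_nonneg _)]
    rcases eq_or_ne x 0 with rfl | hx
    · simp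
    · have : ‖x‖ ≠ 0 := norm_ne_zero_iff.2 hx
      simp only [PiLp.smul_apply, smul_eq_mul, abs_mul, abs_inv, abs_norm]
      field_simp
  rw [h2, integral_abs_coord_rpow_stdGaussian i (by linarith)] at h1
  -- Jensen in tangent-line form: Bernoulli's inequality for `‖x‖²/d` at its mean value `1`, where
  -- the linear term integrates to zero.
  have h3 : (d : ℝ) ^ (q / 2) ≤ ∫ x, ‖x‖ ^ q ∂(stdGaussian (EuclideanSpace ℝ (Fin d))) := by
    have hpt : ∀ x : EuclideanSpace ℝ (Fin d),
        (d : ℝ) ^ (q / 2) * (1 + q / 2 * (‖x‖ ^ 2 / d - 1)) ≤ ‖x‖ ^ q := by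
      intro x
      have hb := one_add_mul_self_le_rpow_one_add (s := ‖x‖ ^ 2 / d - 1) (p := q / 2)
        (by have : 0 ≤ ‖x‖ ^ 2 / d := by positivity
            linarith) (by linarith)
      calc (d : ℝ) ^ (q / 2) * (1 + q / 2 * (‖x‖ ^ 2 / d - 1))
          ≤ (d : ℝ) ^ (q / 2) * (1 + (‖x‖ ^ 2 / d - 1)) ^ (q / 2) := by gcongr
        _ = ‖x‖ ^ q := by
          rw [← Real.mul_rpow hd.le (by ring_nf; positivity),
            show (d : ℝ) * (1 + (‖x‖ ^ 2 / d - 1)) = ‖x‖ ^ (2 : ℝ) by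
              rw [Real.rpow_two]; field_simp; ring,
            ← Real.rpow_mul (norm_nonneg _)]
          congr 1; ring
    have hi2 : Integrable (fun x : EuclideanSpace ℝ (Fin d) => ‖x‖ ^ 2)
        (stdGaussian (EuclideanSpace ℝ (Fin d))) := by
      simpa using integrable_norm_rpow_stdGaussian (d := d) (q := 2) (by norm_num)
    have hi3 : Integrable (fun x : EuclideanSpace ℝ (Fin d) => q / 2 * (‖x‖ ^ 2 / d - 1))
        (stdGaussian (EuclideanSpace ℝ (Fin d))) :=
      ((hi2.div_const _).sub (integrable_const _)).const_mul _
    have hm := integral_mono (((integrable_const (1 : ℝ)).add hi3).const_mul ((d : ℝ) ^ (q / 2)))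
      (integrable_norm_rpow_stdGaussian (by linarith)) hpt
    refine le_trans (le_of_eq ?_) hm
    rw [integral_const_mul]
    simp only [Pi.add_apply]
    rw [integral_add (integrable_const _) hi3,
      integral_const_mul, integral_sub (hi2.div_const _) (integrable_const _), integral_div,
      integral_norm_sq_stdGaussian]
    simp
  have h4 : 0 ≤ ∫ e, |e i| ^ q ∂(uniformSphere d) := integral_nonneg fun e => by positivity
  have h5 : (0 : ℝ) < (d : ℝ) ^ (q / 2) := by positivity
  rw [Real.rpow_neg hd.le, h1, inv_mul_eq_div, le_div_iff₀ h5]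
  gcongr

end Sphere

end ZORSMD

end

/-! ### The Mehler semigroup and the Gaussian Poincaré inequality for odd functions. -/

noncomputable section

namespace ZORSMD

/-- A sequence-type self-improvement: a function with `F(s)² ≤ F(1) F(s²)` and `F(s) = O(s)`
satisfies `F(s) ≤ s F(1)`. -/
lemma le_mul_of_sq_le_of_le_mul {F : ℝ → ℝ} {C : ℝ}
    (hF0 : ∀ s, 0 ≤ s → s ≤ 1 → 0 ≤ F s) (hF1 : ∀ s, 0 ≤ s → s ≤ 1 → F s ^ 2 ≤ F 1 * F (s ^ 2))
    (hF2 : ∀ s, 0 ≤ s → s ≤ 1 → F s ≤ C * s) {s : ℝ} (hs0 : 0 ≤ s) (hs1 : s ≤ 1) :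
    F s ≤ s * F 1 := by
  rcases hs0.eq_or_lt with rfl | hs
  · simpa using hF2 0 le_rfl zero_le_one
  have h1 : 0 ≤ F 1 := hF0 1 zero_le_one le_rfl
  rcases h1.eq_or_lt with h1 | h1
  · have := hF1 s hs0 hs1
    rw [← h1, zero_mul] at this
    have : F s = 0 := by nlinarith
    simp [this, ← h1]
  -- The hypothesis is iterated along `s, s², s⁴, …`. Combined with the linear bound, all powers
  -- `2^n` of `F(s)/(s F(1))` stay below one constant, which forces this ratio to be at most `1`.
  have key : ∀ n : ℕ, (F s / F 1) ^ (2 ^ n) ≤ F (s ^ (2 ^ n)) / F 1 := by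
    intro n
    induction n with
    | zero => simp
    | succ n ih =>
      have hsn0 : 0 ≤ s ^ (2 ^ n) := by positivity
      have hsn1 : s ^ (2 ^ n) ≤ 1 := pow_le_one₀ hs0 hs1
      have h2 := hF1 _ hsn0 hsn1
      rw [pow_succ, pow_mul, pow_mul]
      calc ((F s / F 1) ^ 2 ^ n) ^ 2 ≤ (F (s ^ (2 ^ n)) / F 1) ^ 2 :=
            pow_le_pow_left₀ (pow_nonneg (div_nonneg (hF0 s hs0 hs1) h1.le) _) ih 2
        _ = F (s ^ (2 ^ n)) ^ 2 / F 1 / F 1 := by field_simp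
        _ ≤ F 1 * F ((s ^ (2 ^ n)) ^ 2) / F 1 / F 1 := by gcongr
        _ = F ((s ^ (2 ^ n)) ^ 2) / F 1 := by field_simp
  have key2 : ∀ n : ℕ, (F s / F 1 / s) ^ (2 ^ n) ≤ C / F 1 := by
    intro n
    have h2 := hF2 (s ^ (2 ^ n)) (by positivity) (pow_le_one₀ hs0 hs1)
    rw [div_pow _ s, div_le_iff₀ (by positivity)]
    refine (key n).trans ?_
    rw [div_mul_eq_mul_div]
    gcongr
  by_contra hcon
  push Not at hcon
  have hr : 1 < F s / F 1 / s := by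
    rw [lt_div_iff₀ hs, lt_div_iff₀ h1]; linarith
  obtain ⟨n, hn⟩ := pow_unbounded_of_one_lt (C / F 1) hr
  have h3 : (F s / F 1 / s) ^ n ≤ (F s / F 1 / s) ^ (2 ^ n) :=
    pow_le_pow_right₀ hr.le Nat.lt_two_pow_self.le
  linarith [key2 n]

section Gaussian

variable {d : ℕ}

local notation "𝔼" => EuclideanSpace ℝ (Fin d)
local notation "γ" => stdGaussian (EuclideanSpace ℝ (Fin d))

lemma integral_stdGaussian_prod_rotation' {a b : ℝ} (hab : a ^ 2 + b ^ 2 = 1)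
    (F : 𝔼 × 𝔼 → ℝ) (hF : Measurable F) :
    ∫ z, F (a • z.1 + b • z.2, -b • z.1 + a • z.2) ∂((γ).prod γ) = ∫ z, F z ∂((γ).prod γ) := by
  have hn : ‖(⟨a, b⟩ : ℂ)‖ = 1 := by
    rw [Complex.norm_def, Complex.normSq_mk, ← sq, ← sq, hab, Real.sqrt_one]
  have hne : (⟨a, b⟩ : ℂ) ≠ 0 := norm_ne_zero_iff.1 (by rw [hn]; exact one_ne_zero)
  have h := integral_stdGaussian_prod_rotation (Complex.arg ⟨a, b⟩) F hF
  simpa [Complex.cos_arg hne, Complex.sin_arg, hn] using h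

lemma integral_stdGaussian_neg (F : 𝔼 → ℝ) : ∫ x, F (-x) ∂γ = ∫ x, F x ∂γ := by
  conv_rhs => rw [← stdGaussian_map (LinearIsometryEquiv.neg ℝ (E := 𝔼))]
  exact ((LinearIsometryEquiv.neg ℝ (E := 𝔼)).toHomeomorph.measurableEmbedding.integral_map F).symm

lemma integrable_one_add_norm_sq : Integrable (fun x : 𝔼 => (1 + ‖x‖) ^ 2) γ := by
  have h2 : Integrable (fun x : 𝔼 => ‖x‖ ^ 2) γ := by
    simpa using integrable_norm_rpow_stdGaussian (d := d) (q := 2) (by norm_num)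
  have h1 : Integrable (fun x : 𝔼 => ‖x‖) γ := by
    simpa using integrable_norm_rpow_stdGaussian (d := d) (q := 1) (by norm_num)
  have : (fun x : 𝔼 => (1 + ‖x‖) ^ 2) = fun x => 1 + 2 * ‖x‖ + ‖x‖ ^ 2 := by ext; ring
  rw [this]
  exact ((integrable_const _).add (h1.const_mul 2)).add h2

lemma integrable_prod_dominating :
    Integrable (fun z : 𝔼 × 𝔼 => (1 + ‖z.1‖) ^ 2 * (1 + ‖z.2‖) ^ 2) ((γ).prod γ) :=
  integrable_one_add_norm_sq.mul_prod integrable_one_add_norm_sq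

/-- A single dominating function covers every integrand below, since each is a product of at most
two factors of linear growth. -/
lemma integrable_prod_of_bound {F : 𝔼 × 𝔼 → ℝ} (hF : Measurable F) (C : ℝ)
    (h : ∀ x y, |F (x, y)| ≤ C * ((1 + ‖x‖) ^ 2 * (1 + ‖y‖) ^ 2)) : Integrable F ((γ).prod γ) :=
  Integrable.mono' (integrable_prod_dominating.const_mul C) hF.aestronglyMeasurable
    (Filter.Eventually.of_forall fun z => h z.1 z.2)

/-- The Mehler semigroup, parametrised by the correlation `s`. -/
def mehler (s : ℝ) (G : 𝔼 → ℝ) (x : 𝔼) : ℝ := ∫ y, G (s • x + √(1 - s ^ 2) • y) ∂γ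

variable {G H : EuclideanSpace ℝ (Fin d) → ℝ} {C C' s : ℝ}

lemma norm_combination_le (hs0 : 0 ≤ s) (hs1 : s ≤ 1) (x y : 𝔼) :
    ‖s • x + √(1 - s ^ 2) • y‖ ≤ ‖x‖ + ‖y‖ := by
  have h1 : √(1 - s ^ 2) ≤ 1 := Real.sqrt_le_one.2 (by nlinarith)
  have h2 := Real.sqrt_nonneg (1 - s ^ 2)
  calc ‖s • x + √(1 - s ^ 2) • y‖ ≤ ‖s • x‖ + ‖√(1 - s ^ 2) • y‖ := norm_add_le _ _
    _ = s * ‖x‖ + √(1 - s ^ 2) * ‖y‖ := by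
      rw [norm_smul, norm_smul, Real.norm_of_nonneg hs0, Real.norm_of_nonneg h2]
    _ ≤ _ := by nlinarith [norm_nonneg x, norm_nonneg y]

lemma integrable_mul_combination (hG : Measurable G) (hH : Measurable H)
    (hGC : ∀ x, |G x| ≤ C * (1 + ‖x‖)) (hHC : ∀ x, |H x| ≤ C' * (1 + ‖x‖))
    (hC : 0 ≤ C) (hC' : 0 ≤ C') (hs0 : 0 ≤ s) (hs1 : s ≤ 1) :
    Integrable (fun z : 𝔼 × 𝔼 => G z.1 * H (s • z.1 + √(1 - s ^ 2) • z.2)) ((γ).prod γ) := by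
  refine integrable_prod_of_bound (by fun_prop) (C * C') fun x y => ?_
  rw [abs_mul]
  have h1 := norm_combination_le hs0 hs1 x y
  have hx := norm_nonneg x
  have hy := norm_nonneg y
  calc |G x| * |H (s • x + √(1 - s ^ 2) • y)|
      ≤ (C * (1 + ‖x‖)) * (C' * (1 + (‖x‖ + ‖y‖))) := by
        refine mul_le_mul (hGC x) ((hHC _).trans ?_) (abs_nonneg _) (by positivity)
        gcongr
    _ = C * C' * ((1 + ‖x‖) * (1 + (‖x‖ + ‖y‖))) := by ring
    _ ≤ C * C' * ((1 + ‖x‖) ^ 2 * (1 + ‖y‖) ^ 2) := by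
        refine mul_le_mul_of_nonneg_left ?_ (mul_nonneg hC hC')
        have : 1 + (‖x‖ + ‖y‖) ≤ (1 + ‖x‖) * (1 + ‖y‖) := by nlinarith
        calc (1 + ‖x‖) * (1 + (‖x‖ + ‖y‖)) ≤ (1 + ‖x‖) * ((1 + ‖x‖) * (1 + ‖y‖)) := by gcongr
          _ = ((1 + ‖x‖) ^ 2 * (1 + ‖y‖)) * 1 := by ring
          _ ≤ ((1 + ‖x‖) ^ 2 * (1 + ‖y‖)) * (1 + ‖y‖) := by gcongr; linarith
          _ = _ := by ring

lemma integral_mul_mehler (hG : Measurable G) (hH : Measurable H)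
    (hGC : ∀ x, |G x| ≤ C * (1 + ‖x‖)) (hHC : ∀ x, |H x| ≤ C' * (1 + ‖x‖))
    (hC : 0 ≤ C) (hC' : 0 ≤ C') (hs0 : 0 ≤ s) (hs1 : s ≤ 1) :
    ∫ x, G x * mehler s H x ∂γ =
      ∫ z : 𝔼 × 𝔼, G z.1 * H (s • z.1 + √(1 - s ^ 2) • z.2) ∂((γ).prod γ) := by
  rw [integral_prod _ (integrable_mul_combination hG hH hGC hHC hC hC' hs0 hs1)]
  simp only [mehler, integral_const_mul]

lemma measurable_mehler (hG : Measurable G) : Measurable (mehler s G) := by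
  have : StronglyMeasurable fun z : 𝔼 × 𝔼 => G (s • z.1 + √(1 - s ^ 2) • z.2) :=
    Measurable.stronglyMeasurable (by fun_prop)
  exact this.integral_prod_right.measurable

lemma mehler_bound (hGC : ∀ x, |G x| ≤ C * (1 + ‖x‖)) (hC : 0 ≤ C)
    (hs0 : 0 ≤ s) (hs1 : s ≤ 1) :
    ∃ C', 0 ≤ C' ∧ ∀ x, |mehler s G x| ≤ C' * (1 + ‖x‖) := by
  have hint : Integrable (fun y : 𝔼 => (1 + ‖y‖)) γ := by
    have h1 : Integrable (fun x : 𝔼 => ‖x‖) γ := by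
      simpa using integrable_norm_rpow_stdGaussian (d := d) (q := 1) (by norm_num)
    exact (integrable_const _).add h1
  refine ⟨C * ∫ y, (1 + ‖y‖) ∂γ, mul_nonneg hC (integral_nonneg fun y => by positivity),
    fun x => ?_⟩
  have h := norm_integral_le_of_norm_le (μ := γ) (f := fun y => G (s • x + √(1 - s ^ 2) • y))
    (hint.const_mul (C * (1 + ‖x‖))) (Filter.Eventually.of_forall fun y => by
      have h1 := norm_combination_le hs0 hs1 x y
      have hx := norm_nonneg x
      have hy := norm_nonneg y
      calc ‖G (s • x + √(1 - s ^ 2) • y)‖ ≤ C * (1 + (‖x‖ + ‖y‖)) := (hGC _).trans (by gcongr)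
        _ ≤ C * ((1 + ‖x‖) * (1 + ‖y‖)) := by gcongr; nlinarith
        _ = _ := by ring)
  rw [integral_const_mul] at h
  calc |mehler s G x| ≤ _ := h
    _ = _ := by ring

/-- Self-adjointness of the Mehler operators. The pair `(x, s x + √(1-s²) y)` is exchangeable: a
planar rotation moves its second entry to the first slot, and the sign left in front of `y` is
removed by the symmetry of the Gaussian. -/
lemma integral_mul_mehler_comm (hG : Measurable G) (hH : Measurable H)
    (hGC : ∀ x, |G x| ≤ C * (1 + ‖x‖)) (hHC : ∀ x, |H x| ≤ C' * (1 + ‖x‖))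
    (hC : 0 ≤ C) (hC' : 0 ≤ C') (hs0 : 0 ≤ s) (hs1 : s ≤ 1) :
    ∫ x, G x * mehler s H x ∂γ = ∫ x, H x * mehler s G x ∂γ := by
  have hsq : √(1 - s ^ 2) ^ 2 = 1 - s ^ 2 := Real.sq_sqrt (by nlinarith)
  rw [integral_mul_mehler hG hH hGC hHC hC hC' hs0 hs1]
  have h1 := integral_stdGaussian_prod_rotation' (d := d) (a := s) (b := √(1 - s ^ 2))
    (by rw [hsq]; ring) (fun z => H z.1 * G (s • z.1 - √(1 - s ^ 2) • z.2)) (by fun_prop)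
  have h2 : ∀ z : 𝔼 × 𝔼, s • (s • z.1 + √(1 - s ^ 2) • z.2) -
      √(1 - s ^ 2) • (-√(1 - s ^ 2) • z.1 + s • z.2) = z.1 := by
    intro z
    have : s • (s • z.1 + √(1 - s ^ 2) • z.2) - √(1 - s ^ 2) • (-√(1 - s ^ 2) • z.1 + s • z.2) =
      (s ^ 2 + √(1 - s ^ 2) ^ 2) • z.1 := by module
    rw [this, hsq, add_sub_cancel, one_smul]
  simp only [h2] at h1
  have hi : Integrable (fun z : 𝔼 × 𝔼 => H z.1 * G (s • z.1 - √(1 - s ^ 2) • z.2)) ((γ).prod γ) := by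
    have := integrable_mul_combination hH hG hHC hGC hC' hC hs0 hs1
    have hmp : MeasurePreserving (Prod.map id (fun y : 𝔼 => -y)) ((γ).prod γ) ((γ).prod γ) :=
      (MeasurePreserving.id _).prod ⟨measurable_neg,
        stdGaussian_map (LinearIsometryEquiv.neg ℝ (E := 𝔼))⟩
    have h3 := hmp.integrable_comp_of_integrable this
    simpa [Function.comp_def, sub_eq_add_neg] using h3
  simp_rw [mul_comm (G _)]
  rw [h1, integral_prod _ hi]
  congr 1; ext x
  rw [mehler, ← integral_stdGaussian_neg, ← integral_const_mul]
  simp [sub_eq_add_neg]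

/-- The two independent noises `s c y` and `c w`, with `c² = 1 - s²`, add up to one Gaussian of
variance `s²c² + c² = 1 - s⁴`. A rotation aligns their sum with a single coordinate. -/
lemma mehler_mehler (hG : Measurable G) (hGC : ∀ x, |G x| ≤ C * (1 + ‖x‖)) (hC : 0 ≤ C)
    (hs0 : 0 ≤ s) (hs1 : s ≤ 1) (x : 𝔼) :
    mehler s (mehler s G) x = mehler (s ^ 2) G x := by
  -- At `s = 1` the noise vanishes and the rotation below would divide by zero.
  rcases hs1.eq_or_lt with rfl | hs1'
  · simp [mehler]
  set c := √(1 - s ^ 2) with hc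
  set c' := √(1 - (s ^ 2) ^ 2) with hc'
  have hc2 : c ^ 2 = 1 - s ^ 2 := Real.sq_sqrt (by nlinarith)
  have hc2' : c' ^ 2 = 1 - (s ^ 2) ^ 2 := Real.sq_sqrt (by nlinarith [sq_nonneg s, pow_le_one₀ (n := 2) hs0 hs1])
  have hc0 : 0 < c' := Real.sqrt_pos.2 (by nlinarith [sq_nonneg s])
  have h1 := integral_stdGaussian_prod_rotation' (d := d) (a := s * c / c') (b := c / c')
    (by field_simp; rw [hc2, hc2']; ring) (fun z => G (s ^ 2 • x + c' • z.1)) (by fun_prop)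
  have h2 : ∀ z : 𝔼 × 𝔼, c' • ((s * c / c') • z.1 + (c / c') • z.2) = (s * c) • z.1 + c • z.2 := by
    intro z
    rw [smul_add, smul_smul, smul_smul, mul_div_cancel₀ _ hc0.ne', mul_div_cancel₀ _ hc0.ne']
  simp only [h2] at h1
  have hi : Integrable (fun z : 𝔼 × 𝔼 => G (s ^ 2 • x + ((s * c) • z.1 + c • z.2))) ((γ).prod γ) := by
    refine integrable_prod_of_bound (by fun_prop) (C * (1 + ‖x‖)) fun y w => ?_
    have h3 : s ^ 2 • x + ((s * c) • y + c • w) = s • (s • x + c • y) + c • w := by module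
    have h4 := norm_combination_le hs0 hs1 (s • x + c • y) w
    have h5 := norm_combination_le hs0 hs1 x y
    have hx := norm_nonneg x
    have hy := norm_nonneg y
    have hw := norm_nonneg w
    calc |G (s ^ 2 • x + ((s * c) • y + c • w))| ≤ C * (1 + (‖x‖ + ‖y‖ + ‖w‖)) := by
          rw [h3]
          refine (hGC _).trans ?_
          gcongr
          linarith
      _ ≤ C * ((1 + ‖x‖) * ((1 + ‖y‖) ^ 2 * (1 + ‖w‖) ^ 2)) := by
          refine mul_le_mul_of_nonneg_left ?_ hC
          have h6 : (1 + ‖y‖) * (1 + ‖w‖) ≤ ((1 + ‖y‖) * (1 + ‖w‖)) ^ 2 := by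
            refine le_self_pow₀ ?_ two_ne_zero
            nlinarith [mul_nonneg hy hw]
          calc 1 + (‖x‖ + ‖y‖ + ‖w‖) ≤ (1 + ‖x‖) * ((1 + ‖y‖) * (1 + ‖w‖)) := by
                nlinarith [mul_nonneg hy hw, mul_nonneg hx hw, mul_nonneg hx hy,
                  mul_nonneg hx (mul_nonneg hy hw)]
            _ ≤ (1 + ‖x‖) * ((1 + ‖y‖) * (1 + ‖w‖)) ^ 2 := by gcongr
            _ = _ := by ring
      _ = _ := by ring
  rw [integral_prod _ hi] at h1
  have h3 : ∫ z : 𝔼 × 𝔼, G (s ^ 2 • x + c' • z.1) ∂((γ).prod γ) = mehler (s ^ 2) G x := by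
    rw [integral_fun_fst (fun y => G (s ^ 2 • x + c' • y))]
    simp [mehler, hc']
  rw [← h3, ← h1]
  simp only [mehler, ← hc]
  congr 1; ext y; congr 1; ext w; congr 1; module

lemma memLp_two_of_linear_growth (hG : Measurable G) (hGC : ∀ x, |G x| ≤ C * (1 + ‖x‖)) :
    MemLp G 2 γ := by
  have h1 : MemLp (fun x : 𝔼 => 1 + ‖x‖) 2 γ := by
    rw [memLp_two_iff_integrable_sq (by fun_prop)]
    exact integrable_one_add_norm_sq
  refine h1.of_le_mul (c := C) hG.aestronglyMeasurable (Filter.Eventually.of_forall fun x => ?_)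
  rw [Real.norm_eq_abs, Real.norm_of_nonneg (by positivity : (0 : ℝ) ≤ 1 + ‖x‖)]
  exact hGC x

lemma sq_integral_mul_le {α : Type*} [MeasurableSpace α] {μ : Measure α} {f g : α → ℝ}
    (hf : MemLp f 2 μ) (hg : MemLp g 2 μ) :
    (∫ x, f x * g x ∂μ) ^ 2 ≤ (∫ x, f x ^ 2 ∂μ) * ∫ x, g x ^ 2 ∂μ := by
  have hcs := integral_mul_le_Lp_mul_Lq_of_nonneg (μ := μ) Real.HolderConjugate.two_two
    (f := fun x => |f x|) (g := fun x => |g x|)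
    (Filter.Eventually.of_forall fun x => abs_nonneg _)
    (Filter.Eventually.of_forall fun x => abs_nonneg _)
    (by rw [ENNReal.ofReal_ofNat]; exact hf.abs) (by rw [ENNReal.ofReal_ofNat]; exact hg.abs)
  have habs : |∫ x, f x * g x ∂μ| ≤ ∫ x, |f x| * |g x| ∂μ := by
    refine (abs_integral_le_integral_abs).trans (le_of_eq ?_)
    simp [abs_mul]
  simp only [Real.rpow_two, sq_abs, ← Real.sqrt_eq_rpow] at hcs
  calc (∫ x, f x * g x ∂μ) ^ 2 = |∫ x, f x * g x ∂μ| ^ 2 := (sq_abs _).symm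
    _ ≤ (√(∫ x, f x ^ 2 ∂μ) * √(∫ x, g x ^ 2 ∂μ)) ^ 2 := by gcongr; exact habs.trans hcs
    _ = _ := by
      rw [mul_pow, Real.sq_sqrt (integral_nonneg fun x => sq_nonneg _),
        Real.sq_sqrt (integral_nonneg fun x => sq_nonneg _)]

/-- Oddness makes the Gaussian average of `G(√(1-s²) y)` vanish. Subtracting it leaves an increment
over a displacement of length `s‖x‖`. -/
lemma mehler_abs_le_of_lipschitz_odd {K : NNReal} (hG : LipschitzWith K G)
    (hodd : ∀ x, G (-x) = -G x) (hs0 : 0 ≤ s) (x : 𝔼) : |mehler s G x| ≤ K * s * ‖x‖ := by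
  have hGc := hG.continuous
  have hGm : Measurable G := hG.continuous.measurable
  have hG0 : G 0 = 0 := by have := hodd 0; rw [neg_zero] at this; linarith
  have hGK : ∀ x, |G x| ≤ K * ‖x‖ := fun x => by
    have := hG.dist_le_mul x 0
    simpa [hG0, Real.dist_eq] using this
  have hmean : ∫ y, G (√(1 - s ^ 2) • y) ∂γ = 0 := by
    have := integral_stdGaussian_neg (d := d) (fun y => G (√(1 - s ^ 2) • y))
    simp only [smul_neg, hodd, integral_neg] at this
    linarith
  have hi : ∀ u : 𝔼, Integrable (fun y => G (u + √(1 - s ^ 2) • y)) γ := by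
    intro u
    have h1 : Integrable (fun x : 𝔼 => ‖x‖) γ := by
      simpa using integrable_norm_rpow_stdGaussian (d := d) (q := 1) (by norm_num)
    refine Integrable.mono' (((integrable_const ‖u‖).add (h1.const_mul √(1 - s ^ 2))).const_mul
      (K : ℝ)) (by fun_prop) (Filter.Eventually.of_forall fun y => (hGK _).trans ?_)
    simp only [Pi.add_apply]
    gcongr
    refine (norm_add_le _ _).trans ?_
    rw [norm_smul, Real.norm_of_nonneg (Real.sqrt_nonneg _)]
  have : mehler s G x = ∫ y, (G (s • x + √(1 - s ^ 2) • y) - G (0 + √(1 - s ^ 2) • y)) ∂γ := by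
    rw [integral_sub (hi _) (hi _)]
    simp [hmean, mehler]
  rw [this]
  have hle : ∀ y, ‖G (s • x + √(1 - s ^ 2) • y) - G (0 + √(1 - s ^ 2) • y)‖ ≤ K * s * ‖x‖ := by
    intro y
    refine (hG.norm_sub_le _ _).trans (le_of_eq ?_)
    rw [zero_add, add_sub_cancel_right, norm_smul, Real.norm_of_nonneg hs0, mul_assoc]
  simpa using norm_integral_le_of_norm_le_const (μ := γ) (Filter.Eventually.of_forall hle)

/-- The correlation of `G` along the Mehler semigroup is sublinear for odd Lipschitz `G`. -/
lemma integral_mul_mehler_le {K : NNReal} (hG : LipschitzWith K G) (hodd : ∀ x, G (-x) = -G x)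
    (hs0 : 0 ≤ s) (hs1 : s ≤ 1) :
    ∫ x, G x * mehler s G x ∂γ ≤ s * ∫ x, G x ^ 2 ∂γ := by
  have hGm : Measurable G := hG.continuous.measurable
  have hG0 : G 0 = 0 := by have := hodd 0; rw [neg_zero] at this; linarith
  have hGK : ∀ x, |G x| ≤ K * ‖x‖ := fun x => by
    have := hG.dist_le_mul x 0
    simpa [hG0, Real.dist_eq] using this
  have hGC : ∀ x, |G x| ≤ K * (1 + ‖x‖) := fun x => (hGK x).trans (by gcongr; linarith)
  have hK : (0 : ℝ) ≤ K := K.2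
  -- Self-adjointness and the semigroup law identify the squared `L²` norm at `t` with the
  -- correlation at `t²`. This gives both the nonnegativity of the correlation and, by
  -- Cauchy–Schwarz, its self-improving inequality.
  have hsq : ∀ t, 0 ≤ t → t ≤ 1 → ∫ x, mehler t G x ^ 2 ∂γ = ∫ x, G x * mehler (t ^ 2) G x ∂γ := by
    intro t ht0 ht1
    obtain ⟨C', hC', hb⟩ := mehler_bound (s := t) hGC hK ht0 ht1
    have := integral_mul_mehler_comm hGm (measurable_mehler (s := t) hGm) hGC hb hK hC' ht0 ht1
    simp only [mehler_mehler hGm hGC hK ht0 ht1] at this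
    rw [this]
    simp [sq]
  have h1 : ∀ x, mehler 1 G x = G x := fun x => by simp [mehler]
  have main := le_mul_of_sq_le_of_le_mul (F := fun t => ∫ x, G x * mehler t G x ∂γ)
    (C := K ^ 2 * d) (s := s) ?_ ?_ ?_ hs0 hs1
  · simpa [h1, sq] using main
  · intro t ht0 ht1
    have := hsq (√t) (Real.sqrt_nonneg _) (Real.sqrt_le_one.2 ht1)
    rw [Real.sq_sqrt ht0] at this
    rw [← this]
    exact integral_nonneg fun x => sq_nonneg _
  · intro t ht0 ht1
    obtain ⟨C', hC', hb⟩ := mehler_bound (s := t) hGC hK ht0 ht1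
    simp only [h1, ← hsq t ht0 ht1]
    have := memLp_two_of_linear_growth (measurable_mehler (s := t) hGm) hb
    have hcs := sq_integral_mul_le (memLp_two_of_linear_growth hGm hGC) this
    simpa only [sq] using hcs
  · intro t ht0 ht1
    have hn2 : Integrable (fun x : 𝔼 => ‖x‖ ^ 2) γ := by
      simpa using integrable_norm_rpow_stdGaussian (d := d) (q := 2) (by norm_num)
    have hpt : ∀ x : 𝔼, |G x * mehler t G x| ≤ K ^ 2 * t * ‖x‖ ^ 2 := fun x => by
      rw [abs_mul]
      calc |G x| * |mehler t G x| ≤ (K * ‖x‖) * (K * t * ‖x‖) :=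
            mul_le_mul (hGK x) (mehler_abs_le_of_lipschitz_odd hG hodd ht0 x) (abs_nonneg _)
              (by positivity)
        _ = _ := by ring
    calc ∫ x, G x * mehler t G x ∂γ ≤ ∫ x : 𝔼, K ^ 2 * t * ‖x‖ ^ 2 ∂γ := by
          refine (le_abs_self _).trans ?_
          exact norm_integral_le_of_norm_le (f := fun x => G x * mehler t G x) (hn2.const_mul _)
            (Filter.Eventually.of_forall hpt)
      _ = K ^ 2 * d * t := by rw [integral_const_mul, integral_norm_sq_stdGaussian]; ring

lemma integral_snd_combination {F : 𝔼 → ℝ} (hF : Measurable F) {a b : ℝ}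
    (hab : a ^ 2 + b ^ 2 = 1) : ∫ z : 𝔼 × 𝔼, F (a • z.1 + b • z.2) ∂((γ).prod γ) = ∫ x, F x ∂γ := by
  rw [integral_stdGaussian_prod_rotation' hab (fun z => F z.1) (by fun_prop), integral_fun_fst]
  simp

/-- The Poincaré inequality before passing to the limit: in the expanded square both pure terms
equal `∫ G²` by rotation invariance, and the mixed term is the Mehler correlation at `s = cos θ`. -/
lemma integral_sq_le_integral_sub_sq {K : NNReal} (hG : LipschitzWith K G)
    (hodd : ∀ x, G (-x) = -G x) {θ : ℝ} (hθ0 : 0 ≤ θ) (hθ1 : θ ≤ 1) :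
    2 * (1 - Real.cos θ) * ∫ x, G x ^ 2 ∂γ ≤
      ∫ z : 𝔼 × 𝔼, (G (Real.cos θ • z.1 + Real.sin θ • z.2) - G z.1) ^ 2 ∂((γ).prod γ) := by
  have hGm : Measurable G := hG.continuous.measurable
  have hG0 : G 0 = 0 := by have := hodd 0; rw [neg_zero] at this; linarith
  have hK : (0 : ℝ) ≤ K := K.2
  have hGC : ∀ x, |G x| ≤ K * (1 + ‖x‖) := fun x => by
    have := hG.dist_le_mul x 0
    rw [hG0, dist_zero_right, dist_zero_right, Real.norm_eq_abs] at this
    refine this.trans ?_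
    gcongr; linarith
  have hc0 : 0 ≤ Real.cos θ := Real.cos_nonneg_of_mem_Icc ⟨by linarith [Real.pi_gt_three],
    by linarith [Real.pi_gt_three]⟩
  have hc1 := Real.cos_le_one θ
  have hs0 : 0 ≤ Real.sin θ := Real.sin_nonneg_of_nonneg_of_le_pi hθ0 (by linarith [Real.pi_gt_three])
  have hss : √(1 - Real.cos θ ^ 2) = Real.sin θ := by
    rw [← Real.sin_sq, Real.sqrt_sq hs0]
  have hmain := integral_mul_mehler_le hG hodd hc0 hc1
  rw [integral_mul_mehler hGm hGm hGC hGC hK hK hc0 hc1, hss] at hmain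
  have hi1 := integrable_mul_combination hGm hGm hGC hGC hK hK hc0 hc1
  rw [hss] at hi1
  have hL := memLp_two_of_linear_growth hGm hGC
  have hi2 : Integrable (fun z : 𝔼 × 𝔼 => G z.1 ^ 2) ((γ).prod γ) := hL.integrable_sq.comp_fst _
  have hi3 : Integrable (fun z : 𝔼 × 𝔼 => G (Real.cos θ • z.1 + Real.sin θ • z.2) ^ 2)
      ((γ).prod γ) := by
    have h1 := (hL.comp_fst γ).integrable_sq
    have hmp : MeasurePreserving (ContinuousLinearMap.rotation (E := 𝔼) θ) ((γ).prod γ)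
      ((γ).prod γ) := ⟨by fun_prop, IsGaussian.map_rotation_eq_self (by simp) θ⟩
    exact hmp.integrable_comp_of_integrable h1
  have e : ∀ z : 𝔼 × 𝔼, (G (Real.cos θ • z.1 + Real.sin θ • z.2) - G z.1) ^ 2 =
      G (Real.cos θ • z.1 + Real.sin θ • z.2) ^ 2 + G z.1 ^ 2 -
        2 * (G z.1 * G (Real.cos θ • z.1 + Real.sin θ • z.2)) := fun z => by ring
  have hi4 : Integrable (fun z : 𝔼 × 𝔼 => G (Real.cos θ • z.1 + Real.sin θ • z.2) ^ 2 + G z.1 ^ 2)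
      ((γ).prod γ) := hi3.add hi2
  simp_rw [e]
  rw [integral_sub hi4 (hi1.const_mul 2), integral_add hi3 hi2, integral_const_mul,
    integral_snd_combination (F := fun x => G x ^ 2) (by fun_prop) (Real.cos_sq_add_sin_sq θ),
    integral_fun_fst (fun x => G x ^ 2)]
  simp only [probReal_univ, one_smul]
  linarith

lemma stdGaussian_absolutelyContinuous : γ ≪ (volume : Measure 𝔼) := by
  rw [stdGaussian_eq_withDensity]
  exact withDensity_absolutelyContinuous _ _

/-- The **Gaussian Poincaré inequality** for odd Lipschitz functions. -/
lemma integral_sq_le_integral_fderiv_sq {K : NNReal} (hG : LipschitzWith K G)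
    (hodd : ∀ x, G (-x) = -G x) :
    ∫ x, G x ^ 2 ∂γ ≤ ∫ x, ‖fderiv ℝ G x‖ ^ 2 ∂γ := by
  have hGm : Measurable G := hG.continuous.measurable
  have hGc := hG.continuous
  -- Squared difference quotients along the rotation by angle `1/(n+1)`, whose initial velocity is
  -- `z.2`. By Rademacher's theorem they converge almost everywhere to the squared derivative of `G`
  -- at `z.1` in the direction `z.2`.
  set F : ℕ → 𝔼 × 𝔼 → ℝ := fun n z =>
    (((n : ℝ) + 1) * (G (Real.cos (1 / ((n : ℝ) + 1)) • z.1 + Real.sin (1 / ((n : ℝ) + 1)) • z.2)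
      - G z.1)) ^ 2 with hF
  have hdiff : ∀ᵐ x ∂γ, DifferentiableAt ℝ G x :=
    stdGaussian_absolutelyContinuous.ae_le hG.ae_differentiableAt
  have hdiff2 : ∀ᵐ z ∂((γ).prod γ), DifferentiableAt ℝ G z.1 :=
    (Measure.quasiMeasurePreserving_fst).ae hdiff
  have hθ : ∀ n : ℕ, 0 ≤ 1 / ((n : ℝ) + 1) ∧ 1 / ((n : ℝ) + 1) ≤ 1 := fun n =>
    ⟨by positivity, by rw [div_le_one (by positivity)]; linarith [(Nat.cast_nonneg n : (0 : ℝ) ≤ n)]⟩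
  have hlim : Filter.Tendsto (fun n => ∫ z, F n z ∂((γ).prod γ)) Filter.atTop
      (nhds (∫ z : 𝔼 × 𝔼, (fderiv ℝ G z.1 z.2) ^ 2 ∂((γ).prod γ))) := by
    refine tendsto_integral_of_dominated_convergence
      (fun z => (K : ℝ) ^ 2 * ((1 + ‖z.1‖) ^ 2 * (1 + ‖z.2‖) ^ 2)) (fun n => ?_)
      (integrable_prod_dominating.const_mul _) (fun n => ?_) ?_
    · exact Measurable.aestronglyMeasurable (by fun_prop)
    · refine Filter.Eventually.of_forall fun z => ?_
      obtain ⟨h0, h1⟩ := hθ n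
      set θ : ℝ := 1 / ((n : ℝ) + 1) with hθd
      have hn : ((n : ℝ) + 1) * θ = 1 := by rw [hθd]; field_simp
      have hsin : |Real.sin θ| ≤ θ := (Real.abs_sin_le_abs).trans (abs_of_nonneg h0).le
      have hcos : |Real.cos θ - 1| ≤ θ := by
        rw [abs_sub_comm, abs_of_nonneg (by linarith [Real.cos_le_one θ])]
        nlinarith [Real.one_sub_sq_div_two_le_cos (x := θ)]
      have h2 : |G (Real.cos θ • z.1 + Real.sin θ • z.2) - G z.1| ≤ K * (θ * (‖z.1‖ + ‖z.2‖)) := by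
        refine (hG.norm_sub_le _ _).trans ?_
        gcongr
        have : Real.cos θ • z.1 + Real.sin θ • z.2 - z.1 =
          (Real.cos θ - 1) • z.1 + Real.sin θ • z.2 := by module
        rw [this]
        refine (norm_add_le _ _).trans ?_
        rw [norm_smul, norm_smul, Real.norm_eq_abs, Real.norm_eq_abs, mul_add]
        gcongr
      have h3 : |((n : ℝ) + 1) * (G (Real.cos θ • z.1 + Real.sin θ • z.2) - G z.1)| ≤
          K * (‖z.1‖ + ‖z.2‖) := by
        rw [abs_mul, abs_of_nonneg (by positivity : (0 : ℝ) ≤ (n : ℝ) + 1)]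
        calc ((n : ℝ) + 1) * |G (Real.cos θ • z.1 + Real.sin θ • z.2) - G z.1|
            ≤ ((n : ℝ) + 1) * (K * (θ * (‖z.1‖ + ‖z.2‖))) := by gcongr
          _ = ((n : ℝ) + 1) * θ * (K * (‖z.1‖ + ‖z.2‖)) := by ring
          _ = _ := by rw [hn, one_mul]
      have h4 : ‖z.1‖ + ‖z.2‖ ≤ (1 + ‖z.1‖) * (1 + ‖z.2‖) := by
        nlinarith [norm_nonneg z.1, norm_nonneg z.2, mul_nonneg (norm_nonneg z.1) (norm_nonneg z.2)]
      rw [hF, Real.norm_of_nonneg (sq_nonneg _), ← sq_abs, ← mul_pow, ← mul_pow]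
      refine pow_le_pow_left₀ (abs_nonneg _) (h3.trans ?_) 2
      gcongr
    · filter_upwards [hdiff2] with z hz
      have hder : HasDerivAt (fun t : ℝ => G (Real.cos t • z.1 + Real.sin t • z.2))
          (fderiv ℝ G z.1 z.2) 0 := by
        have hcurve : HasDerivAt (fun t : ℝ => Real.cos t • z.1 + Real.sin t • z.2) z.2 0 := by
          have := ((Real.hasDerivAt_cos 0).smul_const z.1).fun_add ((Real.hasDerivAt_sin 0).smul_const z.2)
          simpa using this
        have hfd : HasFDerivAt G (fderiv ℝ G z.1) (Real.cos 0 • z.1 + Real.sin 0 • z.2) := by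
          simpa using hz.hasFDerivAt
        exact hfd.comp_hasDerivAt 0 hcurve
      have hseq : Filter.Tendsto (fun n : ℕ => 1 / ((n : ℝ) + 1)) Filter.atTop (nhdsWithin 0 {0}ᶜ) := by
        refine tendsto_nhdsWithin_iff.2 ⟨tendsto_one_div_add_atTop_nhds_zero_nat, ?_⟩
        exact Filter.Eventually.of_forall fun n => by
          simp only [Set.mem_compl_iff, Set.mem_singleton_iff]; positivity
      have := (hasDerivAt_iff_tendsto_slope.1 hder).comp hseq
      refine (this.pow 2).congr fun n => ?_
      simp [slope, hF]
  -- Taylor's bound gives `2(1 - cos θ) ≥ θ² - (5/48) θ⁴`; dividing by `θ²` leaves a factor tending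
  -- to `1`.
  have hlow : ∀ n : ℕ, (1 - 5 / 48 * (1 / ((n : ℝ) + 1)) ^ 2) * ∫ x, G x ^ 2 ∂γ ≤
      ∫ z, F n z ∂((γ).prod γ) := by
    intro n
    obtain ⟨h0, h1⟩ := hθ n
    have := integral_sq_le_integral_sub_sq hG hodd h0 h1
    simp only [hF, mul_pow, integral_const_mul]
    set θ : ℝ := 1 / ((n : ℝ) + 1) with hθd
    have hn : ((n : ℝ) + 1) * θ = 1 := by rw [hθd]; field_simp
    have hcos := (abs_le.1 (Real.cos_bound (x := θ) (by rw [abs_of_nonneg h0]; exact h1))).2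
    rw [abs_of_nonneg h0] at hcos
    have hI : 0 ≤ ∫ x, G x ^ 2 ∂γ := integral_nonneg fun x => sq_nonneg _
    calc (1 - 5 / 48 * θ ^ 2) * ∫ x, G x ^ 2 ∂γ
        = ((n : ℝ) + 1) ^ 2 * ((θ ^ 2 - 5 / 48 * θ ^ 4) * ∫ x, G x ^ 2 ∂γ) := by
          linear_combination (-(((n : ℝ) + 1) * θ + 1) * (1 - 5 / 48 * θ ^ 2) *
            ∫ x, G x ^ 2 ∂γ) * hn
      _ ≤ ((n : ℝ) + 1) ^ 2 * (2 * (1 - Real.cos θ) * ∫ x, G x ^ 2 ∂γ) := by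
          gcongr
          linarith
      _ ≤ _ := by gcongr
  have hlim2 : Filter.Tendsto (fun n : ℕ => (1 - 5 / 48 * (1 / ((n : ℝ) + 1)) ^ 2) *
      ∫ x, G x ^ 2 ∂γ) Filter.atTop (nhds ((1 - 5 / 48 * (0 : ℝ) ^ 2) * ∫ x, G x ^ 2 ∂γ)) :=
    ((tendsto_one_div_add_atTop_nhds_zero_nat.pow 2).const_mul _ |>.const_sub _).mul_const _
  have h1 := le_of_tendsto_of_tendsto' hlim2 hlim hlow
  norm_num at h1
  refine h1.trans (le_of_eq ?_)
  have hfm : Measurable fun z : 𝔼 × 𝔼 => (fderiv ℝ G z.1 z.2) ^ 2 := by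
    have : Measurable fun z : 𝔼 × 𝔼 => fderiv ℝ G z.1 z.2 := by
      have h1 : Measurable fun z : 𝔼 × 𝔼 => (fderiv ℝ G z.1, z.2) :=
        ((measurable_fderiv ℝ G).comp measurable_fst).prodMk measurable_snd
      exact (isBoundedBilinearMap_apply (𝕜 := ℝ) (E := 𝔼) (F := ℝ)).continuous.measurable.comp h1
    exact this.pow_const 2
  have hbd : ∀ x, ‖fderiv ℝ G x‖ ≤ K := fun x => norm_fderiv_le_of_lipschitz ℝ hG
  have hfi : Integrable (fun z : 𝔼 × 𝔼 => (fderiv ℝ G z.1 z.2) ^ 2) ((γ).prod γ) := by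
    refine integrable_prod_of_bound hfm ((K : ℝ) ^ 2) fun x y => ?_
    have h2 : |fderiv ℝ G x y| ≤ K * ‖y‖ := by
      refine ((fderiv ℝ G x).le_opNorm y).trans ?_
      gcongr
      exact hbd x
    rw [abs_pow, ← mul_pow, ← mul_pow]
    refine pow_le_pow_left₀ (abs_nonneg _) (h2.trans ?_) 2
    gcongr
    nlinarith [norm_nonneg x, norm_nonneg y, mul_nonneg (norm_nonneg x) (norm_nonneg y)]
  rw [integral_prod _ hfi]
  congr 1; ext x
  -- Averaging the squared linear form over the Gaussian direction returns the squared norm of the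
  -- gradient.
  have := integral_inner_sq_stdGaussian (gradient G x)
  simp only [gradient, InnerProductSpace.toDual_symm_apply, LinearIsometryEquiv.norm_map] at this
  exact this

end Gaussian

end ZORSMD

end

/-! ### From the Gaussian to the spherical Poincaré inequality. -/

noncomputable section

namespace ZORSMD

section SpherePoincare

variable {d : ℕ} {v ℓ : EuclideanSpace ℝ (Fin d) → ℝ} {C : ℝ}

local notation "𝔼" => EuclideanSpace ℝ (Fin d)

/-- The positively homogeneous extension of degree one of a function on the unit sphere. -/
def homExt (v : 𝔼 → ℝ) (x : 𝔼) : ℝ := ‖x‖ * v (‖x‖⁻¹ • x)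

lemma norm_normalize {x : 𝔼} (hx : x ≠ 0) : ‖‖x‖⁻¹ • x‖ = 1 := by
  rw [norm_smul, norm_inv, norm_norm, inv_mul_cancel₀ (norm_ne_zero_iff.2 hx)]

lemma norm_mul_norm_normalize_sub_le {x y : 𝔼} (hx : x ≠ 0) (hy : y ≠ 0) :
    ‖x‖ * ‖‖x‖⁻¹ • x - ‖y‖⁻¹ • y‖ ≤ 2 * ‖x - y‖ := by
  have hx' : ‖x‖ ≠ 0 := norm_ne_zero_iff.2 hx
  have hy' : ‖y‖ ≠ 0 := norm_ne_zero_iff.2 hy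
  have h1 : ‖x‖ * ‖‖x‖⁻¹ • x - ‖y‖⁻¹ • y‖ = ‖‖x‖ • (‖x‖⁻¹ • x - ‖y‖⁻¹ • y)‖ := by
    rw [norm_smul, norm_norm]
  have h2 : ‖x‖ • (‖x‖⁻¹ • x - ‖y‖⁻¹ • y) = (x - y) + (‖y‖ - ‖x‖) • (‖y‖⁻¹ • y) := by
    rw [smul_sub, smul_inv_smul₀ hx', sub_smul, smul_inv_smul₀ hy']
    abel
  rw [h1, h2]
  refine (norm_add_le _ _).trans ?_
  rw [norm_smul, norm_normalize hy, mul_one, Real.norm_eq_abs, norm_sub_rev x y]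
  linarith [abs_norm_sub_norm_le y x]

variable (hodd : ∀ e, ‖e‖ = 1 → v (-e) = -v e)
  (hℓC : ∀ e, ‖e‖ = 1 → 0 ≤ ℓ e ∧ ℓ e ≤ C)
  (hv : ∀ e e', ‖e‖ = 1 → ‖e'‖ = 1 → |v e' - v e| ≤ (ℓ e + C * ‖e' - e‖) * ‖e' - e‖)

include hodd hℓC hv

/-- Comparison with the antipode: oddness turns the increment into `2 v(e)`, and at distance `2` the
local bound is at most `(C + 2C)·2`. -/
lemma abs_le_of_local_lipschitz {e : 𝔼} (he : ‖e‖ = 1) : |v e| ≤ 3 * C := by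
  have h1 := hv e (-e) he (by rwa [norm_neg])
  have h2 : ‖-e - e‖ = 2 := by
    rw [show -e - e = (-2 : ℝ) • e by module, norm_smul, he]; norm_num
  rw [hodd e he, h2, show -v e - v e = -2 * v e by ring, abs_mul] at h1
  norm_num at h1
  linarith [hℓC e he]

/-- The increment splits into an angular part, where chords of length at most `2` turn the local
constant into `3C`, and a radial part controlled by `|v| ≤ 3C`. Normalising doubles distances at
most, whence `9 = 3·2 + 3`. -/
lemma homExt_lipschitz : ∀ x y, |homExt v x - homExt v y| ≤ 9 * C * ‖x - y‖ := by
  intro x y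
  have hbd : ∀ e : 𝔼, ‖e‖ = 1 → |v e| ≤ 3 * C :=
    fun e he => abs_le_of_local_lipschitz hodd hℓC hv he
  rcases eq_or_ne x 0 with rfl | hx
  · rcases eq_or_ne y 0 with rfl | hy
    · simp
    have := hbd _ (norm_normalize hy)
    have hC : 0 ≤ C := by linarith [abs_nonneg (v (‖y‖⁻¹ • y))]
    simp only [homExt, norm_zero, zero_mul, zero_sub, abs_neg, abs_mul, abs_norm, norm_neg]
    nlinarith [norm_nonneg y, mul_nonneg hC (norm_nonneg y)]
  rcases eq_or_ne y 0 with rfl | hy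
  · have := hbd _ (norm_normalize hx)
    have hC : 0 ≤ C := by linarith [abs_nonneg (v (‖x‖⁻¹ • x))]
    simp only [homExt, norm_zero, zero_mul, sub_zero, abs_mul, abs_norm]
    nlinarith [norm_nonneg x, mul_nonneg hC (norm_nonneg x)]
  have h1 := hv _ _ (norm_normalize hy) (norm_normalize hx)
  have h2 := hbd _ (norm_normalize hy)
  have hC : 0 ≤ C := by linarith [abs_nonneg (v (‖y‖⁻¹ • y))]
  have h3 := norm_mul_norm_normalize_sub_le hx hy
  set n := ‖‖x‖⁻¹ • x - ‖y‖⁻¹ • y‖ with hn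
  have h4 : n ≤ 2 := by
    rw [hn]
    refine (norm_sub_le _ _).trans ?_
    rw [norm_normalize hx, norm_normalize hy]; norm_num
  have h5 := (hℓC _ (norm_normalize hy)).2
  have h6 : |v (‖x‖⁻¹ • x) - v (‖y‖⁻¹ • y)| ≤ 3 * C * n := by
    refine h1.trans ?_
    have : 0 ≤ n := norm_nonneg _
    gcongr
    nlinarith
  have h7 : homExt v x - homExt v y = ‖x‖ * (v (‖x‖⁻¹ • x) - v (‖y‖⁻¹ • y)) +
      (‖x‖ - ‖y‖) * v (‖y‖⁻¹ • y) := by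
    unfold homExt; ring
  rw [h7]
  refine (abs_add_le _ _).trans ?_
  rw [abs_mul, abs_mul, abs_norm]
  have h8 := abs_norm_sub_norm_le x y
  calc ‖x‖ * |v (‖x‖⁻¹ • x) - v (‖y‖⁻¹ • y)| + |‖x‖ - ‖y‖| * |v (‖y‖⁻¹ • y)|
      ≤ ‖x‖ * (3 * C * n) + ‖x - y‖ * (3 * C) := by gcongr
    _ = 3 * C * (‖x‖ * n) + 3 * C * ‖x - y‖ := by ring
    _ ≤ 3 * C * (2 * ‖x - y‖) + 3 * C * ‖x - y‖ := by gcongr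
    _ = _ := by ring

/-- Along a tangent direction the norm changes only to second order, while the normalised point
moves by at most `s‖t‖/‖x‖`. To first order only the local Lipschitz bound `ℓ` at the base point
survives. -/
lemma abs_fderiv_homExt_le {x t : 𝔼} (hx : x ≠ 0) (hd : DifferentiableAt ℝ (homExt v) x)
    (ht : inner ℝ x t = 0) : |fderiv ℝ (homExt v) x t| ≤ ℓ (‖x‖⁻¹ • x) * ‖t‖ := by
  have hnx : 0 < ‖x‖ := norm_pos_iff.2 hx
  have hbd := abs_le_of_local_lipschitz hodd hℓC hv (norm_normalize hx)
  have hC : 0 ≤ C := by linarith [abs_nonneg (v (‖x‖⁻¹ • x))]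
  set L := ℓ (‖x‖⁻¹ • x) with hL
  have hder : HasDerivAt (fun s : ℝ => homExt v (x + s • t)) (fderiv ℝ (homExt v) x t) 0 := by
    have h1 : HasDerivAt (fun s : ℝ => x + s • t) t 0 := by
      have := ((hasDerivAt_id (0 : ℝ)).smul_const t).const_add x
      simpa using this
    have h2 : HasFDerivAt (homExt v) (fderiv ℝ (homExt v) x) (x + (0 : ℝ) • t) := by
      simpa using hd.hasFDerivAt
    exact h2.comp_hasDerivAt 0 h1
  have hstep : ∀ s : ℝ, 0 < s → |homExt v (x + s • t) - homExt v x| ≤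
      s * (L * ‖t‖ + s * (C * ‖t‖ ^ 2 / ‖x‖ + 3 * C * ‖t‖ ^ 2 / ‖x‖)) := by
    intro s hs
    set y := x + s • t with hy
    have hy2 : ‖y‖ ^ 2 = ‖x‖ ^ 2 + s ^ 2 * ‖t‖ ^ 2 := by
      rw [hy, norm_add_sq_real, inner_smul_right, ht, norm_smul, mul_pow, Real.norm_eq_abs, sq_abs]
      ring
    have hxy : ‖x‖ ≤ ‖y‖ := by
      refine le_of_sq_le_sq ?_ (norm_nonneg _)
      nlinarith [sq_nonneg (s * ‖t‖)]
    have hny : 0 < ‖y‖ := hnx.trans_le hxy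
    have hy0 : y ≠ 0 := norm_pos_iff.1 hny
    have hdiff : ‖y‖ - ‖x‖ ≤ s * (s * ‖t‖ ^ 2 / ‖x‖) := by
      rw [show s * (s * ‖t‖ ^ 2 / ‖x‖) = s ^ 2 * ‖t‖ ^ 2 / ‖x‖ by ring, le_div_iff₀ hnx]
      nlinarith
    set n := ‖‖y‖⁻¹ • y - ‖x‖⁻¹ • x‖ with hn
    have hn0 : 0 ≤ n := norm_nonneg _
    have hxn : ‖x‖ * n ≤ s * ‖t‖ := by
      refine le_of_sq_le_sq ?_ (by positivity)
      have hin : inner ℝ (‖y‖⁻¹ • y) (‖x‖⁻¹ • x) = ‖x‖ / ‖y‖ := by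
        rw [inner_smul_left, inner_smul_right, hy, inner_add_left, inner_smul_left,
          real_inner_comm x t, ht, real_inner_self_eq_norm_sq]
        simp only [conj_trivial]
        field_simp
        ring
      have hn2 : n ^ 2 = 2 - 2 * (‖x‖ / ‖y‖) := by
        rw [hn, norm_sub_sq_real, norm_normalize hy0, norm_normalize hx, hin]; ring
      rw [mul_pow, hn2, mul_pow]
      have h1 : ‖x‖ ^ 2 * (2 - 2 * (‖x‖ / ‖y‖)) = 2 * ‖x‖ ^ 2 * (‖y‖ - ‖x‖) / ‖y‖ := by
        field_simp
      rw [h1, div_le_iff₀ hny]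
      have h2 : s ^ 2 * ‖t‖ ^ 2 = (‖y‖ - ‖x‖) * (‖y‖ + ‖x‖) := by linarith
      rw [h2]
      have h3 : 2 * ‖x‖ ^ 2 ≤ (‖y‖ + ‖x‖) * ‖y‖ := by nlinarith
      nlinarith [mul_le_mul_of_nonneg_left h3 (sub_nonneg.2 hxy)]
    have hvv := hv _ _ (norm_normalize hx) (norm_normalize hy0)
    have hbdy := abs_le_of_local_lipschitz hodd hℓC hv (norm_normalize hy0)
    have h7 : homExt v y - homExt v x = ‖x‖ * (v (‖y‖⁻¹ • y) - v (‖x‖⁻¹ • x)) +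
        (‖y‖ - ‖x‖) * v (‖y‖⁻¹ • y) := by
      unfold homExt; ring
    have hL0 : 0 ≤ L := (hℓC _ (norm_normalize hx)).1
    have hn' : n ≤ s * ‖t‖ / ‖x‖ := by rw [le_div_iff₀ hnx]; linarith
    rw [h7]
    refine (abs_add_le _ _).trans ?_
    rw [abs_mul, abs_mul, abs_norm, abs_of_nonneg (sub_nonneg.2 hxy)]
    calc ‖x‖ * |v (‖y‖⁻¹ • y) - v (‖x‖⁻¹ • x)| + (‖y‖ - ‖x‖) * |v (‖y‖⁻¹ • y)|
        ≤ ‖x‖ * ((L + C * n) * n) + s * (s * ‖t‖ ^ 2 / ‖x‖) * (3 * C) := by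
          gcongr
      _ = (L + C * n) * (‖x‖ * n) + s * (s * ‖t‖ ^ 2 / ‖x‖) * (3 * C) := by ring
      _ ≤ (L + C * (s * ‖t‖ / ‖x‖)) * (s * ‖t‖) + s * (s * ‖t‖ ^ 2 / ‖x‖) * (3 * C) := by gcongr
      _ = _ := by ring
  have hseq : Filter.Tendsto (fun n : ℕ => 1 / ((n : ℝ) + 1)) Filter.atTop (nhdsWithin 0 {0}ᶜ) := by
    refine tendsto_nhdsWithin_iff.2 ⟨tendsto_one_div_add_atTop_nhds_zero_nat, ?_⟩
    exact Filter.Eventually.of_forall fun n => by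
      simp only [Set.mem_compl_iff, Set.mem_singleton_iff]; positivity
  have hlim := ((hasDerivAt_iff_tendsto_slope.1 hder).comp hseq).abs
  have hlim2 : Filter.Tendsto (fun n : ℕ => L * ‖t‖ + 1 / ((n : ℝ) + 1) *
      (C * ‖t‖ ^ 2 / ‖x‖ + 3 * C * ‖t‖ ^ 2 / ‖x‖)) Filter.atTop (nhds (L * ‖t‖ + 0 *
      (C * ‖t‖ ^ 2 / ‖x‖ + 3 * C * ‖t‖ ^ 2 / ‖x‖))) :=
    (tendsto_one_div_add_atTop_nhds_zero_nat.mul_const _).const_add _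
  rw [zero_mul, add_zero] at hlim2
  refine le_of_tendsto_of_tendsto' hlim hlim2 fun n => ?_
  have hpos : (0 : ℝ) < 1 / ((n : ℝ) + 1) := by positivity
  have := hstep _ hpos
  simp only [Function.comp_apply, slope, vsub_eq_sub, sub_zero, smul_eq_mul, zero_smul, add_zero]
  rw [abs_mul, abs_inv, abs_of_pos hpos, inv_mul_le_iff₀ hpos]
  exact this

/-- The gradient splits orthogonally into a radial part, equal to `v` by Euler's identity for degree
one, and a tangential part bounded by `ℓ`. -/
lemma norm_fderiv_homExt_sq_le {x : 𝔼} (hx : x ≠ 0) (hd : DifferentiableAt ℝ (homExt v) x) :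
    ‖fderiv ℝ (homExt v) x‖ ^ 2 ≤ v (‖x‖⁻¹ • x) ^ 2 + ℓ (‖x‖⁻¹ • x) ^ 2 := by
  have hnx : 0 < ‖x‖ := norm_pos_iff.2 hx
  set g := gradient (homExt v) x with hg
  have hgd : ∀ w, fderiv ℝ (homExt v) x w = inner ℝ g w := fun w => by
    rw [hg, gradient, InnerProductSpace.toDual_symm_apply]
  have hgn : ‖fderiv ℝ (homExt v) x‖ = ‖g‖ := by
    rw [hg, gradient, LinearIsometryEquiv.norm_map]
  set u := ‖x‖⁻¹ • x with hu
  have hun : ‖u‖ = 1 := norm_normalize hx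
  have hrad : inner ℝ g u = v u := by
    have hder : HasDerivAt (fun s : ℝ => homExt v (s • x)) (fderiv ℝ (homExt v) x x) 1 := by
      have h1 : HasDerivAt (fun s : ℝ => s • x) x 1 := by
        simpa using (hasDerivAt_id (1 : ℝ)).smul_const x
      have h2 : HasFDerivAt (homExt v) (fderiv ℝ (homExt v) x) ((1 : ℝ) • x) := by
        simpa using hd.hasFDerivAt
      exact h2.comp_hasDerivAt 1 h1
    have hder2 : HasDerivAt (fun s : ℝ => homExt v (s • x)) (homExt v x) 1 := by
      have h1 : HasDerivAt (fun s : ℝ => s * homExt v x) (homExt v x) 1 := by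
        simpa using (hasDerivAt_id (1 : ℝ)).mul_const (homExt v x)
      refine h1.congr_of_eventuallyEq ?_
      filter_upwards [eventually_gt_nhds (zero_lt_one' ℝ)] with s hs
      simp only [homExt, norm_smul, Real.norm_of_nonneg hs.le, mul_inv, smul_smul]
      rw [show s⁻¹ * ‖x‖⁻¹ * s = ‖x‖⁻¹ by field_simp]
      ring
    have h := hder.unique hder2
    rw [hu, inner_smul_right, ← hgd, h, homExt, inv_mul_cancel_left₀ hnx.ne']
  set t := g - v u • u with ht
  have hut : inner ℝ u t = 0 := by
    rw [ht, inner_sub_right, inner_smul_right, real_inner_comm, hrad, real_inner_self_eq_norm_sq, hun]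
    ring
  have hxt : inner ℝ x t = 0 := by
    have : x = ‖x‖ • u := by rw [hu, smul_inv_smul₀ hnx.ne']
    rw [this, inner_smul_left, hut, mul_zero]
  have hgt : inner ℝ g t = ‖t‖ ^ 2 := by
    have : g = t + v u • u := by rw [ht]; abel
    rw [this, inner_add_left, inner_smul_left, hut, real_inner_self_eq_norm_sq]
    simp
  -- Testing the tangential bound on the tangential part itself gives `‖t‖² ≤ ℓ ‖t‖`.
  have htl := abs_fderiv_homExt_le hodd hℓC hv hx hd hxt
  rw [hgd, hgt, abs_of_nonneg (sq_nonneg _)] at htl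
  have hL0 := (hℓC u hun).1
  have htn : ‖t‖ ≤ ℓ u := by
    rcases (norm_nonneg t).eq_or_lt with h0 | h0
    · rw [← h0]; exact hL0
    · nlinarith
  have hg2 : ‖g‖ ^ 2 = ‖t‖ ^ 2 + v u ^ 2 := by
    have : g = t + v u • u := by rw [ht]; abel
    rw [this, norm_add_sq_real, inner_smul_right, real_inner_comm, hut, norm_smul, hun,
      Real.norm_eq_abs, mul_one, sq_abs]
    ring
  rw [hgn, hg2]
  nlinarith [norm_nonneg t]

/-- The **Poincaré inequality on the sphere** for odd functions, with the gradient replaced by a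
local Lipschitz bound. -/
theorem poincare_uniformSphere [NeZero d] (hvm : Measurable v) (hℓm : Measurable ℓ) :
    ((d : ℝ) - 1) * ∫ e, v e ^ 2 ∂(uniformSphere d) ≤ ∫ e, ℓ e ^ 2 ∂(uniformSphere d) := by
  have hC : 0 ≤ C := by
    have := abs_le_of_local_lipschitz hodd hℓC hv (e := EuclideanSpace.single 0 (1 : ℝ)) (by simp)
    linarith [abs_nonneg (v (EuclideanSpace.single 0 (1 : ℝ)))]
  have hlip : LipschitzWith (Real.toNNReal (9 * C)) (homExt v) := by
    refine LipschitzWith.of_dist_le_mul fun x y => ?_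
    rw [Real.dist_eq, dist_eq_norm, Real.coe_toNNReal _ (by positivity)]
    exact homExt_lipschitz hodd hℓC hv x y
  have hodd' : ∀ x, homExt v (-x) = -homExt v x := by
    intro x
    rcases eq_or_ne x 0 with rfl | hx
    · simp [homExt]
    · simp only [homExt, norm_neg, smul_neg]
      rw [hodd _ (norm_normalize hx), mul_neg]
  have h1 := integral_sq_le_integral_fderiv_sq hlip hodd'
  have hvi : Integrable (fun e => v e ^ 2) (uniformSphere d) :=
    integrable_uniformSphere_of_bound (by fun_prop) ((3 * C) ^ 2) fun e he => by
      rw [abs_pow]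
      exact pow_le_pow_left₀ (abs_nonneg _) (abs_le_of_local_lipschitz hodd hℓC hv he) 2
  have hℓi : Integrable (fun e => ℓ e ^ 2) (uniformSphere d) :=
    integrable_uniformSphere_of_bound (by fun_prop) (C ^ 2) fun e he => by
      rw [abs_of_nonneg (sq_nonneg _)]
      exact pow_le_pow_left₀ (hℓC e he).1 (hℓC e he).2 2
  have h2 : ∫ x, homExt v x ^ 2 ∂(stdGaussian 𝔼) = d * ∫ e, v e ^ 2 ∂(uniformSphere d) := by
    have := integral_stdGaussian_polar (d := d) (fun e => v e ^ 2) (fun r => r ^ 2) (by fun_prop)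
      (by fun_prop)
    rw [integral_norm_sq_stdGaussian] at this
    rw [mul_comm (d : ℝ), ← this]
    congr 1; ext x; simp only [homExt]; ring
  have h3 : ∫ x, ‖fderiv ℝ (homExt v) x‖ ^ 2 ∂(stdGaussian 𝔼) ≤
      ∫ e, (v e ^ 2 + ℓ e ^ 2) ∂(uniformSphere d) := by
    have hmap : ∫ e, (v e ^ 2 + ℓ e ^ 2) ∂(uniformSphere d) =
        ∫ x, (v (‖x‖⁻¹ • x) ^ 2 + ℓ (‖x‖⁻¹ • x) ^ 2) ∂(stdGaussian 𝔼) := by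
      rw [← stdGaussian_map_direction, integral_map (by fun_prop)]
      exact Measurable.aestronglyMeasurable (by fun_prop)
    have hint : Integrable (fun x => v (‖x‖⁻¹ • x) ^ 2 + ℓ (‖x‖⁻¹ • x) ^ 2) (stdGaussian 𝔼) := by
      have := hvi.add hℓi
      rw [← stdGaussian_map_direction] at this
      exact this.comp_measurable (by fun_prop)
    rw [hmap]
    have : Nonempty (Fin d) := ⟨0⟩
    have hne : ∀ᵐ x ∂(stdGaussian 𝔼), x ≠ 0 :=
      stdGaussian_absolutelyContinuous.ae_le (compl_mem_ae_iff.2 (measure_singleton 0))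
    have hae : ∀ᵐ x ∂(stdGaussian 𝔼), ‖fderiv ℝ (homExt v) x‖ ^ 2 ≤
        v (‖x‖⁻¹ • x) ^ 2 + ℓ (‖x‖⁻¹ • x) ^ 2 := by
      filter_upwards [hne, stdGaussian_absolutelyContinuous.ae_le hlip.ae_differentiableAt]
        with x hx hxd using norm_fderiv_homExt_sq_le hodd hℓC hv hx hxd
    refine integral_mono_ae ?_ hint hae
    refine Integrable.mono' hint ((measurable_fderiv ℝ _).norm.pow_const 2).aestronglyMeasurable ?_
    filter_upwards [hae] with x hx
    rwa [Real.norm_of_nonneg (sq_nonneg _)]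
  rw [integral_add hvi hℓi] at h3
  -- The factor `d` on the left is `E‖x‖²`; the radial part of the gradient takes back one `∫ v²`,
  -- which leaves `d - 1`.
  linarith

end SpherePoincare

end ZORSMD

end

noncomputable section

namespace ZORSMD

/-! ### A Stirling bound and Gaussian absolute moments. -/

section Gamma

lemma two_le_one_add_inv_rpow {t : ℝ} (ht : 1 ≤ t) : 2 ≤ (1 + 1 / t) ^ t := by
  have h := one_add_mul_self_le_rpow_one_add (s := 1 / t) (p := t)
    (by have : 0 < 1 / t := by positivity
        linarith) ht
  rw [mul_one_div_cancel (by positivity)] at h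
  linarith

/-- Convexity puts Gamma below its chord between `5/2` and `7/2`, and this chord lies below
`(t/2)²`, hence below `(t/2)^t` since `t/2 ≥ 1`. -/
lemma Gamma_add_half_le_base {t : ℝ} (h2 : 2 ≤ t) (h3 : t ≤ 3) :
    Real.Gamma (t + 1 / 2) ≤ √Real.pi * (t / 2) ^ t := by
  have g1 : Real.Gamma (3 / 2) = √Real.pi / 2 := by
    rw [show (3 / 2 : ℝ) = 1 / 2 + 1 by norm_num, Real.Gamma_add_one (by norm_num),
      Real.Gamma_one_half_eq]; ring
  have g2 : Real.Gamma (5 / 2) = √Real.pi * (3 / 4) := by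
    rw [show (5 / 2 : ℝ) = 3 / 2 + 1 by norm_num, Real.Gamma_add_one (by norm_num), g1]; ring
  have g3 : Real.Gamma (7 / 2) = √Real.pi * (15 / 8) := by
    rw [show (7 / 2 : ℝ) = 5 / 2 + 1 by norm_num, Real.Gamma_add_one (by norm_num), g2]; ring
  have hconv := Real.convexOn_Gamma.2 (show (5 / 2 : ℝ) ∈ Set.Ioi 0 by norm_num)
    (show (7 / 2 : ℝ) ∈ Set.Ioi 0 by norm_num) (show 0 ≤ 3 - t by linarith)
    (show 0 ≤ t - 2 by linarith) (by ring)
  simp only [smul_eq_mul] at hconv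
  rw [show (3 - t) * (5 / 2) + (t - 2) * (7 / 2) = t + 1 / 2 by ring, g2, g3] at hconv
  have hpow : (t / 2) ^ (2 : ℝ) ≤ (t / 2) ^ t :=
    Real.rpow_le_rpow_of_exponent_le (by linarith) h2
  rw [Real.rpow_two] at hpow
  have hpi : 0 < √Real.pi := Real.sqrt_pos.2 Real.pi_pos
  calc Real.Gamma (t + 1 / 2) ≤ √Real.pi * ((3 - t) * (3 / 4) + (t - 2) * (15 / 8)) := by linarith
    _ ≤ √Real.pi * (t / 2) ^ t := by
      gcongr
      nlinarith [sq_nonneg (t - 9 / 4)]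

/-- A Stirling-type upper bound for the Gamma function. -/
lemma Gamma_add_half_le {t : ℝ} (h2 : 2 ≤ t) : Real.Gamma (t + 1 / 2) ≤ √Real.pi * (t / 2) ^ t := by
  have key : ∀ n : ℕ, ∀ t : ℝ, 2 ≤ t → t ≤ 3 + n →
      Real.Gamma (t + 1 / 2) ≤ √Real.pi * (t / 2) ^ t := by
    intro n
    induction n with
    | zero => intro t h2 h3; exact Gamma_add_half_le_base h2 (by simpa using h3)
    | succ n ih =>
      intro t h2 h3
      rcases le_total t 3 with h | h
      · exact Gamma_add_half_le_base h2 h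
      have hi := ih (t - 1) (by linarith) (by push_cast at h3; linarith)
      have hpi : 0 < √Real.pi := Real.sqrt_pos.2 Real.pi_pos
      have ht1 : 0 < t - 1 := by linarith
      rw [show t + 1 / 2 = (t - 1 + 1 / 2) + 1 by ring, Real.Gamma_add_one (by linarith)]
      -- A unit step multiplies Gamma by `t - 1/2 ≤ t`, and the right side by `(t/2)(1 +
      -- 1/(t-1))^(t-1)`, which is at least `t`.
      have hb := two_le_one_add_inv_rpow (t := t - 1) (by linarith)
      have hsplit : (t / 2) ^ t = (t / 2) * (((t - 1) / 2) ^ (t - 1) * (1 + 1 / (t - 1)) ^ (t - 1)) := by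
        rw [← Real.mul_rpow (by positivity) (by positivity),
          show (t - 1) / 2 * (1 + 1 / (t - 1)) = t / 2 by field_simp; ring]
        conv_lhs => rw [show t = 1 + (t - 1) by ring]
        rw [Real.rpow_add (by linarith), Real.rpow_one]
        ring_nf
      calc (t - 1 + 1 / 2) * Real.Gamma (t - 1 + 1 / 2)
          ≤ (t - 1 + 1 / 2) * (√Real.pi * ((t - 1) / 2) ^ (t - 1)) := by gcongr
        _ ≤ t * (√Real.pi * ((t - 1) / 2) ^ (t - 1)) := by gcongr; linarith
        _ = √Real.pi * ((t / 2) * (((t - 1) / 2) ^ (t - 1) * 2)) := by ring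
        _ ≤ √Real.pi * ((t / 2) * (((t - 1) / 2) ^ (t - 1) * (1 + 1 / (t - 1)) ^ (t - 1))) := by
          gcongr
        _ = _ := by rw [hsplit]
  obtain ⟨n, hn⟩ := exists_nat_ge (t - 3)
  exact key n t h2 (by linarith)

/-- The condition `q ≥ 4` is the Stirling bound's `t ≥ 2` at `t = q/2`. Exponents between `2` and
`4` are reached by interpolation with the exact fourth moment instead. -/
lemma gaussian_abs_moment_le {q : ℝ} (hq : 4 ≤ q) :
    2 ^ (q / 2) * Real.Gamma ((q + 1) / 2) / √Real.pi ≤ (q / 2) ^ (q / 2) := by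
  have hpi : 0 < √Real.pi := Real.sqrt_pos.2 Real.pi_pos
  have h := Gamma_add_half_le (t := q / 2) (by linarith)
  rw [show q / 2 + 1 / 2 = (q + 1) / 2 by ring] at h
  rw [div_le_iff₀ hpi]
  calc 2 ^ (q / 2) * Real.Gamma ((q + 1) / 2) ≤ 2 ^ (q / 2) * (√Real.pi * (q / 2 / 2) ^ (q / 2)) := by
        gcongr
    _ = (2 * (q / 2 / 2)) ^ (q / 2) * √Real.pi := by
        rw [Real.mul_rpow (by norm_num) (by positivity)]; ring
    _ = _ := by ring_nf

lemma gaussian_fourth_moment : (2 : ℝ) ^ ((4 : ℝ) / 2) * Real.Gamma ((4 + 1) / 2) / √Real.pi = 3 := by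
  have hpi : 0 < √Real.pi := Real.sqrt_pos.2 Real.pi_pos
  rw [show ((4 : ℝ) + 1) / 2 = 1 / 2 + 1 + 1 by norm_num, Real.Gamma_add_one (by norm_num),
    Real.Gamma_add_one (by norm_num), Real.Gamma_one_half_eq]
  norm_num
  field_simp
  norm_num

end Gamma

/-! ### Weighted moments of the `ℓ_q`-norm on the sphere. -/

section Moments

variable {d : ℕ} [NeZero d]

local notation "𝔼" => EuclideanSpace ℝ (Fin d)

lemma integral_rpow_le_rpow_integral {α : Type*} [MeasurableSpace α] {μ : Measure α}
    [IsProbabilityMeasure μ] {Z : α → ℝ} (hZ : Integrable Z μ) (h0 : ∀ᵐ x ∂μ, 0 ≤ Z x) {r : ℝ}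
    (hr0 : 0 ≤ r) (hr1 : r ≤ 1) (hZr : Integrable (fun x => Z x ^ r) μ) :
    ∫ x, Z x ^ r ∂μ ≤ (∫ x, Z x ∂μ) ^ r :=
  (Real.concaveOn_rpow hr0 hr1).le_map_integral (Real.continuous_rpow_const hr0).continuousOn
    isClosed_Ici h0 hZ hZr

omit [NeZero d] in
lemma pNorm_nonneg (q : ℝ) (x : 𝔼) : 0 ≤ pNorm q x := by unfold pNorm; positivity

omit [NeZero d] in
lemma pNorm_rpow {q : ℝ} (hq : 0 < q) (x : 𝔼) : pNorm q x ^ q = ∑ i, |x i| ^ q := by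
  unfold pNorm
  rw [← Real.rpow_mul (by positivity), one_div_mul_cancel hq.ne', Real.rpow_one]

omit [NeZero d] in
lemma continuous_pNorm {q : ℝ} (hq : 0 < q) : Continuous (pNorm q : 𝔼 → ℝ) := by
  unfold pNorm
  refine Continuous.rpow_const ?_ (fun _ => Or.inr (by positivity))
  refine continuous_finsetSum _ fun i _ => ?_
  exact Continuous.rpow_const (by fun_prop) (fun _ => Or.inr hq.le)

omit [NeZero d] in
lemma abs_coord_le_one {e : 𝔼} (he : ‖e‖ = 1) (i : Fin d) : |e i| ≤ 1 := by
  simpa [he] using PiLp.norm_apply_le e i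

omit [NeZero d] in
lemma pNorm_le_one {q : ℝ} (hq : 2 ≤ q) {e : 𝔼} (he : ‖e‖ = 1) : pNorm q e ≤ 1 := by
  unfold pNorm
  refine Real.rpow_le_one (by positivity) ?_ (by positivity)
  have h := EuclideanSpace.real_norm_sq_eq e
  rw [he, one_pow] at h
  rw [h]
  refine Finset.sum_le_sum fun i _ => ?_
  rw [← sq_abs, ← Real.rpow_two]
  exact Real.rpow_le_rpow_of_exponent_ge_of_imp (abs_nonneg _) (abs_coord_le_one he i) hq
    (fun _ h => by linarith)

lemma integral_pNorm_rpow_le {q : ℝ} (hq : 2 ≤ q) :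
    ∫ e : 𝔼, pNorm q e ^ q ∂(uniformSphere d) ≤
      d * ((d : ℝ) ^ (-(q / 2)) * (2 ^ (q / 2) * Real.Gamma ((q + 1) / 2) / √Real.pi)) := by
  simp_rw [pNorm_rpow (by linarith : 0 < q)]
  rw [integral_finsetSum]
  · refine (Finset.sum_le_sum fun i _ => integral_abs_coord_rpow_uniformSphere_le i hq).trans ?_
    simp
  · intro i _
    refine integrable_uniformSphere_of_bound (Measurable.aestronglyMeasurable (by fun_prop)) 1
      fun e he => ?_
    rw [abs_of_nonneg (by positivity)]
    exact Real.rpow_le_one (abs_nonneg _) (abs_coord_le_one he i) (by linarith)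

lemma integrable_pNorm_rpow {q r : ℝ} (hq : 2 ≤ q) (hr : 0 ≤ r) :
    Integrable (fun e : 𝔼 => pNorm q e ^ r) (uniformSphere d) := by
  refine integrable_uniformSphere_of_bound
    (((continuous_pNorm (by linarith)).measurable.pow_const r).aestronglyMeasurable) 1 fun e he => ?_
  rw [abs_of_nonneg (Real.rpow_nonneg (pNorm_nonneg _ _) _)]
  exact Real.rpow_le_one (pNorm_nonneg _ _) (pNorm_le_one hq he) hr

/-- Jensen for the concave power `4/q` brings the `q`-th moment, which splits over coordinates, down
to the fourth. The fourth moment is what Cauchy–Schwarz against a weight in `L²` requires. -/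
lemma integral_pNorm_four_le {q : ℝ} (hq : 4 ≤ q) :
    ∫ e : 𝔼, pNorm q e ^ 4 ∂(uniformSphere d) ≤ ((d : ℝ) ^ (2 / q - 1) * (q / 2)) ^ 2 := by
  have hd : (0 : ℝ) < d := Nat.cast_pos.2 (NeZero.pos d)
  have hq0 : 0 < q := by linarith
  have h1 := integral_rpow_le_rpow_integral (μ := uniformSphere d)
    (Z := fun e : 𝔼 => pNorm q e ^ q) (r := 4 / q) (integrable_pNorm_rpow (by linarith) hq0.le)
    (Filter.Eventually.of_forall fun e => Real.rpow_nonneg (pNorm_nonneg _ _) _) (by positivity)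
    ((div_le_one hq0).2 hq)
    (by
      simp_rw [← Real.rpow_mul (pNorm_nonneg _ _)]
      exact integrable_pNorm_rpow (by linarith) (by positivity))
  have h2 : ∀ e : 𝔼, (pNorm q e ^ q) ^ (4 / q) = pNorm q e ^ 4 := fun e => by
    rw [← Real.rpow_mul (pNorm_nonneg _ _), mul_div_cancel₀ _ hq0.ne']
    norm_cast
  simp_rw [h2] at h1
  refine h1.trans ?_
  have h3 := integral_pNorm_rpow_le (d := d) (q := q) (by linarith)
  have h4 : (d : ℝ) * ((d : ℝ) ^ (-(q / 2)) * (2 ^ (q / 2) * Real.Gamma ((q + 1) / 2) / √Real.pi)) ≤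
      ((d : ℝ) ^ (2 / q - 1) * (q / 2)) ^ (q / 2) := by
    rw [Real.mul_rpow (by positivity) (by positivity), ← Real.rpow_mul hd.le,
      show (2 / q - 1) * (q / 2) = 1 + -(q / 2) by field_simp; ring, Real.rpow_add hd, Real.rpow_one,
      mul_assoc]
    gcongr
    exact gaussian_abs_moment_le hq
  calc (∫ e : 𝔼, pNorm q e ^ q ∂(uniformSphere d)) ^ (4 / q)
      ≤ (((d : ℝ) ^ (2 / q - 1) * (q / 2)) ^ (q / 2)) ^ (4 / q) := by
        refine Real.rpow_le_rpow (integral_nonneg fun e => Real.rpow_nonneg (pNorm_nonneg _ _) _)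
          (h3.trans h4) (by positivity)
    _ = _ := by
        rw [← Real.rpow_mul (by positivity), show q / 2 * (4 / q) = (2 : ℝ) by field_simp; norm_num,
          Real.rpow_two]

lemma integral_sum_pow_four_le :
    ∫ e : 𝔼, ∑ i, (e i) ^ 4 ∂(uniformSphere d) ≤ 3 / d := by
  have hd : (0 : ℝ) < d := Nat.cast_pos.2 (NeZero.pos d)
  have h := integral_pNorm_rpow_le (d := d) (q := 4) (by norm_num)
  rw [gaussian_fourth_moment] at h
  have h2 : ∀ e : 𝔼, pNorm 4 e ^ (4 : ℝ) = ∑ i, (e i) ^ 4 := fun e => by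
    rw [pNorm_rpow (by norm_num)]
    refine Finset.sum_congr rfl fun i _ => ?_
    rw [show (4 : ℝ) = ((4 : ℕ) : ℝ) by norm_num, Real.rpow_natCast, Even.pow_abs (by decide)]
  simp_rw [h2] at h
  refine h.trans (le_of_eq ?_)
  rw [show -((4 : ℝ) / 2) = -((2 : ℕ) : ℝ) by norm_num, Real.rpow_neg hd.le, Real.rpow_natCast]
  field_simp

omit [NeZero d] in
/-- Interpolation of `ℓ_q`-norms on the unit sphere between `q = 2` and `q = 4`. -/
lemma pNorm_sq_le_interpolation {q : ℝ} (hq2 : 2 ≤ q) (hq4 : q ≤ 4) {e : 𝔼} (he : ‖e‖ = 1) :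
    pNorm q e ^ 2 ≤ √(∑ i, (e i) ^ 4) ^ (2 - 4 / q) := by
  set S := ∑ i, (e i) ^ 4 with hS
  have h2 := EuclideanSpace.real_norm_sq_eq e
  rw [he, one_pow] at h2
  have hS0 : 0 < S := by
    refine lt_of_le_of_ne (Finset.sum_nonneg fun i _ => by positivity) fun h => ?_
    have h3 := (Finset.sum_eq_zero_iff_of_nonneg (fun i _ => by positivity)).1 (hS ▸ h.symm)
    have : ∀ i, e i = 0 := fun i => by simpa using h3 i (Finset.mem_univ i)
    simp [this] at h2
  -- The weight for which `q = 2(1-l) + 4l`. Hölder's inequality is then proved by weighted AM–GM on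
  -- `e_i²` and `e_i⁴/S`, both of which sum to one.
  set l := (q - 2) / 2 with hl
  have hl0 : 0 ≤ l := by rw [hl]; linarith
  have hl1 : 0 ≤ 1 - l := by rw [hl]; linarith
  have hq0 : 0 < q := by linarith
  have hpt : ∀ i, |e i| ^ q ≤ S ^ l * ((1 - l) * (e i) ^ 2 + l * ((e i) ^ 4 / S)) := by
    intro i
    have hg := Real.geom_mean_le_arith_mean2_weighted hl1 hl0 (sq_nonneg (e i))
      (by positivity : 0 ≤ (e i) ^ 4 / S) (by ring)
    refine le_trans (le_of_eq ?_) (mul_le_mul_of_nonneg_left hg (by positivity))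
    rw [Real.div_rpow (by positivity) hS0.le]
    have e1 : ((e i) ^ 2) ^ (1 - l) = |e i| ^ (2 * (1 - l)) := by
      rw [Real.rpow_mul (abs_nonneg _), Real.rpow_two, sq_abs]
    have e2 : ((e i) ^ 4) ^ l = |e i| ^ (4 * l) := by
      rw [Real.rpow_mul (abs_nonneg _), show (4 : ℝ) = ((4 : ℕ) : ℝ) by norm_num, Real.rpow_natCast,
        Even.pow_abs (by decide)]
    rw [e1, e2]
    have : |e i| ^ q = |e i| ^ (2 * (1 - l)) * |e i| ^ (4 * l) := by
      rw [← Real.rpow_add_of_nonneg (abs_nonneg _) (by linarith) (by linarith)]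
      congr 1; rw [hl]; ring
    rw [this]
    field_simp
  have hsum : ∑ i, |e i| ^ q ≤ S ^ l := by
    calc ∑ i, |e i| ^ q ≤ ∑ i, S ^ l * ((1 - l) * (e i) ^ 2 + l * ((e i) ^ 4 / S)) :=
          Finset.sum_le_sum fun i _ => hpt i
      _ = S ^ l * ((1 - l) * ∑ i, (e i) ^ 2 + l * (S / S)) := by
          rw [← Finset.mul_sum, Finset.sum_add_distrib, ← Finset.mul_sum, ← Finset.mul_sum,
            ← Finset.sum_div]
      _ = S ^ l := by rw [← h2, div_self hS0.ne']; ring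
  calc pNorm q e ^ 2 = (∑ i, |e i| ^ q) ^ (2 / q) := by
        unfold pNorm
        rw [← Real.rpow_two, ← Real.rpow_mul (by positivity)]
        congr 1; ring
    _ ≤ (S ^ l) ^ (2 / q) := by gcongr
    _ = √S ^ (2 - 4 / q) := by
        rw [Real.sqrt_eq_rpow, ← Real.rpow_mul hS0.le, ← Real.rpow_mul hS0.le]
        congr 1; rw [hl]; field_simp; ring

lemma integral_mul_pNorm_sq_le_large {k : 𝔼 → ℝ} {C q : ℝ} (hk : MemLp k 2 (uniformSphere d))
    (hC : 0 ≤ C) (hk2 : ∫ e, k e ^ 2 ∂(uniformSphere d) ≤ (2 * C) ^ 2) (hq : 4 ≤ q) :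
    ∫ e, k e * pNorm q e ^ 2 ∂(uniformSphere d) ≤ (d : ℝ) ^ (2 / q - 1) * (C * q) := by
  have hp2 : MemLp (fun e : 𝔼 => pNorm q e ^ 2) 2 (uniformSphere d) := by
    rw [memLp_two_iff_integrable_sq
      ((continuous_pNorm (by linarith)).measurable.pow_const 2).aestronglyMeasurable]
    have := integrable_pNorm_rpow (d := d) (q := q) (r := 4) (by linarith) (by norm_num)
    convert this using 2 with e
    rw [← pow_mul]; norm_cast
  have h1 := sq_integral_mul_le hk hp2
  simp_rw [← pow_mul] at h1
  have h2 := integral_pNorm_four_le (d := d) hq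
  have h3 : 0 ≤ ∫ e : 𝔼, pNorm q e ^ 4 ∂(uniformSphere d) := integral_nonneg fun e => by positivity
  have h4 : (∫ e, k e * pNorm q e ^ 2 ∂(uniformSphere d)) ^ 2 ≤
      ((d : ℝ) ^ (2 / q - 1) * (C * q)) ^ 2 := by
    refine h1.trans ?_
    calc _ ≤ (2 * C) ^ 2 * ((d : ℝ) ^ (2 / q - 1) * (q / 2)) ^ 2 := by gcongr
      _ = _ := by ring
  exact le_of_sq_le_sq h4 (by positivity)

/-- A second AM–GM, between `1` and `√d √(∑ e_i⁴)`, linearises the interpolation bound. The integral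
then needs only the mean of `k` and Cauchy–Schwarz with `E ∑ e_i⁴ ≤ 3/d`. -/
lemma integral_mul_pNorm_sq_le_small {k : 𝔼 → ℝ} {C q : ℝ} (hk : MemLp k 2 (uniformSphere d))
    (hk0 : ∀ e, 0 ≤ k e) (hC : 0 ≤ C) (hk1 : ∫ e, k e ∂(uniformSphere d) ≤ C)
    (hk2 : ∫ e, k e ^ 2 ∂(uniformSphere d) ≤ (2 * C) ^ 2) (hq2 : 2 ≤ q) (hq4 : q ≤ 4) :
    ∫ e, k e * pNorm q e ^ 2 ∂(uniformSphere d) ≤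
      (d : ℝ) ^ (2 / q - 1) * ((4 / q - 1) * C + (2 - 4 / q) * (2 * C * √3)) := by
  have hd : (0 : ℝ) < d := Nat.cast_pos.2 (NeZero.pos d)
  have hq0 : 0 < q := by linarith
  have hθ0 : 0 ≤ 2 - 4 / q := by rw [sub_nonneg, div_le_iff₀ hq0]; linarith
  have hθ1 : 0 ≤ 4 / q - 1 := by rw [sub_nonneg, le_div_iff₀ hq0]; linarith
  have hpt : ∀ e : 𝔼, ‖e‖ = 1 → pNorm q e ^ 2 ≤
      (d : ℝ) ^ (2 / q - 1) * ((4 / q - 1) + (2 - 4 / q) * (√d * √(∑ i, (e i) ^ 4))) := by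
    intro e he
    refine (pNorm_sq_le_interpolation hq2 hq4 he).trans ?_
    have hg := Real.geom_mean_le_arith_mean2_weighted hθ1 hθ0 zero_le_one
      (by positivity : 0 ≤ √(d : ℝ) * √(∑ i, (e i) ^ 4)) (by ring)
    rw [Real.one_rpow, one_mul, mul_one, Real.mul_rpow (by positivity) (by positivity)] at hg
    refine le_trans (le_of_eq ?_) (mul_le_mul_of_nonneg_left hg (by positivity))
    rw [← mul_assoc, Real.sqrt_eq_rpow (d : ℝ), ← Real.rpow_mul hd.le, ← Real.rpow_add hd,
      show 2 / q - 1 + 1 / 2 * (2 - 4 / q) = 0 by ring, Real.rpow_zero, one_mul]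
  have hSm : Measurable fun e : 𝔼 => √(∑ i, (e i) ^ 4) := by fun_prop
  have hSi : Integrable (fun e : 𝔼 => ∑ i, (e i) ^ 4) (uniformSphere d) := by
    refine integrable_uniformSphere_of_bound (by fun_prop) d fun e he => ?_
    rw [abs_of_nonneg (Finset.sum_nonneg fun i _ => by positivity)]
    refine (Finset.sum_le_card_nsmul _ _ 1 fun i _ => ?_).trans (by simp)
    rw [← Even.pow_abs (by decide)]
    exact pow_le_one₀ (abs_nonneg _) (abs_coord_le_one he i)
  have hS2 : MemLp (fun e : 𝔼 => √(∑ i, (e i) ^ 4)) 2 (uniformSphere d) := by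
    rw [memLp_two_iff_integrable_sq hSm.aestronglyMeasurable]
    have : (fun e : 𝔼 => √(∑ i, (e i) ^ 4) ^ 2) = fun e : 𝔼 => ∑ i, (e i) ^ 4 := by
      ext e; exact Real.sq_sqrt (Finset.sum_nonneg fun i _ => by positivity)
    rwa [this]
  have hcs := sq_integral_mul_le hk hS2
  have hS4 : ∫ e : 𝔼, √(∑ i, (e i) ^ 4) ^ 2 ∂(uniformSphere d) ≤ 3 / d := by
    refine le_trans (le_of_eq ?_) integral_sum_pow_four_le
    congr 1; ext e
    rw [Real.sq_sqrt (Finset.sum_nonneg fun i _ => by positivity)]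
  have hkS : ∫ e, k e * √(∑ i, (e i) ^ 4) ∂(uniformSphere d) ≤ 2 * C * √(3 / d) := by
    refine le_of_sq_le_sq (hcs.trans ?_) (by positivity)
    rw [mul_pow, Real.sq_sqrt (by positivity)]
    have : 0 ≤ ∫ e : 𝔼, √(∑ i, (e i) ^ 4) ^ 2 ∂(uniformSphere d) :=
      integral_nonneg fun e => sq_nonneg _
    gcongr
  have hki := hk.integrable (by norm_num)
  have hkSi : Integrable (fun e => k e * √(∑ i, (e i) ^ 4)) (uniformSphere d) :=
    hk.integrable_mul hS2
  have hmaj : Integrable (fun e => (d : ℝ) ^ (2 / q - 1) * ((4 / q - 1) * k e +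
      (2 - 4 / q) * √d * (k e * √(∑ i, (e i) ^ 4)))) (uniformSphere d) :=
    ((hki.const_mul _).add (hkSi.const_mul _)).const_mul _
  calc ∫ e, k e * pNorm q e ^ 2 ∂(uniformSphere d)
      ≤ ∫ e, (d : ℝ) ^ (2 / q - 1) * ((4 / q - 1) * k e +
        (2 - 4 / q) * √d * (k e * √(∑ i, (e i) ^ 4))) ∂(uniformSphere d) := by
        refine integral_mono_of_nonneg (Filter.Eventually.of_forall fun e => ?_) hmaj ?_
        · exact mul_nonneg (hk0 e) (sq_nonneg _)
        · filter_upwards [ae_uniformSphere_norm_eq_one d] with e he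
          refine (mul_le_mul_of_nonneg_left (hpt e he) (hk0 e)).trans (le_of_eq ?_)
          ring
    _ = (d : ℝ) ^ (2 / q - 1) * ((4 / q - 1) * ∫ e, k e ∂(uniformSphere d) +
        (2 - 4 / q) * √d * ∫ e, k e * √(∑ i, (e i) ^ 4) ∂(uniformSphere d)) := by
        rw [integral_const_mul, integral_add (hki.const_mul _) (hkSi.const_mul _),
          integral_const_mul, integral_const_mul]
    _ ≤ (d : ℝ) ^ (2 / q - 1) * ((4 / q - 1) * C + (2 - 4 / q) * √d * (2 * C * √(3 / d))) := by
        gcongr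
    _ = _ := by
        have : √(d : ℝ) * √(3 / d) = √3 := by
          rw [← Real.sqrt_mul hd.le]; congr 1; field_simp
        rw [← this]; ring

/-- Weighted second moment of the `ℓ_q`-norm of a uniform vector on the sphere. -/
lemma integral_mul_pNorm_sq_le {k : 𝔼 → ℝ} {q : ℝ} (hk : MemLp k 2 (uniformSphere d))
    (hk0 : ∀ e, 0 ≤ k e) (hk1 : ∫ e, k e ∂(uniformSphere d) ≤ 17 / 10)
    (hk2 : ∫ e, k e ^ 2 ∂(uniformSphere d) ≤ (2 * (17 / 10)) ^ 2) (hq2 : 2 ≤ q) :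
    ∫ e, k e * pNorm q e ^ 2 ∂(uniformSphere d) ≤ (d : ℝ) ^ (2 / q - 1) * (2 * q - 1) := by
  have hq0 : 0 < q := by linarith
  rcases le_total q 4 with h | h
  · refine (integral_mul_pNorm_sq_le_small hk hk0 (by norm_num) hk1 hk2 hq2 h).trans ?_
    gcongr
    have h3 : √3 ≤ 1.7321 := by
      rw [Real.sqrt_le_left (by norm_num)]; norm_num
    have hθ0 : 0 ≤ 2 - 4 / q := by rw [sub_nonneg, div_le_iff₀ hq0]; linarith
    have h4 : (4 / q - 1) * (17 / 10) + (2 - 4 / q) * (2 * (17 / 10) * √3) ≤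
        (4 / q - 1) * (17 / 10) + (2 - 4 / q) * (2 * (17 / 10) * 1.7321) := by gcongr
    refine h4.trans ?_
    have e1 : (4 / q - 1) * (17 / 10) + (2 - 4 / q) * (2 * (17 / 10) * 1.7321) =
      ((4 - q) * (17 / 10) + (2 * q - 4) * (2 * (17 / 10) * 1.7321)) / q := by
      field_simp
    rw [e1, div_le_iff₀ hq0]
    -- After clearing `q` a quadratic without real roots remains; `2.77` is close to its vertex.
    nlinarith [sq_nonneg (q - 2.77)]
  · refine (integral_mul_pNorm_sq_le_large hk (by norm_num) hk2 h).trans ?_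
    gcongr
    linarith

end Moments

end ZORSMD

end

/-! ### Weights that are squares of odd Lipschitz functions. -/

noncomputable section

namespace ZORSMD

lemma rpow_one_sub_two_div_le (d : ℕ) {q : ℝ} (hq : 2 ≤ q) :
    (d : ℝ) ^ (1 - 2 / q) ≤ 1 + (1 - 2 / q) * ((d : ℝ) - 1) := by
  have hq0 : 0 < q := by linarith
  have hd : (0 : ℝ) ≤ d := Nat.cast_nonneg d
  have h := rpow_one_add_le_one_add_mul_self (s := (d : ℝ) - 1) (p := 1 - 2 / q)
    (by linarith) (by rw [sub_nonneg, div_le_one hq0]; exact hq)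
    (by have : 0 < 2 / q := by positivity
        linarith)
  rwa [add_sub_cancel] at h

section OddLipschitz

variable {d : ℕ} [NeZero d]

local notation "𝔼" => EuclideanSpace ℝ (Fin d)

/-- Second and fourth moments of odd `1`-Lipschitz functions on the sphere. -/
lemma integral_sq_and_pow_four_le {h : 𝔼 → ℝ} (hm : Measurable h) (hd : 2 ≤ d)
    (hodd : ∀ e, ‖e‖ = 1 → h (-e) = -h e)
    (hlip : ∀ e e', ‖e‖ = 1 → ‖e'‖ = 1 → |h e' - h e| ≤ ‖e' - e‖) :
    (∀ e, ‖e‖ = 1 → |h e| ≤ 1) ∧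
    ((d : ℝ) - 1) * ∫ e, h e ^ 2 ∂(uniformSphere d) ≤ 1 ∧
    ((d : ℝ) - 1) ^ 2 * ∫ e, h e ^ 4 ∂(uniformSphere d) ≤ 4 := by
  have hd' : (1 : ℝ) ≤ (d : ℝ) - 1 := by
    have : (2 : ℝ) ≤ d := by exact_mod_cast hd
    linarith
  have hb : ∀ e, ‖e‖ = 1 → |h e| ≤ 1 := by
    intro e he
    have h1 := hlip e (-e) he (by rwa [norm_neg])
    have h2 : ‖-e - e‖ = 2 := by
      rw [show -e - e = (-2 : ℝ) • e by module, norm_smul, he]; norm_num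
    rw [hodd e he, h2, show -h e - h e = -2 * h e by ring, abs_mul] at h1
    norm_num at h1
    linarith
  have h2 := poincare_uniformSphere (v := h) (ℓ := fun _ => 1) (C := 1) hodd (fun e _ => by norm_num)
    (fun e e' he he' => (hlip e e' he he').trans (by nlinarith [norm_nonneg (e' - e)])) hm
    measurable_const
  -- The fourth moment of `h` is the second moment of `h|h|`, which unlike `h²` is odd. Its local
  -- Lipschitz constant `2|h|` leads back to the second moment of `h`.
  have h4 := poincare_uniformSphere (v := fun e => h e * |h e|) (ℓ := fun e => 2 * |h e|) (C := 2)
    (fun e he => by simp only [hodd e he, abs_neg]; ring)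
    (fun e he => ⟨by positivity, by linarith [hb e he]⟩)
    (fun e e' he he' => by
      have h1 := hlip e e' he he'
      have h3 : h e' * |h e'| - h e * |h e| = (h e' - h e) * |h e'| + h e * (|h e'| - |h e|) := by
        ring
      have h5 : |h e'| ≤ |h e| + |h e' - h e| := by
        have := abs_add_le (h e) (h e' - h e)
        rwa [add_sub_cancel] at this
      have h6 : |(|h e'| - |h e|)| ≤ |h e' - h e| := abs_abs_sub_abs_le _ _
      rw [h3]
      refine (abs_add_le _ _).trans ?_
      rw [abs_mul, abs_mul, abs_abs]
      have n1 := abs_nonneg (h e' - h e)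
      have n2 := abs_nonneg (h e)
      calc |h e' - h e| * |h e'| + |h e| * |(|h e'| - |h e|)|
          ≤ |h e' - h e| * (|h e| + |h e' - h e|) + |h e| * |h e' - h e| := by gcongr
        _ = (2 * |h e| + |h e' - h e|) * |h e' - h e| := by ring
        _ ≤ (2 * |h e| + ‖e' - e‖) * ‖e' - e‖ := by gcongr
        _ ≤ _ := by nlinarith [norm_nonneg (e' - e)])
    (by fun_prop) (by fun_prop)
  simp only [one_pow, integral_const, probReal_univ, smul_eq_mul, mul_one, mul_pow, sq_abs] at h2 h4
  refine ⟨hb, h2, ?_⟩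
  simp only [← pow_add] at h4
  rw [integral_const_mul] at h4
  nlinarith

/-- For `d ≥ 6` one has `d/(d-1) ≤ 6/5`. So the weight has mean at most `√2·6/5 < 17/10` and second
moment at most `8·36/25 = 11.52`, below `(2·17/10)² = 11.56`. At `d = 5` both of these estimates
would miss the target. -/
lemma integral_mul_pNorm_sq_le_of_odd_lipschitz_large {h : 𝔼 → ℝ} (hm : Measurable h) (hd : 6 ≤ d)
    (hodd : ∀ e, ‖e‖ = 1 → h (-e) = -h e)
    (hlip : ∀ e e', ‖e‖ = 1 → ‖e'‖ = 1 → |h e' - h e| ≤ ‖e' - e‖) {q : ℝ} (hq : 2 ≤ q) :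
    ∫ e, (√2 * d * h e ^ 2) * pNorm q e ^ 2 ∂(uniformSphere d) ≤
      (d : ℝ) ^ (2 / q - 1) * (2 * q - 1) := by
  obtain ⟨hb, h2, h4⟩ := integral_sq_and_pow_four_le hm (by omega) hodd hlip
  have hd6 : (6 : ℝ) ≤ d := by exact_mod_cast hd
  have hs : √2 ^ 2 = 2 := Real.sq_sqrt (by norm_num)
  have hs1 : √2 ≤ 1.4143 := by rw [Real.sqrt_le_left (by norm_num)]; norm_num
  have hkm : Measurable fun e => √2 * d * h e ^ 2 := by fun_prop
  refine integral_mul_pNorm_sq_le ?_ (fun e => by positivity) ?_ ?_ hq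
  · rw [memLp_two_iff_integrable_sq hkm.aestronglyMeasurable]
    refine integrable_uniformSphere_of_bound (hkm.pow_const 2).aestronglyMeasurable
      ((√2 * d) ^ 2) fun e he => ?_
    rw [abs_of_nonneg (sq_nonneg _), mul_pow _ (h e ^ 2)]
    have : (h e ^ 2) ^ 2 ≤ 1 := by
      rw [← pow_mul, ← Even.pow_abs (by decide)]
      exact pow_le_one₀ (abs_nonneg _) (hb e he)
    nlinarith [sq_nonneg (√2 * (d : ℝ))]
  · rw [integral_const_mul]
    have hI : 0 ≤ ∫ e, h e ^ 2 ∂(uniformSphere d) := integral_nonneg fun e => sq_nonneg _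
    have h5 : (d : ℝ) * ∫ e, h e ^ 2 ∂(uniformSphere d) ≤ 6 / 5 := by nlinarith
    have : √2 * d * ∫ e, h e ^ 2 ∂(uniformSphere d) ≤ 1.4143 * (6 / 5) := by
      rw [mul_assoc]
      have : 0 ≤ (d : ℝ) * ∫ e, h e ^ 2 ∂(uniformSphere d) := by positivity
      gcongr
    linarith
  · have e1 : ∀ e, (√2 * d * h e ^ 2) ^ 2 = 2 * (d : ℝ) ^ 2 * h e ^ 4 := fun e => by
      rw [mul_pow, mul_pow, hs]; ring
    simp_rw [e1]
    rw [integral_const_mul]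
    have hI : 0 ≤ ∫ e, h e ^ 4 ∂(uniformSphere d) := integral_nonneg fun e => by positivity
    have h5 : (d : ℝ) ^ 2 * ∫ e, h e ^ 4 ∂(uniformSphere d) ≤ 36 / 25 * 4 := by
      have : (d : ℝ) ^ 2 ≤ 36 / 25 * ((d : ℝ) - 1) ^ 2 := by nlinarith
      nlinarith
    nlinarith

/-- In low dimension `‖e‖_q ≤ 1` loses little: the second moment of `h` and Bernoulli's bound for
`d^(1-2/q)` leave one explicit quadratic inequality in `q` for each `d`. -/
lemma integral_mul_pNorm_sq_le_of_odd_lipschitz_small {h : 𝔼 → ℝ} (hm : Measurable h) (hd2 : 2 ≤ d)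
    (hd5 : d ≤ 5) (hodd : ∀ e, ‖e‖ = 1 → h (-e) = -h e)
    (hlip : ∀ e e', ‖e‖ = 1 → ‖e'‖ = 1 → |h e' - h e| ≤ ‖e' - e‖) {q : ℝ} (hq : 2 ≤ q) :
    ∫ e, (√2 * d * h e ^ 2) * pNorm q e ^ 2 ∂(uniformSphere d) ≤
      (d : ℝ) ^ (2 / q - 1) * (2 * q - 1) := by
  obtain ⟨hb, h2, -⟩ := integral_sq_and_pow_four_le hm hd2 hodd hlip
  have hd0 : (0 : ℝ) < d := Nat.cast_pos.2 (NeZero.pos d)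
  have hq0 : 0 < q := by linarith
  have hhi : Integrable (fun e => h e ^ 2) (uniformSphere d) :=
    integrable_uniformSphere_of_bound (by fun_prop) 1 fun e he => by
      rw [abs_pow]; exact pow_le_one₀ (abs_nonneg _) (hb e he)
  have h3 : ∫ e, (√2 * d * h e ^ 2) * pNorm q e ^ 2 ∂(uniformSphere d) ≤
      √2 * d * ∫ e, h e ^ 2 ∂(uniformSphere d) := by
    rw [← integral_const_mul]
    refine integral_mono_of_nonneg (Filter.Eventually.of_forall fun e => by positivity)
      (hhi.const_mul _) ?_
    filter_upwards [ae_uniformSphere_norm_eq_one d] with e he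
    exact mul_le_of_le_one_right (by positivity)
      (pow_le_one₀ (pNorm_nonneg _ _) (pNorm_le_one hq he))
  refine h3.trans ?_
  have h5 := rpow_one_sub_two_div_le d hq
  have hs1 : √2 ≤ 1.4143 := by rw [Real.sqrt_le_left (by norm_num)]; norm_num
  have h6 : √2 * d * ∫ e, h e ^ 2 ∂(uniformSphere d) ≤ 1.4143 * (d / ((d : ℝ) - 1)) := by
    have hd1 : (0 : ℝ) < (d : ℝ) - 1 := by
      have : (2 : ℝ) ≤ d := by exact_mod_cast hd2
      linarith
    have : ∫ e, h e ^ 2 ∂(uniformSphere d) ≤ 1 / ((d : ℝ) - 1) := by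
      rw [le_div_iff₀ hd1]; linarith
    calc √2 * d * ∫ e, h e ^ 2 ∂(uniformSphere d) ≤ 1.4143 * d * (1 / ((d : ℝ) - 1)) := by
          have hI : 0 ≤ ∫ e, h e ^ 2 ∂(uniformSphere d) := integral_nonneg fun e => sq_nonneg _
          gcongr
      _ = _ := by ring
  have h7 : 1.4143 * (d / ((d : ℝ) - 1)) * (1 + (1 - 2 / q) * ((d : ℝ) - 1)) ≤ 2 * q - 1 := by
    have e1 : 1.4143 * (d / ((d : ℝ) - 1)) * (1 + (1 - 2 / q) * ((d : ℝ) - 1)) =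
      1.4143 * (d / ((d : ℝ) - 1)) * (q + (q - 2) * ((d : ℝ) - 1)) / q := by field_simp
    rw [e1, div_le_iff₀ hq0]
    interval_cases d
    · norm_num
      nlinarith [sq_nonneg (q - 1.664)]
    · norm_num
      nlinarith [sq_nonneg (q - 1.85)]
    · norm_num
      nlinarith [sq_nonneg (q - 2.13)]
    · norm_num
      nlinarith [sq_nonneg (q - 2.46)]
  have h8 : (d : ℝ) ^ (2 / q - 1) * (d : ℝ) ^ (1 - 2 / q) = 1 := by
    rw [← Real.rpow_add hd0]; norm_num
  have hc : 0 ≤ 1.4143 * (d / ((d : ℝ) - 1)) := by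
    have : (2 : ℝ) ≤ d := by exact_mod_cast hd2
    have : (0 : ℝ) ≤ (d : ℝ) - 1 := by linarith
    positivity
  calc √2 * d * ∫ e, h e ^ 2 ∂(uniformSphere d) ≤ 1.4143 * (d / ((d : ℝ) - 1)) := h6
    _ = (d : ℝ) ^ (2 / q - 1) * (1.4143 * (d / ((d : ℝ) - 1)) * (d : ℝ) ^ (1 - 2 / q)) := by
        linear_combination (-1.4143 * (d / ((d : ℝ) - 1))) * h8
    _ ≤ (d : ℝ) ^ (2 / q - 1) * (2 * q - 1) := by
        gcongr
        refine le_trans ?_ h7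
        gcongr

lemma integral_mul_pNorm_sq_le_of_odd_lipschitz {h : 𝔼 → ℝ} (hm : Measurable h) (hd2 : 2 ≤ d)
    (hodd : ∀ e, ‖e‖ = 1 → h (-e) = -h e)
    (hlip : ∀ e e', ‖e‖ = 1 → ‖e'‖ = 1 → |h e' - h e| ≤ ‖e' - e‖) {q : ℝ} (hq : 2 ≤ q) :
    ∫ e, (√2 * d * h e ^ 2) * pNorm q e ^ 2 ∂(uniformSphere d) ≤
      (d : ℝ) ^ (2 / q - 1) * (2 * q - 1) := by
  rcases le_or_gt d 5 with h5 | h5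
  · exact integral_mul_pNorm_sq_le_of_odd_lipschitz_small hm hd2 h5 hodd hlip hq
  · exact integral_mul_pNorm_sq_le_of_odd_lipschitz_large hm h5 hodd hlip hq

end OddLipschitz

/-! ### The dual norm, including `q = ∞`. -/

section DualNorm

variable {d : ℕ}

local notation "𝔼" => EuclideanSpace ℝ (Fin d)

/-- The `ℓ_q`-norm for `q ∈ [1, ∞]`. -/
def qNorm (q : ℝ≥0∞) (x : 𝔼) : ℝ := if q = ∞ then ‖x.ofLp‖ else pNorm q.toReal x

lemma qNorm_nonneg (q : ℝ≥0∞) (x : 𝔼) : 0 ≤ qNorm q x := by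
  unfold qNorm; split_ifs
  · exact norm_nonneg _
  · exact pNorm_nonneg _ _

lemma two_le_toReal {q : ℝ≥0∞} (hq : 2 ≤ q) (h : q ≠ ∞) : 2 ≤ q.toReal :=
  (ENNReal.ofReal_le_iff_le_toReal h).1 (by simpa using hq)

lemma continuous_qNorm {q : ℝ≥0∞} (hq : 2 ≤ q) : Continuous (qNorm q : 𝔼 → ℝ) := by
  unfold qNorm; split_ifs with h
  · fun_prop
  · exact continuous_pNorm (by linarith [two_le_toReal hq h])

lemma pNorm_smul {q : ℝ} (hq : 0 < q) (c : ℝ) (x : 𝔼) : pNorm q (c • x) = |c| * pNorm q x := by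
  unfold pNorm
  simp only [PiLp.smul_apply, smul_eq_mul, abs_mul, Real.mul_rpow (abs_nonneg _) (abs_nonneg _)]
  rw [← Finset.mul_sum, Real.mul_rpow (by positivity) (by positivity), ← Real.rpow_mul (abs_nonneg _),
    mul_one_div_cancel hq.ne', Real.rpow_one]

lemma qNorm_smul {q : ℝ≥0∞} (hq : 2 ≤ q) (c : ℝ) (x : 𝔼) : qNorm q (c • x) = |c| * qNorm q x := by
  unfold qNorm; split_ifs with h
  · rw [WithLp.ofLp_smul, norm_smul, Real.norm_eq_abs]
  · exact pNorm_smul (by linarith [two_le_toReal hq h]) c x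

lemma abs_coord_le_pNorm {s : ℝ} (hs : 0 < s) (x : 𝔼) (i : Fin d) : |x i| ≤ pNorm s x := by
  have h1 : |x i| ^ s ≤ ∑ j, |x j| ^ s :=
    Finset.single_le_sum (f := fun j => |x j| ^ s) (fun j _ => by positivity) (Finset.mem_univ i)
  calc |x i| = (|x i| ^ s) ^ (1 / s) := by
        rw [← Real.rpow_mul (abs_nonneg _), mul_one_div_cancel hs.ne', Real.rpow_one]
    _ ≤ pNorm s x := by unfold pNorm; gcongr

lemma pNorm_anti {s r : ℝ} (hs : 0 < s) (hsr : s ≤ r) (x : 𝔼) : pNorm r x ≤ pNorm s x := by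
  have hr : 0 < r := hs.trans_le hsr
  have h0 := pNorm_nonneg s x
  have h1 : ∑ i, |x i| ^ r ≤ pNorm s x ^ r := by
    calc ∑ i, |x i| ^ r ≤ ∑ i, |x i| ^ s * pNorm s x ^ (r - s) := by
          refine Finset.sum_le_sum fun i _ => ?_
          calc |x i| ^ r = |x i| ^ s * |x i| ^ (r - s) := by
                rw [← Real.rpow_add_of_nonneg (abs_nonneg _) hs.le (by linarith)]
                congr 1; ring
            _ ≤ _ := by
                have h2 := abs_coord_le_pNorm hs x i
                have h3 : 0 ≤ r - s := by linarith
                gcongr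
      _ = pNorm s x ^ s * pNorm s x ^ (r - s) := by rw [← Finset.sum_mul, pNorm_rpow hs]
      _ = _ := by
          rw [← Real.rpow_add_of_nonneg h0 hs.le (by linarith)]
          congr 1; ring
  calc pNorm r x = (∑ i, |x i| ^ r) ^ (1 / r) := rfl
    _ ≤ (pNorm s x ^ r) ^ (1 / r) := by gcongr
    _ = _ := by rw [← Real.rpow_mul h0, mul_one_div_cancel hr.ne', Real.rpow_one]

lemma pNorm_two (x : 𝔼) : pNorm 2 x = ‖x‖ := by
  rw [EuclideanSpace.norm_eq, pNorm, Real.sqrt_eq_rpow]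
  simp

lemma norm_le_pNorm {p : ℝ} (hp1 : 1 ≤ p) (hp2 : p ≤ 2) (x : 𝔼) : ‖x‖ ≤ pNorm p x := by
  rw [← pNorm_two]; exact pNorm_anti (by linarith) hp2 x

lemma qNorm_le_pNorm {q : ℝ≥0∞} {s : ℝ} (hs : 0 < s) (hq : q ≠ ∞ → s ≤ q.toReal) (x : 𝔼) :
    qNorm q x ≤ pNorm s x := by
  unfold qNorm; split_ifs with h
  · exact (pi_norm_le_iff_of_nonneg (pNorm_nonneg _ _)).2 fun i => abs_coord_le_pNorm hs x i
  · exact pNorm_anti hs (hq h) x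

lemma qNorm_le_norm {q : ℝ≥0∞} (hq : 2 ≤ q) (x : 𝔼) : qNorm q x ≤ ‖x‖ := by
  rw [← pNorm_two]
  exact qNorm_le_pNorm (by norm_num) (fun h => two_le_toReal hq h) x

/-- Hölder's inequality for the Euclidean inner product. -/
lemma inner_le_qNorm_mul_pNorm {p : ℝ} (hp1 : 1 ≤ p) (hp2 : p ≤ 2) {q : ℝ≥0∞}
    (hpq : (ENNReal.ofReal p).HolderConjugate q) (x y : 𝔼) :
    inner ℝ x y ≤ qNorm q x * pNorm p y := by
  have hin : inner ℝ x y = ∑ i, x i * y i := by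
    rw [PiLp.inner_apply]; simp [mul_comm]
  rw [hin]
  unfold qNorm; split_ifs with h
  · subst h
    have hp : p = 1 := by
      have := ENNReal.HolderConjugate.inv_add_inv_eq_one (ENNReal.ofReal p) ∞
      rw [ENNReal.inv_top, add_zero, ENNReal.inv_eq_one] at this
      rwa [← ENNReal.ofReal_one, ENNReal.ofReal_eq_ofReal_iff (by linarith) (by norm_num)] at this
    subst hp
    simp only [pNorm, Real.rpow_one, div_one, Finset.mul_sum]
    refine Finset.sum_le_sum fun i _ => (le_abs_self _).trans ?_
    rw [abs_mul]
    gcongr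
    exact norm_le_pi_norm x.ofLp i
  · have hc : q.toReal.HolderConjugate p := by
      have := ENNReal.HolderConjugate.toReal_of_ne_top (p := ENNReal.ofReal p) (q := q)
        ENNReal.ofReal_ne_top h
      rw [ENNReal.toReal_ofReal (by linarith)] at this
      exact this.symm
    have := Real.inner_le_Lp_mul_Lq Finset.univ (fun i => x i) (fun i => y i) hc
    exact this

lemma two_le_of_holderConjugate {p : ℝ} (hp2 : p ≤ 2) {q : ℝ≥0∞}
    (hpq : (ENNReal.ofReal p).HolderConjugate q) : 2 ≤ q := by
  have h1 := ENNReal.HolderConjugate.inv_add_inv_eq_one (ENNReal.ofReal p) q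
  have h2 : (2 : ℝ≥0∞)⁻¹ ≤ (ENNReal.ofReal p)⁻¹ :=
    ENNReal.inv_le_inv.2 (by simpa using ENNReal.ofReal_le_ofReal hp2)
  rw [← ENNReal.inv_le_inv]
  have h3 : (2 : ℝ≥0∞)⁻¹ + q⁻¹ ≤ 2⁻¹ + 2⁻¹ := by
    rw [ENNReal.inv_two_add_inv_two, ← h1]; gcongr
  exact (ENNReal.add_le_add_iff_left (by simp)).1 h3

end DualNorm

/-! ### Second moments in terms of `a_q`, including the logarithmic branch. -/

section LogBranch

variable {d : ℕ}

local notation "𝔼" => EuclideanSpace ℝ (Fin d)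

/-- This numerical bound keeps `32 ln d - 8` positive and makes `4 ln d ≥ 2` an admissible exponent.
-/
lemma log_natCast_ge (hd : 2 ≤ d) : 0.69 ≤ Real.log d := by
  have h1 : Real.log 2 ≤ Real.log d := Real.log_le_log (by norm_num) (by exact_mod_cast hd)
  linarith [Real.log_two_gt_d9]

lemma aConst_pos (hd : 2 ≤ d) {q : ℝ≥0∞} (hq : 2 ≤ q) : 0 < aConst d q := by
  have hL := log_natCast_ge hd
  have hd0 : (0 : ℝ) < d := by exact_mod_cast (by omega : 0 < d)
  have h1 : 0 < √(32 * Real.log d - 8) := Real.sqrt_pos.2 (by linarith)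
  unfold aConst
  refine mul_pos (by positivity) ?_
  split_ifs with h
  · exact h1
  · exact lt_min h1 (Real.sqrt_pos.2 (by linarith [two_le_toReal hq h]))

lemma le_aConst_sq (hd : 2 ≤ d) {q : ℝ≥0∞} (hq : 2 ≤ q) {z : ℝ}
    (h1 : z ≤ (d : ℝ) ^ (2 * (q⁻¹).toReal - 1) * (32 * Real.log d - 8))
    (h2 : q ≠ ∞ → z ≤ (d : ℝ) ^ (2 * (q⁻¹).toReal - 1) * (2 * q.toReal - 1)) :
    z ≤ aConst d q ^ 2 := by
  have hL := log_natCast_ge hd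
  have hd0 : (0 : ℝ) < d := by exact_mod_cast (by omega : 0 < d)
  have e1 : ((d : ℝ) ^ ((q⁻¹).toReal - 1 / 2)) ^ 2 = (d : ℝ) ^ (2 * (q⁻¹).toReal - 1) := by
    rw [← Real.rpow_natCast, ← Real.rpow_mul hd0.le]; congr 1; push_cast; ring
  unfold aConst
  rw [mul_pow, e1]
  split_ifs with h
  · rwa [Real.sq_sqrt (by linarith)]
  · have hq2 := two_le_toReal hq h
    rcases min_choice √(32 * Real.log d - 8) √(2 * q.toReal - 1) with hm | hm <;> rw [hm]
    · rwa [Real.sq_sqrt (by linarith)]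
    · rw [Real.sq_sqrt (by linarith)]; exact h2 h

/-- If `q ≤ 4 ln d`, then `2q - 1` is already below `32 ln d - 8`. Otherwise the `ℓ_q`-norm is
dominated by the `ℓ_r`-norm with `r = 4 ln d`, for which `d^(2/r) = √e ≤ 2`, so the bound is at most
`2(8 ln d - 1)/d`. -/
lemma integral_mul_qNorm_sq_le [NeZero d] (hd : 2 ≤ d) {q : ℝ≥0∞} (hq : 2 ≤ q) {k : 𝔼 → ℝ}
    (hkm : Measurable k) (hk0 : ∀ e, 0 ≤ k e) {C : ℝ} (hkC : ∀ e, ‖e‖ = 1 → k e ≤ C)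
    (H : ∀ r : ℝ, 2 ≤ r → ∫ e, k e * pNorm r e ^ 2 ∂(uniformSphere d) ≤
      (d : ℝ) ^ (2 / r - 1) * (2 * r - 1)) :
    ∫ e, k e * qNorm q e ^ 2 ∂(uniformSphere d) ≤ aConst d q ^ 2 := by
  have hL := log_natCast_ge hd
  have hd0 : (0 : ℝ) < d := by exact_mod_cast (by omega : 0 < d)
  have hd1 : (1 : ℝ) ≤ d := by exact_mod_cast (by omega : 1 ≤ d)
  have hfin : q ≠ ∞ → ∫ e, k e * qNorm q e ^ 2 ∂(uniformSphere d) ≤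
      (d : ℝ) ^ (2 * (q⁻¹).toReal - 1) * (2 * q.toReal - 1) := fun h => by
    have := H q.toReal (two_le_toReal hq h)
    simpa only [qNorm, h, if_false, ENNReal.toReal_inv, div_eq_mul_inv] using this
  have hnn : 0 ≤ (q⁻¹).toReal := ENNReal.toReal_nonneg
  refine le_aConst_sq hd hq ?_ hfin
  by_cases hs : q ≠ ∞ ∧ q.toReal ≤ 4 * Real.log d
  · refine (hfin hs.1).trans ?_
    have := hs.2
    gcongr ?_ * ?_
    linarith
  · have hs' : q ≠ ∞ → 4 * Real.log d ≤ q.toReal := fun h => by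
      by_contra h'
      exact hs ⟨h, (not_le.1 h').le⟩
    have hs2 : 2 ≤ 4 * Real.log d := by linarith
    have h1 : ∫ e, k e * qNorm q e ^ 2 ∂(uniformSphere d) ≤
        ∫ e, k e * pNorm (4 * Real.log d) e ^ 2 ∂(uniformSphere d) := by
      refine integral_mono_of_nonneg
        (Filter.Eventually.of_forall fun e => mul_nonneg (hk0 e) (sq_nonneg _)) ?_
        (Filter.Eventually.of_forall fun e => ?_)
      · refine integrable_uniformSphere_of_bound
          (hkm.mul ((continuous_pNorm (by linarith)).measurable.pow_const 2)).aestronglyMeasurable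
          C fun e he => ?_
        have hp0 := pNorm_nonneg (4 * Real.log d) e
        rw [abs_of_nonneg (mul_nonneg (hk0 e) (sq_nonneg _))]
        exact (mul_le_of_le_one_right (hk0 e)
          (pow_le_one₀ (pNorm_nonneg _ _) (pNorm_le_one hs2 he))).trans (hkC e he)
      · have := qNorm_le_pNorm (by linarith : 0 < 4 * Real.log d) hs' e
        have h0 := qNorm_nonneg q e
        have hke := hk0 e
        show k e * qNorm q e ^ 2 ≤ k e * pNorm (4 * Real.log d) e ^ 2
        gcongr
    refine (h1.trans (H _ hs2)).trans ?_
    have e2 : (d : ℝ) ^ (2 / (4 * Real.log d)) ≤ 2 := by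
      rw [Real.rpow_def_of_pos hd0, show Real.log d * (2 / (4 * Real.log d)) = 1 / 2 by
        field_simp; norm_num]
      have h3 : Real.exp (1 / 2) ^ 2 = Real.exp 1 := by
        rw [← Real.exp_nat_mul]; norm_num
      nlinarith [Real.exp_one_lt_d9, Real.exp_pos (1 / 2)]
    have e3 : (1 : ℝ) ≤ (d : ℝ) ^ (2 * (q⁻¹).toReal) := Real.one_le_rpow hd1 (by positivity)
    rw [Real.rpow_sub hd0, Real.rpow_sub hd0, Real.rpow_one, div_mul_eq_mul_div,
      div_mul_eq_mul_div]
    gcongr ?_ / _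
    nlinarith

lemma integral_qNorm_sq_le [NeZero d] (hd : 2 ≤ d) {q : ℝ≥0∞} (hq : 2 ≤ q) :
    ∫ e : 𝔼, qNorm q e ^ 2 ∂(uniformSphere d) ≤ aConst d q ^ 2 := by
  have := integral_mul_qNorm_sq_le hd hq (k := fun _ : 𝔼 => (1 : ℝ)) measurable_const
    (fun _ => zero_le_one) (C := 1) (fun _ _ => le_rfl) fun r hr =>
      integral_mul_pNorm_sq_le (memLp_const 1) (fun _ => zero_le_one)
        (by simp; norm_num) (by simp; norm_num) hr
  simpa using this

/-- Rescaling by `L` reduces to the `1`-Lipschitz case; for `L = 0` oddness makes `h` vanish on the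
sphere. The normalisation `√2 d` is the origin of the factor `2^(1/4)` in `σ_q`. -/
lemma integral_sq_mul_qNorm_sq_le [NeZero d] (hd : 2 ≤ d) {q : ℝ≥0∞} (hq : 2 ≤ q) {h : 𝔼 → ℝ}
    (hm : Measurable h) (hodd : ∀ e, ‖e‖ = 1 → h (-e) = -h e) {L : ℝ} (hL : 0 ≤ L)
    (hlip : ∀ e e', ‖e‖ = 1 → ‖e'‖ = 1 → |h e' - h e| ≤ L * ‖e' - e‖) :
    √2 * d * ∫ e, h e ^ 2 * qNorm q e ^ 2 ∂(uniformSphere d) ≤ L ^ 2 * aConst d q ^ 2 := by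
  rcases hL.eq_or_lt with rfl | hL
  · have h0 : ∀ᵐ e ∂(uniformSphere d), h e ^ 2 * qNorm q e ^ 2 = 0 := by
      filter_upwards [ae_uniformSphere_norm_eq_one d] with e he
      have h1 := hlip e (-e) he (by rwa [norm_neg])
      rw [zero_mul, abs_nonpos_iff, hodd e he] at h1
      have : h e = 0 := by linarith
      simp [this]
    rw [integral_congr_ae h0]; simp
  · have hlip' : ∀ e e', ‖e‖ = 1 → ‖e'‖ = 1 → |h e' / L - h e / L| ≤ ‖e' - e‖ := by
      intro e e' he he'
      rw [← sub_div, abs_div, abs_of_pos hL, div_le_iff₀ hL, mul_comm]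
      exact hlip e e' he he'
    have hodd' : ∀ e, ‖e‖ = 1 → h (-e) / L = -(h e / L) := fun e he => by
      rw [hodd e he, neg_div]
    have hm' : Measurable fun e => h e / L := hm.div_const L
    have hb := (integral_sq_and_pow_four_le hm' hd hodd' hlip').1
    have := integral_mul_qNorm_sq_le hd hq (k := fun e => √2 * d * (h e / L) ^ 2)
      (by fun_prop) (fun e => by positivity) (C := √2 * d)
      (fun e he => mul_le_of_le_one_right (by positivity)
        (by rw [← sq_abs]; exact pow_le_one₀ (abs_nonneg _) (hb e he)))
      fun r hr => integral_mul_pNorm_sq_le_of_odd_lipschitz hm' hd hodd' hlip' hr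
    have e1 : ∀ e, √2 * d * (h e / L) ^ 2 * qNorm q e ^ 2 =
      (√2 * d / L ^ 2) * (h e ^ 2 * qNorm q e ^ 2) := fun e => by field_simp
    simp_rw [e1] at this
    rw [integral_const_mul, div_mul_eq_mul_div, div_le_iff₀ (by positivity)] at this
    linarith

end LogBranch

end ZORSMD

end

noncomputable section

namespace ZORSMD

/-! ### Uniformly convex prox-functions and the mirror step. -/

section Prox

open Filter Topology

variable {d : ℕ}

local notation "𝔼" => EuclideanSpace ℝ (Fin d)

lemma measurable_gradient (Ψ : 𝔼 → ℝ) : Measurable (gradient Ψ) :=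
  (InnerProductSpace.toDual ℝ 𝔼).symm.continuous.measurable.comp (measurable_fderiv ℝ Ψ)

lemma bregman_add_bregman (Ψ : 𝔼 → ℝ) (x y : 𝔼) :
    bregman Ψ x y + bregman Ψ y x = inner ℝ (gradient Ψ x - gradient Ψ y) (x - y) := by
  simp only [bregman, inner_sub_left, inner_sub_right]; ring

lemma bregman_three_point (Ψ : 𝔼 → ℝ) (x y z : 𝔼) :
    bregman Ψ z x - bregman Ψ z y - bregman Ψ y x =
      inner ℝ (gradient Ψ y - gradient Ψ x) (z - y) := by
  simp only [bregman, inner_sub_left, inner_sub_right]; ring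

/-- First-order optimality condition for linear perturbations of a differentiable function over a
convex set. -/
lemma inner_gradient_sub_nonneg_of_isMinOn {Ψ : 𝔼 → ℝ} (hΨ : Differentiable ℝ Ψ) {C : Set 𝔼}
    (hC : Convex ℝ C) {u z w : 𝔼} (hz : z ∈ C) (hw : w ∈ C)
    (hmin : IsMinOn (fun y => Ψ y - inner ℝ u y) C z) :
    0 ≤ inner ℝ (gradient Ψ z - u) (w - z) := by
  have h1 : HasFDerivAt (fun y => Ψ y - inner ℝ u y)
      (InnerProductSpace.toDual ℝ 𝔼 (gradient Ψ z) - innerSL ℝ u) z :=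
    ((hΨ z).hasGradientAt.hasFDerivAt).sub (innerSL ℝ u).hasFDerivAt
  have h2 := hmin.localize.hasFDerivWithinAt_nonneg h1.hasFDerivWithinAt
    (mem_posTangentConeAt_of_segment_subset (y := w - z) (by simpa using hC.segment_subset hz hw))
  simpa [inner_sub_left] using h2

variable {κ p : ℝ} {Ψ : EuclideanSpace ℝ (Fin d) → ℝ}

lemma two_le_exponent (hκ0 : 0 < κ) (hκ1 : κ ≤ 1) : 2 ≤ (1 + κ) / κ := by
  rw [le_div_iff₀ hκ0]; linarith

lemma IsUniformlyConvex.norm_rpow_le_bregman (hκ0 : 0 < κ) (hp1 : 1 ≤ p) (hp2 : p ≤ 2)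
    (hΨ : IsUniformlyConvex 1 ((1 + κ) / κ) p Ψ) (x y : 𝔼) :
    κ / (1 + κ) * ‖x - y‖ ^ ((1 + κ) / κ) ≤ bregman Ψ y x := by
  refine le_trans ?_ (hΨ.le_bregman x y)
  rw [one_div_div]
  have := norm_le_pNorm hp1 hp2 (x - y)
  gcongr

lemma IsUniformlyConvex.bregman_nonneg (hκ0 : 0 < κ)
    (hΨ : IsUniformlyConvex 1 ((1 + κ) / κ) p Ψ) (x y : 𝔼) : 0 ≤ bregman Ψ y x :=
  le_trans (mul_nonneg (by positivity) (Real.rpow_nonneg (pNorm_nonneg _ _) _))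
    (hΨ.le_bregman x y)

/-- Solutions of the variational inequality for `∇Ψ - u` are Hölder continuous in `u`. -/
lemma IsUniformlyConvex.norm_sub_le (hκ0 : 0 < κ) (hp1 : 1 ≤ p) (hp2 : p ≤ 2)
    (hΨ : IsUniformlyConvex 1 ((1 + κ) / κ) p Ψ) {u v y z : 𝔼}
    (hy : 0 ≤ inner ℝ (gradient Ψ y - u) (z - y)) (hz : 0 ≤ inner ℝ (gradient Ψ z - v) (y - z)) :
    ‖y - z‖ ≤ ((1 + κ) / (2 * κ) * ‖u - v‖) ^ κ := by
  have h1 := hΨ.norm_rpow_le_bregman hκ0 hp1 hp2 y z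
  have h2 := hΨ.norm_rpow_le_bregman hκ0 hp1 hp2 z y
  rw [norm_sub_rev] at h2
  have h3 := bregman_add_bregman Ψ y z
  have h4 : inner ℝ (gradient Ψ y - gradient Ψ z) (y - z) ≤ inner ℝ (u - v) (y - z) := by
    simp only [inner_sub_left, inner_sub_right] at hy hz ⊢; linarith
  have h5 := real_inner_le_norm (u - v) (y - z)
  rcases (norm_nonneg (y - z)).eq_or_lt with h0 | h0
  · rw [← h0]; positivity
  · have e1 : ‖y - z‖ ^ ((1 + κ) / κ) = ‖y - z‖ ^ (1 / κ) * ‖y - z‖ := by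
      rw [← Real.rpow_add_one h0.ne']; congr 1; field_simp
    rw [e1] at h1 h2
    have h6 : (2 * (κ / (1 + κ)) * ‖y - z‖ ^ (1 / κ)) * ‖y - z‖ ≤ ‖u - v‖ * ‖y - z‖ := by linarith
    have h7 := le_of_mul_le_mul_right h6 h0
    have h8 : ‖y - z‖ ^ (1 / κ) ≤ (1 + κ) / (2 * κ) * ‖u - v‖ := by
      calc ‖y - z‖ ^ (1 / κ)
          = (1 + κ) / (2 * κ) * (2 * (κ / (1 + κ)) * ‖y - z‖ ^ (1 / κ)) := by field_simp
        _ ≤ _ := by gcongr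
    calc ‖y - z‖ = (‖y - z‖ ^ (1 / κ)) ^ κ := by
          rw [← Real.rpow_mul h0.le, one_div_mul_cancel hκ0.ne', Real.rpow_one]
      _ ≤ _ := by gcongr

lemma tendsto_holder_bound (hκ0 : 0 < κ) (u : 𝔼) :
    Tendsto (fun v => ((1 + κ) / (2 * κ) * ‖v - u‖) ^ κ) (𝓝 u) (𝓝 0) := by
  have h : Continuous fun v : 𝔼 => ((1 + κ) / (2 * κ) * ‖v - u‖) ^ κ :=
    (by fun_prop : Continuous fun v : 𝔼 => (1 + κ) / (2 * κ) * ‖v - u‖).rpow_const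
      fun _ => Or.inr hκ0.le
  have := h.tendsto u
  simpa [Real.zero_rpow hκ0.ne'] using this

/-- Coercivity: uniform convexity at the origin gives growth of order `(1+κ)/κ > 1`, which beats any
linear term. -/
lemma IsUniformlyConvex.exists_isMinOn (hκ0 : 0 < κ) (hκ1 : κ ≤ 1) (hp1 : 1 ≤ p) (hp2 : p ≤ 2)
    (hΨ : IsUniformlyConvex 1 ((1 + κ) / κ) p Ψ) (u : 𝔼) :
    ∃ z, ∀ y, Ψ z - inner ℝ u z ≤ Ψ y - inner ℝ u y := by
  have hc : Continuous fun y => Ψ y - inner ℝ u y :=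
    hΨ.differentiable.continuous.sub (by fun_prop)
  have hr := two_le_exponent hκ0 hκ1
  refine hc.exists_forall_le ?_
  have hlow : ∀ y, Ψ 0 + ‖y‖ * (κ / (1 + κ) * ‖y‖ ^ (1 / κ) - ‖gradient Ψ 0 - u‖) ≤
      Ψ y - inner ℝ u y := by
    intro y
    have h1 := hΨ.norm_rpow_le_bregman hκ0 hp1 hp2 0 y
    rw [zero_sub, norm_neg] at h1
    have h2 := real_inner_le_norm (gradient Ψ 0 - u) (-y)
    have e1 : ‖y‖ ^ ((1 + κ) / κ) = ‖y‖ * ‖y‖ ^ (1 / κ) := by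
      rcases (norm_nonneg y).eq_or_lt with h0 | h0
      · rw [← h0, zero_mul, Real.zero_rpow (by positivity)]
      · rw [mul_comm, ← Real.rpow_add_one h0.ne']; congr 1; field_simp
    rw [e1] at h1
    simp only [bregman, sub_zero, inner_neg_right, inner_sub_left, norm_neg] at h1 h2
    nlinarith
  refine tendsto_atTop_mono hlow ?_
  refine tendsto_atTop_add_const_left _ _ ?_
  have hn : Tendsto (fun y : 𝔼 => ‖y‖) (cocompact 𝔼) atTop := tendsto_norm_cocompact_atTop
  refine hn.atTop_mul_atTop₀ ?_
  refine tendsto_atTop_add_const_right _ _ ?_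
  exact ((tendsto_rpow_atTop (by positivity)).comp hn).const_mul_atTop (by positivity)

/-- `∇Ψ` is inverse to `∇Ψ^*`. -/
lemma IsUniformlyConvex.gradient_gradient_fenchelConj (hκ0 : 0 < κ) (hκ1 : κ ≤ 1) (hp1 : 1 ≤ p)
    (hp2 : p ≤ 2) (hΨ : IsUniformlyConvex 1 ((1 + κ) / κ) p Ψ) (u : 𝔼) :
    gradient Ψ (gradient (fenchelConj Ψ) u) = u := by
  choose Z hZ using hΨ.exists_isMinOn hκ0 hκ1 hp1 hp2
  have hVI : ∀ u w, 0 ≤ inner ℝ (gradient Ψ (Z u) - u) (w - Z u) := fun u w =>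
    inner_gradient_sub_nonneg_of_isMinOn hΨ.differentiable convex_univ (Set.mem_univ _)
      (Set.mem_univ w) fun y _ => hZ u y
  -- On the whole space the variational inequality may be tested against the point displaced by
  -- `-(∇Ψ(Z u) - u)`, which forces that difference to vanish.
  have hgrad : ∀ u, gradient Ψ (Z u) = u := fun u => by
    have h := hVI u (Z u - (gradient Ψ (Z u) - u))
    rw [sub_sub_cancel_left, inner_neg_right, real_inner_self_eq_norm_sq] at h
    have : ‖gradient Ψ (Z u) - u‖ = 0 := by nlinarith [norm_nonneg (gradient Ψ (Z u) - u)]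
    exact sub_eq_zero.1 (norm_eq_zero.1 this)
  have hbd : ∀ u, BddAbove (Set.range fun x => inner ℝ x u - Ψ x) := fun u =>
    ⟨inner ℝ (Z u) u - Ψ (Z u), by
      rintro _ ⟨x, rfl⟩
      have := hZ u x
      rw [real_inner_comm (Z u) u, real_inner_comm x u] at this
      simp only; linarith⟩
  have hle : ∀ u x, inner ℝ x u - Ψ x ≤ fenchelConj Ψ u := fun u x => le_ciSup (hbd u) x
  have heq : ∀ u, fenchelConj Ψ u = inner ℝ (Z u) u - Ψ (Z u) := fun u =>
    le_antisymm (ciSup_le fun x => by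
      have := hZ u x
      rw [real_inner_comm (Z u) u, real_inner_comm x u] at this
      linarith) (hle u _)
  -- Two Fenchel inequalities put the linearisation error of the conjugate between `0` and `⟨Z v - Z
  -- u, v - u⟩`. The latter is `o(‖v - u‖)` because `Z` is Hölder continuous.
  have hG : HasGradientAt (fenchelConj Ψ) (Z u) u := by
    rw [hasGradientAt_iff_isLittleO, Asymptotics.isLittleO_iff]
    intro c hc
    have h1 : ∀ᶠ v in 𝓝 u, ((1 + κ) / (2 * κ) * ‖v - u‖) ^ κ < c :=
      (tendsto_holder_bound hκ0 u).eventually_lt_const hc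
    filter_upwards [h1] with v hv
    have h2 := hΨ.norm_sub_le hκ0 hp1 hp2 (hVI v (Z u)) (hVI u (Z v))
    have h3 := hle v (Z u)
    have h4 := hle u (Z v)
    have h5 := real_inner_le_norm (Z v - Z u) (v - u)
    have h6 : ‖Z v - Z u‖ * ‖v - u‖ ≤ c * ‖v - u‖ := by
      have := h2.trans hv.le
      gcongr
    have h7 := heq u
    have h8 := heq v
    simp only [inner_sub_left, inner_sub_right] at h5 ⊢
    rw [Real.norm_eq_abs, abs_of_nonneg (by linarith)]
    linarith
  rw [hG.gradient, hgrad]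

lemma bregman_eq_of_gradient_eq {y u : 𝔼} (h : gradient Ψ y = u) (z : 𝔼) :
    bregman Ψ z y = (Ψ z - inner ℝ u z) - (Ψ y - inner ℝ u y) := by
  rw [bregman, h, inner_sub_right]; ring

/-- First-order optimality of the mirror step. -/
lemma IsUniformlyConvex.inner_nonneg_of_isMinOn_bregman (hκ0 : 0 < κ) (hκ1 : κ ≤ 1) (hp1 : 1 ≤ p)
    (hp2 : p ≤ 2) (hΨ : IsUniformlyConvex 1 ((1 + κ) / κ) p Ψ) {X : Set 𝔼} (hX : Convex ℝ X)
    {u z w : 𝔼} (hz : z ∈ X) (hw : w ∈ X)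
    (hmin : IsMinOn (fun y => bregman Ψ y (gradient (fenchelConj Ψ) u)) X z) :
    0 ≤ inner ℝ (gradient Ψ z - u) (w - z) := by
  have hg := hΨ.gradient_gradient_fenchelConj hκ0 hκ1 hp1 hp2 u
  refine inner_gradient_sub_nonneg_of_isMinOn hΨ.differentiable hX hz hw fun y hy => ?_
  have := hmin hy
  simp only [Set.mem_ofPred_eq, bregman_eq_of_gradient_eq hg] at this
  exact sub_le_sub_iff_right _ |>.1 this

/-- The projection step depends continuously on the dual point. -/
lemma IsUniformlyConvex.exists_continuous_argmin (hκ0 : 0 < κ) (hκ1 : κ ≤ 1) (hp1 : 1 ≤ p)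
    (hp2 : p ≤ 2) (hΨ : IsUniformlyConvex 1 ((1 + κ) / κ) p Ψ) {X : Set 𝔼} (hXc : IsCompact X)
    (hX : Convex ℝ X) (hne : X.Nonempty) :
    ∃ S : 𝔼 → 𝔼, Continuous S ∧ (∀ u, S u ∈ X) ∧ ∀ u z, z ∈ X →
      IsMinOn (fun y => bregman Ψ y (gradient (fenchelConj Ψ) u)) X z → z = S u := by
  have hex : ∀ u : 𝔼, ∃ z ∈ X, IsMinOn (fun y => Ψ y - inner ℝ u y) X z := fun u =>
    hXc.exists_isMinOn hne (hΨ.differentiable.continuous.sub (by fun_prop)).continuousOn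
  choose S hS hmin using hex
  have hVI : ∀ u, ∀ w ∈ X, 0 ≤ inner ℝ (gradient Ψ (S u) - u) (w - S u) := fun u w hw =>
    inner_gradient_sub_nonneg_of_isMinOn hΨ.differentiable hX (hS u) hw (hmin u)
  refine ⟨S, continuous_iff_continuousAt.2 fun u => ?_, hS, fun u z hz hzmin => ?_⟩
  · rw [ContinuousAt, tendsto_iff_norm_sub_tendsto_zero]
    exact squeeze_zero (fun _ => norm_nonneg _)
      (fun v => hΨ.norm_sub_le hκ0 hp1 hp2 (hVI v _ (hS u)) (hVI u _ (hS v)))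
      (tendsto_holder_bound hκ0 u)
  · have := hΨ.norm_sub_le hκ0 hp1 hp2
      (hΨ.inner_nonneg_of_isMinOn_bregman hκ0 hκ1 hp1 hp2 hX hz (hS u) hzmin) (hVI u z hz)
    rw [sub_self, norm_zero, mul_zero, Real.zero_rpow hκ0.ne'] at this
    exact sub_eq_zero.1 (norm_le_zero_iff.1 this)

/-- One step of mirror descent. -/
lemma IsUniformlyConvex.mirror_descent_step (hκ0 : 0 < κ) (hκ1 : κ ≤ 1) (hp1 : 1 ≤ p)
    (hp2 : p ≤ 2) {q : ℝ≥0∞} (hpq : (ENNReal.ofReal p).HolderConjugate q)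
    (hΨ : IsUniformlyConvex 1 ((1 + κ) / κ) p Ψ) {X : Set 𝔼} (hX : Convex ℝ X) {ν : ℝ}
    (hν : 0 ≤ ν) {x g y z : 𝔼} (hy : y ∈ X) (hz : z ∈ X)
    (hmin : IsMinOn (fun w => bregman Ψ w (mirrorStep Ψ ν x g)) X y) :
    ν * inner ℝ g (x - z) ≤ bregman Ψ z x - bregman Ψ z y +
      ν ^ (1 + κ) / (1 + κ) * qNorm q g ^ (1 + κ) := by
  have h1 := hΨ.inner_nonneg_of_isMinOn_bregman hκ0 hκ1 hp1 hp2 hX hy hz hmin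
  have h2 := bregman_three_point Ψ x y z
  have h3 := hΨ.le_bregman x y
  have h4 := inner_le_qNorm_mul_pNorm hp1 hp2 hpq g (x - y)
  -- With these conjugate exponents the second term of Young's inequality equals the lower bound for
  -- `D_Ψ(y, x)`, so the two cancel.
  have hc : (1 + κ).HolderConjugate ((1 + κ) / κ) := by
    rw [Real.holderConjugate_iff]
    exact ⟨by linarith, by field_simp⟩
  have h5 := Real.young_inequality_of_nonneg (mul_nonneg hν (qNorm_nonneg q g))
    (pNorm_nonneg p (x - y)) hc
  rw [Real.mul_rpow hν (qNorm_nonneg q g)] at h5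
  have h6 : ν * inner ℝ g (x - y) ≤ ν * qNorm q g * pNorm p (x - y) := by
    rw [mul_assoc]; gcongr
  rw [one_div_div] at h3
  have e1 : pNorm p (x - y) ^ ((1 + κ) / κ) / ((1 + κ) / κ) =
    κ / (1 + κ) * pNorm p (x - y) ^ ((1 + κ) / κ) := by field_simp
  have e2 : ν ^ (1 + κ) * qNorm q g ^ (1 + κ) / (1 + κ) =
    ν ^ (1 + κ) / (1 + κ) * qNorm q g ^ (1 + κ) := by ring
  rw [e1, e2] at h5
  simp only [inner_sub_left, inner_sub_right, real_inner_smul_left] at h1 h2 h6 ⊢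
  linarith

/-- Nonnegativity of the divergence at the mirror point `2x - y` bounds the gradient term, so
`D_Ψ(y, x) ≤ Ψ(y) + Ψ(2x - y) - 2Ψ(x)`. This is continuous, and continuity of `∇Ψ` is not needed.
Without boundedness the real supremum in `bregmanDiam` would take its default value `0`. -/
lemma IsUniformlyConvex.bddAbove_bregman (hκ0 : 0 < κ)
    (hΨ : IsUniformlyConvex 1 ((1 + κ) / κ) p Ψ) {X : Set 𝔼} (hXc : IsCompact X) :
    BddAbove (Set.image2 (bregman Ψ) X X) := by
  have hcont : Continuous fun z : 𝔼 × 𝔼 => Ψ z.1 + Ψ ((2 : ℝ) • z.2 - z.1) - 2 * Ψ z.2 := by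
    have := hΨ.differentiable.continuous
    fun_prop
  obtain ⟨B, hB⟩ := (hXc.prod hXc).bddAbove_image hcont.continuousOn
  refine ⟨B, ?_⟩
  rintro _ ⟨y, hy, x, hx, rfl⟩
  have h1 := hB (Set.mem_image_of_mem _ (Set.mk_mem_prod hy hx))
  have h2 := hΨ.bregman_nonneg hκ0 x ((2 : ℝ) • x - y)
  simp only [bregman, inner_sub_right, real_inner_smul_right] at h1 h2 ⊢
  linarith

lemma IsUniformlyConvex.pNorm_sub_le_bregmanDiam (hκ0 : 0 < κ)
    (hΨ : IsUniformlyConvex 1 ((1 + κ) / κ) p Ψ) {X : Set 𝔼} (hXc : IsCompact X)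
    {x y : 𝔼} (hx : x ∈ X) (hy : y ∈ X) : pNorm p (x - y) ≤ bregmanDiam κ Ψ X := by
  have h1 := (hΨ.le_bregman x y).trans
    (le_csSup (hΨ.bddAbove_bregman hκ0 hXc) (Set.mem_image2_of_mem hy hx))
  rw [one_div_div] at h1
  have h0 := pNorm_nonneg p (x - y)
  calc pNorm p (x - y) = ((1 + κ) / κ * (κ / (1 + κ) * pNorm p (x - y) ^ ((1 + κ) / κ))) ^
        (κ / (1 + κ)) := by
        rw [← mul_assoc, show (1 + κ) / κ * (κ / (1 + κ)) = 1 by field_simp, one_mul,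
          ← Real.rpow_mul h0, show (1 + κ) / κ * (κ / (1 + κ)) = 1 by field_simp, Real.rpow_one]
    _ ≤ _ := by unfold bregmanDiam; gcongr

lemma IsUniformlyConvex.initialDist_rpow (hκ0 : 0 < κ)
    (hΨ : IsUniformlyConvex 1 ((1 + κ) / κ) p Ψ) (x y : 𝔼) :
    initialDist κ Ψ y x ^ ((1 + κ) / κ) = (1 + κ) / κ * bregman Ψ y x := by
  have h := hΨ.bregman_nonneg hκ0 x y
  rw [initialDist, ← Real.rpow_mul (by positivity),
    show κ / (1 + κ) * ((1 + κ) / κ) = 1 by field_simp, Real.rpow_one]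

lemma IsUniformlyConvex.initialDist_nonneg (hκ0 : 0 < κ)
    (hΨ : IsUniformlyConvex 1 ((1 + κ) / κ) p Ψ) (x y : 𝔼) : 0 ≤ initialDist κ Ψ y x := by
  have h := hΨ.bregman_nonneg hκ0 x y
  unfold initialDist; positivity

end Prox

end ZORSMD

end

noncomputable section

namespace ZORSMD

/-! ### A continuous retraction onto a compact convex set. -/

section Retraction

variable {d : ℕ}

local notation "𝔼" => EuclideanSpace ℝ (Fin d)

lemma hasGradientAt_half_norm_sq (x : 𝔼) : HasGradientAt (fun y : 𝔼 => ‖y‖ ^ 2 / 2) x x := by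
  rw [hasGradientAt_iff_hasFDerivAt]
  have h := (hasStrictFDerivAt_norm_sq x).hasFDerivAt.mul_const (1 / 2 : ℝ)
  have e1 : (fun y : 𝔼 => ‖y‖ ^ 2 * (1 / 2)) = fun y => ‖y‖ ^ 2 / 2 := by ext y; ring
  rw [e1] at h
  exact h.congr_fderiv (by ext y; simp)

lemma bregman_half_norm_sq (x y : 𝔼) :
    bregman (fun y : 𝔼 => ‖y‖ ^ 2 / 2) y x = ‖x - y‖ ^ 2 / 2 := by
  rw [bregman, (hasGradientAt_half_norm_sq x).gradient, norm_sub_sq_real, inner_sub_right,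
    real_inner_self_eq_norm_sq]
  ring

/-- The case `κ = 1`, `p = 2` of the prox theory, whose argmin map is the Euclidean projection and
therefore supplies the retraction. -/
lemma isUniformlyConvex_half_norm_sq :
    IsUniformlyConvex 1 ((1 + 1) / 1) 2 (fun y : 𝔼 => ‖y‖ ^ 2 / 2) where
  differentiable x := (hasGradientAt_half_norm_sq x).differentiableAt
  convex := by
    have := (convexOn_univ_norm (E := 𝔼)).pow (fun _ _ => norm_nonneg _) 2
    simpa [div_eq_inv_mul] using this.smul (by norm_num : (0 : ℝ) ≤ 2⁻¹)
  le_bregman x y := by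
    rw [bregman_half_norm_sq, pNorm_two]
    norm_num
    linarith

/-- A compact convex nonempty set is a retract of the Euclidean space. -/
lemma exists_continuous_retraction {C : Set 𝔼} (hCc : IsCompact C) (hC : Convex ℝ C)
    (hne : C.Nonempty) :
    ∃ ρ : 𝔼 → 𝔼, Continuous ρ ∧ (∀ u, ρ u ∈ C) ∧ ∀ u ∈ C, ρ u = u := by
  have h := isUniformlyConvex_half_norm_sq (d := d)
  obtain ⟨S, hS, hSC, hmin⟩ :=
    h.exists_continuous_argmin one_pos le_rfl one_le_two le_rfl hCc hC hne
  refine ⟨S, hS, hSC, fun u hu => (hmin u u hu fun y _ => ?_).symm⟩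
  have hg := h.gradient_gradient_fenchelConj one_pos le_rfl one_le_two le_rfl u
  rw [(hasGradientAt_half_norm_sq _).gradient] at hg
  rw [hg, Set.mem_ofPred_eq]
  beta_reduce
  rw [bregman_half_norm_sq, bregman_half_norm_sq, sub_self, norm_zero]
  nlinarith [sq_nonneg ‖u - y‖]

end Retraction

/-! ### Bias of the two-point difference. -/

section TwoPoint

variable {d : ℕ} {X : Set (EuclideanSpace ℝ (Fin d))} {τ : ℝ}

local notation "𝔼" => EuclideanSpace ℝ (Fin d)

lemma add_smul_mem_enlarged {x e : EuclideanSpace ℝ (Fin d)} (hx : x ∈ X) (he : ‖e‖ = 1) :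
    x + τ • e ∈ enlarged X τ :=
  Set.add_mem_add hx (Set.smul_mem_smul_set (by simp [he]))

lemma sub_smul_mem_enlarged {x e : EuclideanSpace ℝ (Fin d)} (hx : x ∈ X) (he : ‖e‖ = 1) :
    x - τ • e ∈ enlarged X τ := by
  rw [sub_eq_add_neg, ← smul_neg]
  exact add_smul_mem_enlarged hx (by rwa [norm_neg])

lemma mem_enlarged {x : EuclideanSpace ℝ (Fin d)} (hx : x ∈ X) : x ∈ enlarged X τ := by
  have : x + τ • (0 : EuclideanSpace ℝ (Fin d)) ∈ enlarged X τ :=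
    Set.add_mem_add hx (Set.smul_mem_smul_set (by simp))
  simpa using this

lemma convex_enlarged (hX : Convex ℝ X) : Convex ℝ (enlarged X τ) :=
  hX.add ((convex_closedBall _ _).smul _)

lemma isCompact_enlarged (hX : IsCompact X) : IsCompact (enlarged X τ) :=
  hX.add ((isCompact_closedBall _ _).smul _)

lemma integrable_uniformSphere_of_continuous [NeZero d] {F : EuclideanSpace ℝ (Fin d) → ℝ}
    (hF : Continuous F) : Integrable F (uniformSphere d) := by
  obtain ⟨C, hC⟩ := (isCompact_sphere (0 : EuclideanSpace ℝ (Fin d)) 1).exists_bound_of_continuousOn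
    hF.continuousOn
  exact integrable_uniformSphere_of_bound hF.aestronglyMeasurable C fun e he => hC e (by simpa using he)

variable {φ : EuclideanSpace ℝ (Fin d) → ℝ} {L : ℝ}

/-- Slope comparison for a convex function along a line. -/
lemma mul_sub_le_of_convexOn {C : Set (EuclideanSpace ℝ (Fin d))} (hφ : ConvexOn ℝ C φ)
    {a v : EuclideanSpace ℝ (Fin d)} {c : ℝ} (hc : 0 ≤ c) (h1 : a - v ∈ C) (h2 : a + c • v ∈ C) :
    c * (φ a - φ (a - v)) ≤ φ (a + c • v) - φ a := by
  have h := hφ.2 h1 h2 (by positivity : 0 ≤ c / (1 + c)) (by positivity : 0 ≤ 1 / (1 + c))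
    (by field_simp; ring)
  have e1 : (c / (1 + c)) • (a - v) + (1 / (1 + c)) • (a + c • v) = a := by
    have h3 : (1 + c) ≠ 0 := by positivity
    rw [smul_sub, smul_add, smul_smul, div_mul_eq_mul_div, one_mul]
    rw [show (c / (1 + c)) • a - (c / (1 + c)) • v + ((1 / (1 + c)) • a + (c / (1 + c)) • v) =
      (c / (1 + c) + 1 / (1 + c)) • a by module, ← add_div, add_comm c 1, div_self h3, one_smul]
  rw [e1, smul_eq_mul, smul_eq_mul, div_mul_eq_mul_div, div_mul_eq_mul_div, ← add_div,
    le_div_iff₀ (by positivity)] at h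
  linarith

/-- The symmetrised two-point difference dominates the increment of the function, pointwise on the
sphere. -/
lemma le_two_point_reflection (hτ : 0 < τ) (hφ : ConvexOn ℝ (enlarged X τ) φ)
    (hL : ∀ y ∈ enlarged X τ, ∀ z ∈ enlarged X τ, |φ y - φ z| ≤ L * ‖y - z‖)
    {x v e e' : EuclideanSpace ℝ (Fin d)} (hx : x ∈ X) (hxv : x - v ∈ X) (hv : v ≠ 0)
    (he : ‖e‖ = 1) (he' : ‖e'‖ = 1) (hee : e - e' = (2 * inner ℝ e v / ‖v‖ ^ 2) • v) :
    2 * τ / ‖v‖ ^ 2 * (φ x - φ (x - v) - 2 * L * τ) * inner ℝ e v ^ 2 ≤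
      (φ (x + τ • e) - φ (x + τ • e')) * inner ℝ e v := by
  -- Translating both `x` and `x - v` by `τ w` changes each value by at most `Lτ`; this is the whole
  -- bias `2Lτ`.
  have key : ∀ w : EuclideanSpace ℝ (Fin d), ‖w‖ = 1 →
      φ x - φ (x - v) - 2 * L * τ ≤ φ (x + τ • w) - φ (x + τ • w - v) := by
    intro w hw
    have n1 : ‖τ • w‖ = τ := by rw [norm_smul, hw, mul_one, Real.norm_of_nonneg hτ.le]
    have h1 := hL _ (add_smul_mem_enlarged (τ := τ) hx hw) _ (mem_enlarged hx)
    have h2 := hL _ (add_smul_mem_enlarged (τ := τ) hxv hw) _ (mem_enlarged hxv)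
    rw [add_sub_cancel_left, n1] at h1 h2
    rw [show x - v + τ • w = x + τ • w - v by abel] at h2
    linarith [abs_le.1 h1, abs_le.1 h2]
  have hv2 : 0 < ‖v‖ ^ 2 := by positivity
  have hin : inner ℝ e' v = -inner ℝ e v := by
    have h1 : inner ℝ (e - e') v = 2 * inner ℝ e v := by
      rw [hee, real_inner_smul_left, real_inner_self_eq_norm_sq]; field_simp
    rw [inner_sub_left] at h1; linarith
  -- For `⟨w, v⟩ ≥ 0` the point `x + τw` lies ahead of `x + τw'` in the direction `v`, by the
  -- multiple `2τ⟨w, v⟩/‖v‖²`, and slopes of a convex function increase. The opposite sign follows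
  -- by exchanging the two points.
  have half : ∀ w w' : EuclideanSpace ℝ (Fin d), ‖w‖ = 1 → ‖w'‖ = 1 →
      w - w' = (2 * inner ℝ w v / ‖v‖ ^ 2) • v → 0 ≤ inner ℝ w v →
      2 * τ / ‖v‖ ^ 2 * (φ x - φ (x - v) - 2 * L * τ) * inner ℝ w v ^ 2 ≤
        (φ (x + τ • w) - φ (x + τ • w')) * inner ℝ w v := by
    intro w w' hw hw' hww h0
    have e1 : x + τ • w = (x + τ • w') + (τ * (2 * inner ℝ w v / ‖v‖ ^ 2)) • v := by
      rw [mul_smul, ← hww]; module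
    have h1 := mul_sub_le_of_convexOn hφ (a := x + τ • w') (v := v)
      (c := τ * (2 * inner ℝ w v / ‖v‖ ^ 2)) (by positivity)
      (by rw [show x + τ • w' - v = x - v + τ • w' by abel]; exact add_smul_mem_enlarged hxv hw')
      (by rw [← e1]; exact add_smul_mem_enlarged hx hw)
    rw [← e1] at h1
    calc 2 * τ / ‖v‖ ^ 2 * (φ x - φ (x - v) - 2 * L * τ) * inner ℝ w v ^ 2
        = (τ * (2 * inner ℝ w v / ‖v‖ ^ 2) * (φ x - φ (x - v) - 2 * L * τ)) * inner ℝ w v := by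
          ring
      _ ≤ (τ * (2 * inner ℝ w v / ‖v‖ ^ 2) * (φ (x + τ • w') - φ (x + τ • w' - v))) *
          inner ℝ w v := by
          have := key w' hw'
          gcongr
      _ ≤ _ := by gcongr
  rcases le_total 0 (inner ℝ e v) with h0 | h0
  · exact half e e' he he' hee h0
  · have h1 := half e' e he' he (by rw [hin, ← neg_sub, hee, ← neg_smul]; congr 1; ring)
      (by rw [hin]; linarith)
    rw [hin, neg_sq] at h1
    linarith

/-- The two-point estimate of the gradient of a convex Lipschitz function. -/
lemma sub_le_integral_two_point [NeZero d] (hτ : 0 < τ) (hc : Continuous φ)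
    (hφ : ConvexOn ℝ (enlarged X τ) φ) (hL0 : 0 ≤ L)
    (hL : ∀ y ∈ enlarged X τ, ∀ z ∈ enlarged X τ, |φ y - φ z| ≤ L * ‖y - z‖)
    {x z : EuclideanSpace ℝ (Fin d)} (hx : x ∈ X) (hz : z ∈ X) :
    φ x - φ z - 2 * L * τ ≤
      d / (2 * τ) * ∫ e, (φ (x + τ • e) - φ (x - τ • e)) * inner ℝ e (x - z) ∂(uniformSphere d) := by
  obtain ⟨v, rfl⟩ : ∃ v, z = x - v := ⟨x - z, by abel⟩
  rw [sub_sub_cancel]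
  have hd0 : (0 : ℝ) < d := Nat.cast_pos.2 (NeZero.pos d)
  rcases eq_or_ne v 0 with rfl | hv
  · simp; positivity
  have hv2 : 0 < ‖v‖ ^ 2 := by positivity
  -- The reflection that fixes `v` keeps `⟨e, v⟩` and the law of `e`, while `-Q e` is the mirror
  -- image of `e` in the hyperplane orthogonal to `v`. Hence `-e` may be replaced by `-Q e` under
  -- the integral.
  let Q := Submodule.reflection (ℝ ∙ v)
  have hQ : ∀ e, Q e = (2 * inner ℝ e v / ‖v‖ ^ 2) • v - e := fun e => by
    rw [Submodule.reflection_singleton_apply, real_inner_comm, mul_div_assoc, mul_smul, two_smul,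
      two_smul]
    simp
  have hQv : ∀ e, inner ℝ (Q e) v = inner ℝ e v := fun e => by
    rw [hQ, inner_sub_left, real_inner_smul_left, real_inner_self_eq_norm_sq]; field_simp; ring
  have i1 : Integrable (fun e => φ (x + τ • e) * inner ℝ e v) (uniformSphere d) :=
    integrable_uniformSphere_of_continuous (by fun_prop)
  have i2 : Integrable (fun e => φ (x - τ • e) * inner ℝ e v) (uniformSphere d) :=
    integrable_uniformSphere_of_continuous (by fun_prop)
  have i3 : Integrable (fun e => φ (x - τ • Q e) * inner ℝ e v) (uniformSphere d) :=
    integrable_uniformSphere_of_continuous (by fun_prop)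
  have e1 : ∫ e, (φ (x + τ • e) - φ (x - τ • e)) * inner ℝ e v ∂(uniformSphere d) =
      ∫ e, (φ (x + τ • e) - φ (x + τ • (-Q e))) * inner ℝ e v ∂(uniformSphere d) := by
    have h1 := integral_uniformSphere_comp_isometry Q fun e => φ (x - τ • e) * inner ℝ e v
    simp only [hQv] at h1
    simp only [sub_mul, smul_neg, ← sub_eq_add_neg]
    rw [integral_sub i1 i2, integral_sub i1 i3, h1]
  have i4 : Integrable (fun e => (φ (x + τ • e) - φ (x + τ • (-Q e))) * inner ℝ e v)
      (uniformSphere d) := integrable_uniformSphere_of_continuous (by fun_prop)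
  have i5 : Integrable (fun e => 2 * τ / ‖v‖ ^ 2 * (φ x - φ (x - v) - 2 * L * τ) *
      inner ℝ e v ^ 2) (uniformSphere d) := integrable_uniformSphere_of_continuous (by fun_prop)
  have h2 := integral_mono_ae i5 i4 (by
    filter_upwards [ae_uniformSphere_norm_eq_one d] with e he
    exact le_two_point_reflection hτ hφ hL hx hz hv he
      (by rw [norm_neg, LinearIsometryEquiv.norm_map, he]) (by rw [hQ]; abel))
  rw [integral_const_mul, integral_inner_sq_uniformSphere] at h2
  rw [e1]
  calc φ x - φ (x - v) - 2 * L * τ = d / (2 * τ) *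
        (2 * τ / ‖v‖ ^ 2 * (φ x - φ (x - v) - 2 * L * τ) * (‖v‖ ^ 2 / d)) := by field_simp
    _ ≤ _ := by gcongr

lemma integral_abs_inner_uniformSphere_le [NeZero d] (v : EuclideanSpace ℝ (Fin d)) :
    ∫ e, |inner ℝ e v| ∂(uniformSphere d) ≤ ‖v‖ / √d := by
  have hd0 : (0 : ℝ) < d := Nat.cast_pos.2 (NeZero.pos d)
  have hm : MemLp (fun e : EuclideanSpace ℝ (Fin d) => |inner ℝ e v|) 2 (uniformSphere d) := by
    rw [memLp_two_iff_integrable_sq (by fun_prop)]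
    exact integrable_uniformSphere_of_continuous (by fun_prop)
  have h := sq_integral_mul_le hm (memLp_const (1 : ℝ))
  simp only [mul_one, sq_abs, one_pow, integral_const, probReal_univ, smul_eq_mul] at h
  rw [integral_inner_sq_uniformSphere] at h
  have h0 : 0 ≤ ∫ e, |inner ℝ e v| ∂(uniformSphere d) := integral_nonneg fun _ => abs_nonneg _
  refine le_of_sq_le_sq ?_ (by positivity)
  rwa [div_pow, Real.sq_sqrt hd0.le]

variable {δ : EuclideanSpace ℝ (Fin d) → ℝ} {Δ : ℝ}

lemma abs_noise_sub_le (hδ : ∀ x ∈ enlarged X τ, |δ x| ≤ Δ) {x e : EuclideanSpace ℝ (Fin d)}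
    (hx : x ∈ X) (he : ‖e‖ = 1) : |δ (x + τ • e) - δ (x - τ • e)| ≤ 2 * Δ := by
  have h1 := hδ _ (add_smul_mem_enlarged hx he)
  have h2 := hδ _ (sub_smul_mem_enlarged hx he)
  rw [abs_le] at *
  constructor <;> linarith

lemma abs_two_point_sub_le (hτ : 0 < τ)
    (hL : ∀ y ∈ enlarged X τ, ∀ z ∈ enlarged X τ, |φ y - φ z| ≤ L * ‖y - z‖)
    {x e : EuclideanSpace ℝ (Fin d)}
    (hx : x ∈ X) (he : ‖e‖ = 1) : |φ (x + τ • e) - φ (x - τ • e)| ≤ 2 * τ * L := by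
  have h1 := hL _ (add_smul_mem_enlarged hx he) _ (sub_smul_mem_enlarged hx he)
  rw [show x + τ • e - (x - τ • e) = (2 * τ) • e by module, norm_smul, he, mul_one,
    Real.norm_of_nonneg (by positivity)] at h1
  linarith

/-- Bounding `|⟨e, v⟩|` on average by `‖v‖/√d`, rather than pointwise by `‖v‖`, turns the prefactor
`d` into `√d`. -/
lemma abs_integral_noise_le [NeZero d] (hτ : 0 < τ)
    (hδ : ∀ x ∈ enlarged X τ, |δ x| ≤ Δ) {x v : EuclideanSpace ℝ (Fin d)} (hx : x ∈ X) :
    |(d : ℝ) / (2 * τ) * ∫ e, (δ (x + τ • e) - δ (x - τ • e)) * inner ℝ e v ∂(uniformSphere d)| ≤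
      √d * Δ / τ * ‖v‖ := by
  have hd0 : (0 : ℝ) < d := Nat.cast_pos.2 (NeZero.pos d)
  have hΔ : 0 ≤ Δ := (abs_nonneg _).trans (hδ x (mem_enlarged hx))
  rw [abs_mul, abs_of_nonneg (by positivity)]
  have h1 : |∫ e, (δ (x + τ • e) - δ (x - τ • e)) * inner ℝ e v ∂(uniformSphere d)| ≤
      2 * Δ * ∫ e, |inner ℝ e v| ∂(uniformSphere d) := by
    refine (abs_integral_le_integral_abs).trans ?_
    rw [← integral_const_mul]
    refine integral_mono_of_nonneg (Filter.Eventually.of_forall fun _ => abs_nonneg _)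
      ((integrable_uniformSphere_of_continuous (by fun_prop)).const_mul _) ?_
    filter_upwards [ae_uniformSphere_norm_eq_one d] with e he
    rw [abs_mul]
    exact mul_le_mul_of_nonneg_right (abs_noise_sub_le hδ hx he) (abs_nonneg _)
  calc d / (2 * τ) * |∫ e, (δ (x + τ • e) - δ (x - τ • e)) * inner ℝ e v ∂(uniformSphere d)|
      ≤ d / (2 * τ) * (2 * Δ * (‖v‖ / √d)) := by
        gcongr
        refine h1.trans ?_
        have := integral_abs_inner_uniformSphere_le v
        gcongr
    _ = (d / √d) * Δ / τ * ‖v‖ := by field_simp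
    _ = _ := by rw [Real.div_sqrt]

lemma add_rpow_le_two_rpow_mul {a b κ : ℝ} (ha : 0 ≤ a) (hb : 0 ≤ b) (hκ : 0 ≤ κ) :
    (a + b) ^ (1 + κ) ≤ 2 ^ κ * (a ^ (1 + κ) + b ^ (1 + κ)) := by
  have h := NNReal.rpow_add_le_mul_rpow_add_rpow ⟨a, ha⟩ ⟨b, hb⟩ (p := 1 + κ) (by linarith)
  rw [add_sub_cancel_left] at h
  exact_mod_cast h

end TwoPoint

end ZORSMD

end

noncomputable section

namespace ZORSMD

/-! ### Mean and moment of the gradient estimate for one fixed datum. -/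

section GradEst

variable {d : ℕ} {X : Set (EuclideanSpace ℝ (Fin d))} {τ : ℝ} {Ξ : Type*}
  {f : EuclideanSpace ℝ (Fin d) → Ξ → ℝ} {Mξ : Ξ → ℝ} {δ : EuclideanSpace ℝ (Fin d) → ℝ} {Δ κ : ℝ}

/-- A Carathéodory argument: continuity in the point and measurability in the datum give joint
measurability. -/
lemma measurable_gradEst [MeasurableSpace Ξ] (hfc : ∀ s, Continuous fun x => f x s)
    (hfm : ∀ x, Measurable (f x)) (hδm : Measurable δ) (τ : ℝ) :
    Measurable fun z : EuclideanSpace ℝ (Fin d) × EuclideanSpace ℝ (Fin d) × Ξ =>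
      gradEst f δ τ z.1 z.2.2 z.2.1 := by
  have hF : Measurable (Function.uncurry f) := measurable_uncurry_of_continuous_of_measurable hfc hfm
  have h1 : Measurable fun z : EuclideanSpace ℝ (Fin d) × EuclideanSpace ℝ (Fin d) × Ξ =>
    f (z.1 + τ • z.2.1) z.2.2 := hF.comp (by fun_prop : Measurable fun z :
      EuclideanSpace ℝ (Fin d) × EuclideanSpace ℝ (Fin d) × Ξ => (z.1 + τ • z.2.1, z.2.2))
  have h2 : Measurable fun z : EuclideanSpace ℝ (Fin d) × EuclideanSpace ℝ (Fin d) × Ξ =>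
    f (z.1 - τ • z.2.1) z.2.2 := hF.comp (by fun_prop : Measurable fun z :
      EuclideanSpace ℝ (Fin d) × EuclideanSpace ℝ (Fin d) × Ξ => (z.1 - τ • z.2.1, z.2.2))
  unfold gradEst oracle
  fun_prop

/-- A crude envelope with the full factor `d`. It serves only for integrability; the sharp dimension
dependence comes from the moment bound. -/
lemma norm_gradEst_le (hτ : 0 < τ) {s : Ξ}
    (hLip : ∀ x ∈ enlarged X τ, ∀ y ∈ enlarged X τ, |f x s - f y s| ≤ Mξ s * ‖x - y‖)
    (hδ : ∀ x ∈ enlarged X τ, |δ x| ≤ Δ) {x e : EuclideanSpace ℝ (Fin d)} (hx : x ∈ X)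
    (he : ‖e‖ = 1) : ‖gradEst f δ τ x s e‖ ≤ d * Mξ s + d * Δ / τ := by
  have h1 := abs_two_point_sub_le (φ := fun y => f y s) hτ hLip hx he
  have h2 := abs_noise_sub_le hδ hx he
  have h3 : |oracle f δ (x + τ • e) s - oracle f δ (x - τ • e) s| ≤ 2 * τ * Mξ s + 2 * Δ := by
    unfold oracle
    rw [abs_le] at *
    constructor <;> linarith
  rw [gradEst, norm_smul, he, mul_one, Real.norm_eq_abs, abs_mul, abs_of_nonneg (by positivity)]
  calc d / (2 * τ) * |oracle f δ (x + τ • e) s - oracle f δ (x - τ • e) s|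
      ≤ d / (2 * τ) * (2 * τ * Mξ s + 2 * Δ) := by gcongr
    _ = _ := by field_simp

variable [NeZero d]

/-- Conditional mean of the two-point estimate for a fixed datum. -/
lemma le_integral_inner_gradEst (hτ : 0 < τ) {s : Ξ} (hfc : Continuous fun x => f x s)
    (hconv : ConvexOn ℝ (enlarged X τ) fun x => f x s) (hM : 0 ≤ Mξ s)
    (hLip : ∀ x ∈ enlarged X τ, ∀ y ∈ enlarged X τ, |f x s - f y s| ≤ Mξ s * ‖x - y‖)
    (hδm : Measurable δ) (hδ : ∀ x ∈ enlarged X τ, |δ x| ≤ Δ)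
    {x z : EuclideanSpace ℝ (Fin d)} (hx : x ∈ X) (hz : z ∈ X) :
    f x s - f z s - 2 * Mξ s * τ - √d * Δ / τ * ‖x - z‖ ≤
      ∫ e, inner ℝ (gradEst f δ τ x s e) (x - z) ∂(uniformSphere d) := by
  have h1 := sub_le_integral_two_point hτ hfc hconv hM hLip hx hz
  have h2 := (abs_le.1 (abs_integral_noise_le hτ hδ (v := x - z) hx)).1
  have e1 : ∀ e, inner ℝ (gradEst f δ τ x s e) (x - z) =
      d / (2 * τ) * ((f (x + τ • e) s - f (x - τ • e) s) * inner ℝ e (x - z)) +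
      d / (2 * τ) * ((δ (x + τ • e) - δ (x - τ • e)) * inner ℝ e (x - z)) := fun e => by
    rw [gradEst, real_inner_smul_left]; unfold oracle; ring
  simp_rw [e1]
  rw [integral_add, integral_const_mul, integral_const_mul]
  · linarith
  · exact integrable_uniformSphere_of_continuous (by fun_prop)
  · refine (integrable_uniformSphere_of_bound (Measurable.aestronglyMeasurable (by fun_prop))
      (2 * Δ * ‖x - z‖) fun e he => ?_).const_mul _
    have h3 := abs_real_inner_le_norm e (x - z)
    rw [he, one_mul] at h3
    have h4 := abs_noise_sub_le hδ hx he
    rw [abs_mul]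
    have h5 := (abs_nonneg _).trans h4
    gcongr

/-- Conditional moment of the two-point estimate for a fixed datum. -/
lemma integral_qNorm_gradEst_rpow_le (hd : 2 ≤ d) {q : ℝ≥0∞} (hq : 2 ≤ q) (hκ0 : 0 < κ)
    (hκ1 : κ ≤ 1) (hτ : 0 < τ) {s : Ξ} (hfc : Continuous fun x => f x s) (hM : 0 ≤ Mξ s)
    (hLip : ∀ x ∈ enlarged X τ, ∀ y ∈ enlarged X τ, |f x s - f y s| ≤ Mξ s * ‖x - y‖)
    (hΔ : 0 ≤ Δ) (hδ : ∀ x ∈ enlarged X τ, |δ x| ≤ Δ)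
    {x : EuclideanSpace ℝ (Fin d)} (hx : x ∈ X) :
    ∫ e, qNorm q (gradEst f δ τ x s e) ^ (1 + κ) ∂(uniformSphere d) ≤
      2 ^ κ * (√d / 2 ^ (1 / 4 : ℝ) * aConst d q * Mξ s) ^ (1 + κ) +
        2 ^ κ * (d * aConst d q * Δ / τ) ^ (1 + κ) := by
  have hd0 : (0 : ℝ) < d := Nat.cast_pos.2 (NeZero.pos d)
  have ha := aConst_pos hd hq
  set a := aConst d q
  set A : EuclideanSpace ℝ (Fin d) → ℝ := fun e => f (x + τ • e) s - f (x - τ • e) s with hA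
  have hAc : Continuous A := by fun_prop
  have hwc := continuous_qNorm (d := d) hq
  have hr0 : 0 ≤ (1 + κ) / 2 := by positivity
  have hr1 : (1 + κ) / 2 ≤ 1 := by linarith
  have hsqr : ∀ y : ℝ, 0 ≤ y → (y ^ 2) ^ ((1 + κ) / 2) = y ^ (1 + κ) := fun y hy => by
    rw [← Real.rpow_natCast, ← Real.rpow_mul hy]; congr 1; push_cast; ring
  set c : ℝ := d / (2 * τ) with hc
  have hc0 : 0 < c := by positivity
  have c1 : Continuous fun e => (A e ^ 2 * qNorm q e ^ 2) ^ ((1 + κ) / 2) :=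
    ((hAc.pow 2).mul (hwc.pow 2)).rpow_const fun _ => Or.inr hr0
  have c2 : Continuous fun e : EuclideanSpace ℝ (Fin d) => (qNorm q e ^ 2) ^ ((1 + κ) / 2) :=
    (hwc.pow 2).rpow_const fun _ => Or.inr hr0
  -- Objective and noise differences are separated at the cost of `2^κ`. Both parts are written as
  -- powers of squares, so that they can be reduced to second moments.
  have h1 : ∫ e, qNorm q (gradEst f δ τ x s e) ^ (1 + κ) ∂(uniformSphere d) ≤
      ∫ e, (c ^ (1 + κ) * 2 ^ κ * (A e ^ 2 * qNorm q e ^ 2) ^ ((1 + κ) / 2) +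
        c ^ (1 + κ) * 2 ^ κ * (2 * Δ) ^ (1 + κ) * (qNorm q e ^ 2) ^ ((1 + κ) / 2))
        ∂(uniformSphere d) := by
    refine integral_mono_of_nonneg
      (Filter.Eventually.of_forall fun e => Real.rpow_nonneg (qNorm_nonneg _ _) _)
      (((integrable_uniformSphere_of_continuous c1).const_mul _).add
        ((integrable_uniformSphere_of_continuous c2).const_mul _)) ?_
    filter_upwards [ae_uniformSphere_norm_eq_one d] with e he
    have hw := qNorm_nonneg q e
    have h2 := abs_noise_sub_le hδ hx he
    have h3 : qNorm q (gradEst f δ τ x s e) ≤ c * (|A e| * qNorm q e + 2 * Δ * qNorm q e) := by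
      rw [gradEst, qNorm_smul hq, abs_mul, abs_of_pos hc0, mul_assoc, ← add_mul]
      gcongr
      have : oracle f δ (x + τ • e) s - oracle f δ (x - τ • e) s =
        A e + (δ (x + τ • e) - δ (x - τ • e)) := by simp only [oracle, hA]; ring
      rw [this]
      exact (abs_add_le _ _).trans (by gcongr)
    calc qNorm q (gradEst f δ τ x s e) ^ (1 + κ)
        ≤ (c * (|A e| * qNorm q e + 2 * Δ * qNorm q e)) ^ (1 + κ) := by
          have := qNorm_nonneg q (gradEst f δ τ x s e)
          gcongr
      _ = c ^ (1 + κ) * (|A e| * qNorm q e + 2 * Δ * qNorm q e) ^ (1 + κ) :=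
          Real.mul_rpow hc0.le (by positivity)
      _ ≤ c ^ (1 + κ) * (2 ^ κ * ((|A e| * qNorm q e) ^ (1 + κ) +
            (2 * Δ * qNorm q e) ^ (1 + κ))) := by
          gcongr
          exact add_rpow_le_two_rpow_mul (by positivity) (by positivity) hκ0.le
      _ = _ := by
          rw [← sq_abs (A e), ← mul_pow, hsqr _ (by positivity), hsqr _ hw,
            Real.mul_rpow (by positivity : 0 ≤ 2 * Δ) hw]
          ring
  -- The difference `A` is odd, and its two evaluation points each move by `τ‖e' - e‖`, so the
  -- weighted second-moment bound applies with `L = 2τ Mξ(s)`.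
  have hlip : ∀ e e' : EuclideanSpace ℝ (Fin d), ‖e‖ = 1 → ‖e'‖ = 1 →
      |A e' - A e| ≤ 2 * τ * Mξ s * ‖e' - e‖ := by
    intro e e' he he'
    have h2 := hLip _ (add_smul_mem_enlarged (τ := τ) hx he') _ (add_smul_mem_enlarged hx he)
    have h3 := hLip _ (sub_smul_mem_enlarged (τ := τ) hx he') _ (sub_smul_mem_enlarged hx he)
    rw [show x + τ • e' - (x + τ • e) = τ • (e' - e) by module, norm_smul,
      Real.norm_of_nonneg hτ.le] at h2
    rw [show x - τ • e' - (x - τ • e) = -(τ • (e' - e)) by module, norm_neg, norm_smul,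
      Real.norm_of_nonneg hτ.le] at h3
    simp only [hA]
    rw [abs_le] at *
    constructor <;> linarith
  have hI1 := integral_sq_mul_qNorm_sq_le hd hq hAc.measurable
    (fun e _ => by simp only [hA, smul_neg, sub_neg_eq_add, ← sub_eq_add_neg]; ring)
    (by positivity) hlip
  have hI2 := integral_qNorm_sq_le hd hq
  -- Jensen for the concave power `(1+κ)/2`; this is where `κ ≤ 1` matters.
  have hJ1 := integral_rpow_le_rpow_integral (μ := uniformSphere d)
    (Z := fun e => A e ^ 2 * qNorm q e ^ 2)
    (integrable_uniformSphere_of_continuous (by fun_prop))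
    (Filter.Eventually.of_forall fun e => by positivity) hr0 hr1
    (integrable_uniformSphere_of_continuous c1)
  have hJ2 := integral_rpow_le_rpow_integral (μ := uniformSphere d)
    (Z := fun e => qNorm q e ^ 2)
    (integrable_uniformSphere_of_continuous (by fun_prop))
    (Filter.Eventually.of_forall fun e => by positivity) hr0 hr1
    (integrable_uniformSphere_of_continuous c2)
  rw [integral_add ((integrable_uniformSphere_of_continuous c1).const_mul _)
    ((integrable_uniformSphere_of_continuous c2).const_mul _), integral_const_mul,
    integral_const_mul] at h1
  have hs4 : ((2 : ℝ) ^ (1 / 4 : ℝ)) ^ 2 = √2 := by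
    rw [← Real.rpow_natCast, ← Real.rpow_mul (by norm_num), Real.sqrt_eq_rpow]; norm_num
  have hy1 : ∫ e, A e ^ 2 * qNorm q e ^ 2 ∂(uniformSphere d) ≤
      (2 * τ * Mξ s * a / (2 ^ (1 / 4 : ℝ) * √d)) ^ 2 := by
    rw [div_pow, mul_pow _ √(d : ℝ), hs4, Real.sq_sqrt hd0.le, le_div_iff₀ (by positivity)]
    linarith
  have hK1 : ∫ e, (A e ^ 2 * qNorm q e ^ 2) ^ ((1 + κ) / 2) ∂(uniformSphere d) ≤
      (2 * τ * Mξ s * a / (2 ^ (1 / 4 : ℝ) * √d)) ^ (1 + κ) := by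
    rw [← hsqr _ (by positivity)]
    refine hJ1.trans ?_
    have : 0 ≤ ∫ e, A e ^ 2 * qNorm q e ^ 2 ∂(uniformSphere d) :=
      integral_nonneg fun e => by positivity
    gcongr
  have hK2 : ∫ e : EuclideanSpace ℝ (Fin d), (qNorm q e ^ 2) ^ ((1 + κ) / 2) ∂(uniformSphere d) ≤
      a ^ (1 + κ) := by
    rw [← hsqr _ ha.le]
    refine hJ2.trans ?_
    have : 0 ≤ ∫ e : EuclideanSpace ℝ (Fin d), qNorm q e ^ 2 ∂(uniformSphere d) :=
      integral_nonneg fun e => by positivity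
    gcongr
  have e2 : c * (2 * τ * Mξ s * a / (2 ^ (1 / 4 : ℝ) * √d)) = √d / 2 ^ (1 / 4 : ℝ) * a * Mξ s := by
    have : (d : ℝ) = √d * √d := (Real.mul_self_sqrt hd0.le).symm
    have h4 : √(d : ℝ) ≠ 0 := by positivity
    rw [hc]; field_simp
    rw [sq]; linear_combination Mξ s * this
  have e3 : c * (2 * Δ) * a = d * a * Δ / τ := by rw [hc]; field_simp
  calc ∫ e, qNorm q (gradEst f δ τ x s e) ^ (1 + κ) ∂(uniformSphere d)
      ≤ _ := h1
    _ ≤ c ^ (1 + κ) * 2 ^ κ * (2 * τ * Mξ s * a / (2 ^ (1 / 4 : ℝ) * √d)) ^ (1 + κ) +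
        c ^ (1 + κ) * 2 ^ κ * (2 * Δ) ^ (1 + κ) * a ^ (1 + κ) := by gcongr
    _ = _ := by
        rw [← e2, ← e3, Real.mul_rpow hc0.le (by positivity),
          Real.mul_rpow (by positivity : 0 ≤ c * (2 * Δ)) ha.le, Real.mul_rpow hc0.le (by positivity)]
        ring

end GradEst

end ZORSMD

end

noncomputable section

namespace ZORSMD

/-! ### Averaging over the datum. -/

section Regular

variable {d : ℕ} {Ξ : Type*} [MeasurableSpace Ξ]

/-- The standing assumptions on objective and noise, for an objective that is defined, continuous
and measurable on the whole space. -/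
structure IsRegular (X : Set (EuclideanSpace ℝ (Fin d))) (τ κ : ℝ) (𝒟 : Measure Ξ)
    (f : EuclideanSpace ℝ (Fin d) → Ξ → ℝ) (Mξ : Ξ → ℝ) (M₂ : ℝ)
    (δ : EuclideanSpace ℝ (Fin d) → ℝ) (Δ : ℝ) : Prop where
  tau_pos : 0 < τ
  kappa_pos : 0 < κ
  kappa_le_one : κ ≤ 1
  continuous : ∀ s, Continuous fun x => f x s
  measurable : ∀ x, Measurable (f x)
  integrable : ∀ x ∈ X, Integrable (f x) 𝒟
  convexOn : ∀ s, ConvexOn ℝ (enlarged X τ) fun x => f x s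
  lipschitz_nonneg : ∀ s, 0 ≤ Mξ s
  lipschitz : ∀ s, ∀ x ∈ enlarged X τ, ∀ y ∈ enlarged X τ, |f x s - f y s| ≤ Mξ s * ‖x - y‖
  moment_integrable : Integrable (fun s => Mξ s ^ (1 + κ)) 𝒟
  bound_nonneg : 0 ≤ M₂
  moment_le : ∫ s, Mξ s ^ (1 + κ) ∂𝒟 ≤ M₂ ^ (1 + κ)
  noise_measurable : Measurable δ
  noise_nonneg : 0 ≤ Δ
  noise_le : ∀ x ∈ enlarged X τ, |δ x| ≤ Δ

namespace IsRegular

variable {X : Set (EuclideanSpace ℝ (Fin d))} {τ κ : ℝ} {𝒟 : Measure Ξ} [IsProbabilityMeasure 𝒟]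
  {f : EuclideanSpace ℝ (Fin d) → Ξ → ℝ} {Mξ : Ξ → ℝ} {M₂ : ℝ}
  {δ : EuclideanSpace ℝ (Fin d) → ℝ} {Δ : ℝ} (H : IsRegular X τ κ 𝒟 f Mξ M₂ δ Δ)

include H

/-- Measurability of `Mξ` is recovered from that of its power by taking a root; integrability
follows from `Mξ ≤ 1 + Mξ^(1+κ)`. -/
lemma integrable_lipschitz : Integrable Mξ 𝒟 := by
  have hκ := H.kappa_pos
  have e1 : Mξ = fun s => (Mξ s ^ (1 + κ)) ^ (1 / (1 + κ)) := by
    ext s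
    rw [← Real.rpow_mul (H.lipschitz_nonneg s), mul_one_div_cancel (by positivity), Real.rpow_one]
  have hm : AEStronglyMeasurable Mξ 𝒟 := by
    rw [e1]
    exact (Real.continuous_rpow_const (by positivity)).comp_aestronglyMeasurable
      H.moment_integrable.aestronglyMeasurable
  refine ((integrable_const (1 : ℝ)).add H.moment_integrable).mono' hm
    (Filter.Eventually.of_forall fun s => ?_)
  have h0 := H.lipschitz_nonneg s
  rw [Real.norm_of_nonneg h0, Pi.add_apply]
  rcases le_total (Mξ s) 1 with h | h
  · linarith [Real.rpow_nonneg h0 (1 + κ)]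
  · have := Real.self_le_rpow_of_one_le h (by linarith : 1 ≤ 1 + κ)
    linarith

lemma integral_lipschitz_le : ∫ s, Mξ s ∂𝒟 ≤ M₂ := by
  have hκ := H.kappa_pos
  have e1 : ∀ s, (Mξ s ^ (1 + κ)) ^ (1 / (1 + κ)) = Mξ s := fun s => by
    rw [← Real.rpow_mul (H.lipschitz_nonneg s), mul_one_div_cancel (by positivity), Real.rpow_one]
  have h := integral_rpow_le_rpow_integral (r := 1 / (1 + κ)) H.moment_integrable
    (Filter.Eventually.of_forall fun s => Real.rpow_nonneg (H.lipschitz_nonneg s) _)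
    (by positivity) (by rw [div_le_one (by positivity)]; linarith)
    (by simpa only [e1] using H.integrable_lipschitz)
  simp only [e1] at h
  refine h.trans ?_
  calc (∫ s, Mξ s ^ (1 + κ) ∂𝒟) ^ (1 / (1 + κ)) ≤ (M₂ ^ (1 + κ)) ^ (1 / (1 + κ)) := by
        have h1 := H.moment_le
        have h0 : 0 ≤ ∫ s, Mξ s ^ (1 + κ) ∂𝒟 :=
          integral_nonneg fun s => Real.rpow_nonneg (H.lipschitz_nonneg s) _
        gcongr
    _ = M₂ := by
        rw [← Real.rpow_mul H.bound_nonneg, mul_one_div_cancel (by positivity), Real.rpow_one]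

lemma abs_objective_sub_le {x y : EuclideanSpace ℝ (Fin d)} (hx : x ∈ X) (hy : y ∈ X) :
    |objective 𝒟 f x - objective 𝒟 f y| ≤ M₂ * ‖x - y‖ := by
  unfold objective
  rw [← integral_sub (H.integrable x hx) (H.integrable y hy)]
  calc |∫ s, (f x s - f y s) ∂𝒟| ≤ ∫ s, |f x s - f y s| ∂𝒟 := abs_integral_le_integral_abs
    _ ≤ ∫ s, Mξ s * ‖x - y‖ ∂𝒟 :=
        integral_mono ((H.integrable x hx).sub (H.integrable y hy)).abs
          (H.integrable_lipschitz.mul_const _)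
          fun s => H.lipschitz s _ (mem_enlarged hx) _ (mem_enlarged hy)
    _ = (∫ s, Mξ s ∂𝒟) * ‖x - y‖ := integral_mul_const _ _
    _ ≤ _ := by
        have := H.integral_lipschitz_le
        gcongr

omit [IsProbabilityMeasure 𝒟] in
lemma convexOn_objective (hX : Convex ℝ X) : ConvexOn ℝ X (objective 𝒟 f) := by
  refine ⟨hX, fun x hx y hy a b ha hb hab => ?_⟩
  have hxy := hX hx hy ha hb hab
  simp only [objective, smul_eq_mul]
  rw [← integral_const_mul, ← integral_const_mul,
    ← integral_add ((H.integrable x hx).const_mul a) ((H.integrable y hy).const_mul b)]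
  exact integral_mono (H.integrable _ hxy)
    (((H.integrable x hx).const_mul a).add ((H.integrable y hy).const_mul b))
    fun s => (H.convexOn s).2 (mem_enlarged hx) (mem_enlarged hy) ha hb hab

lemma measurable_objective : Measurable (objective 𝒟 f) := by
  have hF : Measurable (Function.uncurry f) :=
    measurable_uncurry_of_continuous_of_measurable H.continuous H.measurable
  exact (hF.stronglyMeasurable.integral_prod_right (ν := 𝒟)).measurable

lemma integrable_envelope : Integrable (fun s => d * Mξ s + d * Δ / τ) 𝒟 :=
  (H.integrable_lipschitz.const_mul _).add (integrable_const _)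

omit [IsProbabilityMeasure 𝒟] in
lemma envelope_nonneg (s : Ξ) : 0 ≤ d * Mξ s + d * Δ / τ := by
  have := H.lipschitz_nonneg s
  have := H.noise_nonneg
  have := H.tau_pos
  positivity

lemma integrable_envelope_rpow : Integrable (fun s => (d * Mξ s + d * Δ / τ) ^ (1 + κ)) 𝒟 := by
  have hκ := H.kappa_pos
  have hΔ := H.noise_nonneg
  have hτ := H.tau_pos
  refine ((((H.moment_integrable.const_mul ((d : ℝ) ^ (1 + κ))).add
    (integrable_const ((d * Δ / τ) ^ (1 + κ)))).const_mul ((2 : ℝ) ^ κ))).mono'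
    ((Real.continuous_rpow_const (by positivity)).comp_aestronglyMeasurable
      H.integrable_envelope.aestronglyMeasurable) (Filter.Eventually.of_forall fun s => ?_)
  have h0 := H.lipschitz_nonneg s
  rw [Real.norm_of_nonneg (by positivity), Pi.add_apply, ← Real.mul_rpow (by positivity) h0]
  exact add_rpow_le_two_rpow_mul (by positivity) (by positivity) hκ.le

omit [IsProbabilityMeasure 𝒟] in
lemma measurable_gradEst_fixed (x : EuclideanSpace ℝ (Fin d)) :
    Measurable fun w : EuclideanSpace ℝ (Fin d) × Ξ => gradEst f δ τ x w.2 w.1 := by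
  have h := (measurable_gradEst H.continuous H.measurable H.noise_measurable τ).comp
    (measurable_prodMk_left (x := x))
  simp only [Function.comp_def] at h
  exact h

omit [IsProbabilityMeasure 𝒟] in
lemma norm_gradEst_le {x e : EuclideanSpace ℝ (Fin d)} (hx : x ∈ X) (he : ‖e‖ = 1) (s : Ξ) :
    ‖gradEst f δ τ x s e‖ ≤ d * Mξ s + d * Δ / τ :=
  ZORSMD.norm_gradEst_le H.tau_pos (H.lipschitz s) H.noise_le hx he

variable [NeZero d]

omit H [IsProbabilityMeasure 𝒟] [NeZero d] in
lemma ae_prod_norm_eq_one [SFinite 𝒟] :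
    ∀ᵐ w ∂((uniformSphere d).prod 𝒟), ‖w.1‖ = 1 :=
  Measure.quasiMeasurePreserving_fst.ae (ae_uniformSphere_norm_eq_one d)

lemma integrable_inner_gradEst {x : EuclideanSpace ℝ (Fin d)} (hx : x ∈ X)
    (v : EuclideanSpace ℝ (Fin d)) :
    Integrable (fun w : EuclideanSpace ℝ (Fin d) × Ξ => inner ℝ (gradEst f δ τ x w.2 w.1) v)
      ((uniformSphere d).prod 𝒟) := by
  have := H.measurable_gradEst_fixed x
  refine ((H.integrable_envelope.comp_snd (uniformSphere d)).mul_const ‖v‖).mono'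
    (Measurable.aestronglyMeasurable (by fun_prop)) ?_
  filter_upwards [ae_prod_norm_eq_one (𝒟 := 𝒟)] with w hw
  refine (norm_inner_le_norm _ _).trans ?_
  have := H.norm_gradEst_le hx hw w.2
  gcongr

/-- Conditional mean of the two-point estimate. -/
lemma le_integral_inner_gradEst {x z : EuclideanSpace ℝ (Fin d)} (hx : x ∈ X) (hz : z ∈ X) :
    objective 𝒟 f x - objective 𝒟 f z - 2 * M₂ * τ - √d * Δ / τ * ‖x - z‖ ≤
      ∫ w : EuclideanSpace ℝ (Fin d) × Ξ, inner ℝ (gradEst f δ τ x w.2 w.1) (x - z)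
        ∂((uniformSphere d).prod 𝒟) := by
  have hi := H.integrable_inner_gradEst hx (x - z)
  have hτ := H.tau_pos
  -- The direction is integrated first, with the datum frozen, so that the pathwise convexity of
  -- `f(·, ξ)` can be used.
  rw [integral_prod_symm _ hi]
  have hM := H.integrable_lipschitz
  have i1 : Integrable (fun s => f x s - f z s) 𝒟 := (H.integrable x hx).sub (H.integrable z hz)
  have i2 : Integrable (fun s => 2 * Mξ s * τ) 𝒟 := (hM.const_mul 2).mul_const τ
  have h1 := integral_mono ((i1.sub i2).sub (integrable_const (√d * Δ / τ * ‖x - z‖)))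
    hi.integral_prod_right fun s => ZORSMD.le_integral_inner_gradEst H.tau_pos (H.continuous s)
      (H.convexOn s) (H.lipschitz_nonneg s) (H.lipschitz s) H.noise_measurable H.noise_le hx hz
  refine le_trans ?_ h1
  rw [integral_sub' (i1.sub i2) (integrable_const _), integral_sub' i1 i2,
    integral_sub (H.integrable x hx) (H.integrable z hz), integral_mul_const, integral_const_mul,
    integral_const, probReal_univ, one_smul]
  have h2 := H.integral_lipschitz_le
  have h3 : 2 * (∫ s, Mξ s ∂𝒟) * τ ≤ 2 * M₂ * τ := by gcongr
  simp only [objective]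
  linarith

lemma integrable_qNorm_gradEst_rpow {q : ℝ≥0∞} (hq : 2 ≤ q) {x : EuclideanSpace ℝ (Fin d)}
    (hx : x ∈ X) :
    Integrable (fun w : EuclideanSpace ℝ (Fin d) × Ξ =>
      qNorm q (gradEst f δ τ x w.2 w.1) ^ (1 + κ)) ((uniformSphere d).prod 𝒟) := by
  have hκ := H.kappa_pos
  refine (H.integrable_envelope_rpow.comp_snd (uniformSphere d)).mono'
    (((continuous_qNorm hq).measurable.comp (H.measurable_gradEst_fixed x)).pow_const
      _).aestronglyMeasurable ?_
  filter_upwards [ae_prod_norm_eq_one (𝒟 := 𝒟)] with w hw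
  have h0 := qNorm_nonneg q (gradEst f δ τ x w.2 w.1)
  rw [Real.norm_of_nonneg (by positivity)]
  have := (qNorm_le_norm hq _).trans (H.norm_gradEst_le hx hw w.2)
  gcongr

omit H [NeZero d] in
lemma sigmaConst_nonneg (hd : 2 ≤ d) {q : ℝ≥0∞} (hq : 2 ≤ q) (hM : 0 ≤ M₂) (hΔ : 0 ≤ Δ)
    (hτ : 0 < τ) : 0 ≤ sigmaConst d q κ M₂ Δ τ := by
  have := aConst_pos hd hq
  unfold sigmaConst
  positivity

/-- Conditional moment of the two-point estimate. -/
lemma integral_qNorm_gradEst_rpow_le (hd : 2 ≤ d) {q : ℝ≥0∞} (hq : 2 ≤ q)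
    {x : EuclideanSpace ℝ (Fin d)} (hx : x ∈ X) :
    ∫ w : EuclideanSpace ℝ (Fin d) × Ξ, qNorm q (gradEst f δ τ x w.2 w.1) ^ (1 + κ)
      ∂((uniformSphere d).prod 𝒟) ≤ sigmaConst d q κ M₂ Δ τ ^ (1 + κ) := by
  have hκ := H.kappa_pos
  have hτ := H.tau_pos
  have hΔ := H.noise_nonneg
  have hM₂ := H.bound_nonneg
  have ha := aConst_pos hd hq
  have hi := H.integrable_qNorm_gradEst_rpow hq hx
  set c := √d / 2 ^ (1 / 4 : ℝ) * aConst d q with hc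
  have hc0 : 0 ≤ c := by positivity
  have i1 : Integrable (fun s => 2 ^ κ * (c * Mξ s) ^ (1 + κ) +
      2 ^ κ * (d * aConst d q * Δ / τ) ^ (1 + κ)) 𝒟 := by
    have : ∀ s, (c * Mξ s) ^ (1 + κ) = c ^ (1 + κ) * Mξ s ^ (1 + κ) := fun s =>
      Real.mul_rpow hc0 (H.lipschitz_nonneg s)
    simp only [this]
    exact ((H.moment_integrable.const_mul _).const_mul _).add (integrable_const _)
  rw [integral_prod_symm _ hi]
  refine (integral_mono hi.integral_prod_right i1 fun s =>
    ZORSMD.integral_qNorm_gradEst_rpow_le hd hq hκ H.kappa_le_one hτ (H.continuous s)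
      (H.lipschitz_nonneg s) (H.lipschitz s) hΔ H.noise_le hx).trans ?_
  have e1 : ∀ s, (c * Mξ s) ^ (1 + κ) = c ^ (1 + κ) * Mξ s ^ (1 + κ) := fun s =>
    Real.mul_rpow hc0 (H.lipschitz_nonneg s)
  simp only [e1]
  rw [integral_add ((H.moment_integrable.const_mul _).const_mul _) (integrable_const _),
    integral_const_mul, integral_const_mul, integral_const, probReal_univ, one_smul, sigmaConst,
    ← Real.rpow_mul (by positivity), one_div_mul_cancel (by positivity), Real.rpow_one,
    ← hc, Real.mul_rpow hc0 hM₂]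
  have := H.moment_le
  gcongr

end IsRegular

end Regular

end ZORSMD

end

noncomputable section

namespace ZORSMD

/-! ### Recursions driven by independent inputs. -/

section Recursion

variable {α β Ω : Type*}

/-- The orbit `a_{k+1} = G(a_k, z_k)` started at `a`. -/
def orbit (G : α × β → α) (a : α) (z : ℕ → β) : ℕ → α
  | 0 => a
  | k + 1 => G (orbit G a z k, z k)

variable [MeasurableSpace α] [mβ : MeasurableSpace β] [mΩ : MeasurableSpace Ω] {P : Measure Ω}

/-- The `k`-th state of a recursion driven by independent inputs is measurable and independent of
the `k`-th input. -/
lemma measurable_and_indepFun_orbit {G : α × β → α} (hG : Measurable G) (a : α) {T : ℕ}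
    {Z : ℕ → Ω → β} (hZ : ∀ k < T, Measurable (Z k))
    (hind : iIndepFun (fun (k : Fin T) ω => Z k ω) P) {k : ℕ} (hk : k < T) :
    Measurable (fun ω => orbit G a (fun i => Z i ω) k) ∧
      IndepFun (fun ω => orbit G a (fun i => Z i ω) k) (Z k) P := by
  let m : Fin T → MeasurableSpace Ω := fun i => mβ.comap (Z i)
  -- Information carried by the inputs strictly before `k`. It determines the `k`-th state, and its
  -- index set is disjoint from `{k}`, whence independence.
  let F : ℕ → MeasurableSpace Ω := fun k => ⨆ i ∈ {i : Fin T | i.1 < k}, m i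
  have hm : ∀ i, m i ≤ mΩ := fun i => (hZ i i.2).comap_le
  have hmono : ∀ j, F j ≤ F (j + 1) := fun j =>
    biSup_mono fun i hi => Nat.lt_succ_of_lt hi
  have hX : ∀ j, j ≤ T → Measurable[F j] (fun ω => orbit G a (fun i => Z i ω) j) := by
    intro j
    induction j with
    | zero => intro _; exact measurable_const
    | succ j ih =>
      intro hj
      have h1 : Measurable[F (j + 1)] (fun ω => orbit G a (fun i => Z i ω) j) :=
        (ih (by omega)).mono (hmono j) le_rfl
      have h2 : Measurable[F (j + 1)] (Z j) := by
        rw [measurable_iff_comap_le]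
        exact le_iSup₂_of_le (⟨j, by omega⟩ : Fin T) (Nat.lt_succ_self j) le_rfl
      exact hG.comp (h1.prodMk h2)
  have hF : F k ≤ mΩ := iSup₂_le fun i _ => hm i
  refine ⟨(hX k hk.le).mono hF le_rfl, ?_⟩
  have h := indep_iSup_of_disjoint hm hind (S := {i : Fin T | i.1 < k}) (T := {⟨k, hk⟩})
    (by rw [Set.disjoint_singleton_right]; exact lt_irrefl k)
  rw [iSup_singleton] at h
  rw [IndepFun_iff_Indep]
  exact indep_of_indep_of_le_left h (hX k hk.le).comap_le

end Recursion

/-! ### Expected progress and moment of one step at a random iterate. -/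

section Expectation

variable {d : ℕ} [NeZero d] {Ξ : Type*} [MeasurableSpace Ξ]
  {X : Set (EuclideanSpace ℝ (Fin d))} {τ κ : ℝ} {𝒟 : Measure Ξ} [IsProbabilityMeasure 𝒟]
  {f : EuclideanSpace ℝ (Fin d) → Ξ → ℝ} {Mξ : Ξ → ℝ} {M₂ : ℝ}
  {δ : EuclideanSpace ℝ (Fin d) → ℝ} {Δ : ℝ}
  {Ω : Type*} [MeasurableSpace Ω] {P : Measure Ω} [IsProbabilityMeasure P]
  {Y : Ω → EuclideanSpace ℝ (Fin d)} {Z : Ω → EuclideanSpace ℝ (Fin d) × Ξ}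

omit [NeZero d] in
lemma map_prodMk_eq {μ : Measure (EuclideanSpace ℝ (Fin d) × Ξ)} [SigmaFinite μ]
    (hY : Measurable Y) (hZ : Measurable Z) (hlaw : P.map Z = μ) (hind : IndepFun Y Z P) :
    P.map (fun ω => (Y ω, Z ω)) = (P.map Y).prod μ := by
  rw [← hlaw]
  exact (indepFun_iff_map_prod_eq_prod_map_map hY.aemeasurable hZ.aemeasurable).1 hind

namespace IsRegular

variable (H : IsRegular X τ κ 𝒟 f Mξ M₂ δ Δ)

include H

omit [NeZero d] in
lemma integrable_objective_comp {D : ℝ} {z : EuclideanSpace ℝ (Fin d)} (hz : z ∈ X)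
    (hD : ∀ x ∈ X, ‖x - z‖ ≤ D) (hY : Measurable Y) (hYX : ∀ ω, Y ω ∈ X) :
    Integrable (fun ω => objective 𝒟 f (Y ω)) P := by
  refine Integrable.of_bound (H.measurable_objective.comp hY).aestronglyMeasurable
    (|objective 𝒟 f z| + M₂ * D) (Filter.Eventually.of_forall fun ω => ?_)
  have h1 := H.abs_objective_sub_le (hYX ω) hz
  have h2 : M₂ * ‖Y ω - z‖ ≤ M₂ * D := mul_le_mul_of_nonneg_left (hD _ (hYX ω)) H.bound_nonneg
  have h3 := abs_add_le (objective 𝒟 f z) (objective 𝒟 f (Y ω) - objective 𝒟 f z)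
  rw [add_sub_cancel] at h3
  rw [Real.norm_eq_abs]
  linarith

omit [NeZero d] [IsProbabilityMeasure P] H in
lemma ae_norm_eq_one (hZ : Measurable Z) (hlaw : P.map Z = (uniformSphere d).prod 𝒟) :
    ∀ᵐ ω ∂P, ‖(Z ω).1‖ = 1 := by
  have h := ae_prod_norm_eq_one (d := d) (𝒟 := 𝒟)
  rw [← hlaw] at h
  exact ae_of_ae_map hZ.aemeasurable h

omit [IsProbabilityMeasure P] H in
lemma integrable_comp_snd (hZ : Measurable Z) (hlaw : P.map Z = (uniformSphere d).prod 𝒟)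
    {W : Ξ → ℝ} (hW : Integrable W 𝒟) : Integrable (fun ω => W (Z ω).2) P := by
  have h := hW.comp_snd (uniformSphere d)
  rw [← hlaw] at h
  exact h.comp_measurable hZ

/-- Expected progress of one step: the random direction correlates with the increment of the
objective. -/
lemma integral_inner_gradEst_ge (hXc : IsCompact X) {D : ℝ} {z : EuclideanSpace ℝ (Fin d)}
    (hz : z ∈ X) (hD : ∀ x ∈ X, ‖x - z‖ ≤ D) (hY : Measurable Y) (hYX : ∀ ω, Y ω ∈ X)
    (hZ : Measurable Z) (hlaw : P.map Z = (uniformSphere d).prod 𝒟) (hind : IndepFun Y Z P) :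
    Integrable (fun ω => inner ℝ (gradEst f δ τ (Y ω) (Z ω).2 (Z ω).1) (Y ω - z)) P ∧
    ∫ ω, objective 𝒟 f (Y ω) ∂P - objective 𝒟 f z - (2 * M₂ * τ + √d * Δ / τ * D) ≤
      ∫ ω, inner ℝ (gradEst f δ τ (Y ω) (Z ω).2 (Z ω).1) (Y ω - z) ∂P := by
  have hg := measurable_gradEst H.continuous H.measurable H.noise_measurable τ
  have hYZ : Measurable fun ω => (Y ω, Z ω) := hY.prodMk hZ
  have hh : Measurable fun y : EuclideanSpace ℝ (Fin d) × EuclideanSpace ℝ (Fin d) × Ξ =>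
    inner ℝ (gradEst f δ τ y.1 y.2.2 y.2.1) (y.1 - z) := by fun_prop
  have hi : Integrable (fun ω => inner ℝ (gradEst f δ τ (Y ω) (Z ω).2 (Z ω).1) (Y ω - z)) P := by
    refine ((integrable_comp_snd hZ hlaw H.integrable_envelope).mul_const D).mono'
      (hh.comp hYZ).aestronglyMeasurable ?_
    filter_upwards [ae_norm_eq_one hZ hlaw] with ω hω
    refine (norm_inner_le_norm _ _).trans ?_
    have h1 := H.norm_gradEst_le (hYX ω) hω (Z ω).2
    have h2 := hD _ (hYX ω)
    have h3 := H.envelope_nonneg (Z ω).2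
    gcongr
  refine ⟨hi, ?_⟩
  have hmap := map_prodMk_eq hY hZ hlaw hind
  have hi' : Integrable (fun y : EuclideanSpace ℝ (Fin d) × EuclideanSpace ℝ (Fin d) × Ξ =>
      inner ℝ (gradEst f δ τ y.1 y.2.2 y.2.1) (y.1 - z))
      ((P.map Y).prod ((uniformSphere d).prod 𝒟)) := by
    rw [← hmap, integrable_map_measure hh.aestronglyMeasurable hYZ.aemeasurable]
    exact hi
  -- Independence makes the joint law a product, so Fubini lets the iterate be frozen while the
  -- sample is averaged. This replaces conditional expectations.
  have e1 : ∫ ω, inner ℝ (gradEst f δ τ (Y ω) (Z ω).2 (Z ω).1) (Y ω - z) ∂P =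
      ∫ y, ∫ w : EuclideanSpace ℝ (Fin d) × Ξ, inner ℝ (gradEst f δ τ y w.2 w.1) (y - z)
        ∂((uniformSphere d).prod 𝒟) ∂(P.map Y) := by
    rw [← integral_prod _ hi', ← hmap, integral_map hYZ.aemeasurable hh.aestronglyMeasurable]
  have hFi : Integrable (objective 𝒟 f) (P.map Y) := by
    rw [integrable_map_measure H.measurable_objective.aestronglyMeasurable hY.aemeasurable]
    exact H.integrable_objective_comp hz hD hY hYX
  have : IsProbabilityMeasure (P.map Y) := Measure.isProbabilityMeasure_map hY.aemeasurable
  have e2 : ∫ ω, objective 𝒟 f (Y ω) ∂P - objective 𝒟 f z - (2 * M₂ * τ + √d * Δ / τ * D) =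
      ∫ y, (objective 𝒟 f y - (objective 𝒟 f z + (2 * M₂ * τ + √d * Δ / τ * D))) ∂(P.map Y) := by
    rw [integral_sub hFi (integrable_const _), integral_const, probReal_univ, one_smul,
      integral_map hY.aemeasurable H.measurable_objective.aestronglyMeasurable]
    ring
  rw [e1, e2]
  refine integral_mono_ae (hFi.sub (integrable_const _)) hi'.integral_prod_left ?_
  have hmem : ∀ᵐ y ∂(P.map Y), y ∈ X :=
    (ae_map_iff hY.aemeasurable hXc.isClosed.measurableSet).2 (Filter.Eventually.of_forall hYX)
  filter_upwards [hmem] with y hy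
  refine le_trans ?_ (H.le_integral_inner_gradEst hy hz)
  have h1 : √d * Δ / τ * ‖y - z‖ ≤ √d * Δ / τ * D := by
    have := hD y hy
    have := H.noise_nonneg
    have := H.tau_pos
    gcongr
  linarith

/-- Expected moment of one stochastic gradient. -/
lemma integral_qNorm_gradEst_comp_le (hd : 2 ≤ d) {q : ℝ≥0∞} (hq : 2 ≤ q) (hXc : IsCompact X)
    (hY : Measurable Y) (hYX : ∀ ω, Y ω ∈ X)
    (hZ : Measurable Z) (hlaw : P.map Z = (uniformSphere d).prod 𝒟) (hind : IndepFun Y Z P) :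
    Integrable (fun ω => qNorm q (gradEst f δ τ (Y ω) (Z ω).2 (Z ω).1) ^ (1 + κ)) P ∧
    ∫ ω, qNorm q (gradEst f δ τ (Y ω) (Z ω).2 (Z ω).1) ^ (1 + κ) ∂P ≤
      sigmaConst d q κ M₂ Δ τ ^ (1 + κ) := by
  have hκ := H.kappa_pos
  have hg := measurable_gradEst H.continuous H.measurable H.noise_measurable τ
  have hqm := (continuous_qNorm (d := d) hq).measurable
  have hYZ : Measurable fun ω => (Y ω, Z ω) := hY.prodMk hZ
  have hh : Measurable fun y : EuclideanSpace ℝ (Fin d) × EuclideanSpace ℝ (Fin d) × Ξ =>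
    qNorm q (gradEst f δ τ y.1 y.2.2 y.2.1) ^ (1 + κ) := (hqm.comp hg).pow_const _
  have hi : Integrable (fun ω => qNorm q (gradEst f δ τ (Y ω) (Z ω).2 (Z ω).1) ^ (1 + κ)) P := by
    refine (integrable_comp_snd hZ hlaw H.integrable_envelope_rpow).mono'
      (hh.comp hYZ).aestronglyMeasurable ?_
    filter_upwards [ae_norm_eq_one hZ hlaw] with ω hω
    have h0 := qNorm_nonneg q (gradEst f δ τ (Y ω) (Z ω).2 (Z ω).1)
    rw [Real.norm_of_nonneg (by positivity)]
    have := (qNorm_le_norm hq _).trans (H.norm_gradEst_le (hYX ω) hω (Z ω).2)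
    gcongr
  refine ⟨hi, ?_⟩
  have hmap := map_prodMk_eq hY hZ hlaw hind
  have hi' : Integrable (fun y : EuclideanSpace ℝ (Fin d) × EuclideanSpace ℝ (Fin d) × Ξ =>
      qNorm q (gradEst f δ τ y.1 y.2.2 y.2.1) ^ (1 + κ))
      ((P.map Y).prod ((uniformSphere d).prod 𝒟)) := by
    rw [← hmap, integrable_map_measure hh.aestronglyMeasurable hYZ.aemeasurable]
    exact hi
  have e1 : ∫ ω, qNorm q (gradEst f δ τ (Y ω) (Z ω).2 (Z ω).1) ^ (1 + κ) ∂P =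
      ∫ y, ∫ w : EuclideanSpace ℝ (Fin d) × Ξ, qNorm q (gradEst f δ τ y w.2 w.1) ^ (1 + κ)
        ∂((uniformSphere d).prod 𝒟) ∂(P.map Y) := by
    rw [← integral_prod _ hi', ← hmap, integral_map hYZ.aemeasurable hh.aestronglyMeasurable]
  have : IsProbabilityMeasure (P.map Y) := Measure.isProbabilityMeasure_map hY.aemeasurable
  have e2 : sigmaConst d q κ M₂ Δ τ ^ (1 + κ) =
      ∫ _, sigmaConst d q κ M₂ Δ τ ^ (1 + κ) ∂(P.map Y) := by simp
  rw [e1, e2]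
  refine integral_mono_ae hi'.integral_prod_left (integrable_const _) ?_
  have hmem : ∀ᵐ y ∂(P.map Y), y ∈ X :=
    (ae_map_iff hY.aemeasurable hXc.isClosed.measurableSet).2 (Filter.Eventually.of_forall hYX)
  filter_upwards [hmem] with y hy
  exact H.integral_qNorm_gradEst_rpow_le hd hq hy

end IsRegular

end Expectation

/-! ### Pathwise analysis of a run. -/

section Run

variable {d : ℕ} {Ξ : Type*} {X : Set (EuclideanSpace ℝ (Fin d))} {τ κ ν p : ℝ}
  {f : EuclideanSpace ℝ (Fin d) → Ξ → ℝ} {δ Ψ : EuclideanSpace ℝ (Fin d) → ℝ} {T : ℕ}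
  {x₀ : EuclideanSpace ℝ (Fin d)} {e : ℕ → EuclideanSpace ℝ (Fin d)} {ξ : ℕ → Ξ}
  {x : ℕ → EuclideanSpace ℝ (Fin d)}

lemma IsRun.mem (h : IsRun X f δ Ψ τ ν T x₀ e ξ x) {k : ℕ} (hk : k ≤ T) : x k ∈ X := by
  cases k with
  | zero => rw [h.zero]; exact h.start_mem
  | succ k => exact h.succ_mem k hk

/-- The one-step inequalities telescope in `D_Ψ(z, ·)`. -/
lemma IsRun.sum_inner_le (h : IsRun X f δ Ψ τ ν T x₀ e ξ x) (hκ0 : 0 < κ) (hκ1 : κ ≤ 1)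
    (hp1 : 1 ≤ p) (hp2 : p ≤ 2) {q : ℝ≥0∞} (hpq : (ENNReal.ofReal p).HolderConjugate q)
    (hΨ : IsUniformlyConvex 1 ((1 + κ) / κ) p Ψ) (hX : Convex ℝ X) (hν : 0 ≤ ν)
    {z : EuclideanSpace ℝ (Fin d)} (hz : z ∈ X) {n : ℕ} (hn : n ≤ T) :
    bregman Ψ z (x n) + ν * ∑ k ∈ Finset.range n, inner ℝ (gradEst f δ τ (x k) (ξ k) (e k)) (x k - z)
      ≤ bregman Ψ z x₀ + ν ^ (1 + κ) / (1 + κ) *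
        ∑ k ∈ Finset.range n, qNorm q (gradEst f δ τ (x k) (ξ k) (e k)) ^ (1 + κ) := by
  induction n with
  | zero => simp [h.zero]
  | succ n ih =>
    have h1 := hΨ.mirror_descent_step hκ0 hκ1 hp1 hp2 hpq hX hν (h.mem hn) hz
      (h.succ_min n (by omega))
    have h2 := ih (by omega)
    rw [Finset.sum_range_succ, Finset.sum_range_succ, mul_add, mul_add]
    linarith

/-- The proximal minimiser is unique, so a run is a deterministic function of its samples. This
supplies the measurability and independence of the iterates, which a run does not include as data.
-/
lemma IsRun.eq_orbit (h : IsRun X f δ Ψ τ ν T x₀ e ξ x) {S : EuclideanSpace ℝ (Fin d) →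
    EuclideanSpace ℝ (Fin d)} (hS : ∀ u z, z ∈ X →
      IsMinOn (fun y => bregman Ψ y (gradient (fenchelConj Ψ) u)) X z → z = S u)
    {n : ℕ} (hn : n ≤ T) :
    x n = orbit (fun w : EuclideanSpace ℝ (Fin d) × EuclideanSpace ℝ (Fin d) × Ξ =>
      S (gradient Ψ w.1 - ν • gradEst f δ τ w.1 w.2.2 w.2.1)) x₀ (fun k => (e k, ξ k)) n := by
  induction n with
  | zero => exact h.zero
  | succ n ih =>
    rw [orbit, ← ih (by omega)]
    exact hS _ _ (h.succ_mem n hn) (h.succ_min n hn)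

end Run

end ZORSMD

end

noncomputable section

namespace ZORSMD

/-! ### The averaged iterate. -/

section Average

variable {d : ℕ} {X : Set (EuclideanSpace ℝ (Fin d))} {T : ℕ} {x : ℕ → EuclideanSpace ℝ (Fin d)}

lemma average_eq_sum (T : ℕ) (x : ℕ → EuclideanSpace ℝ (Fin d)) :
    average T x = ∑ k ∈ Finset.range T, (T : ℝ)⁻¹ • x k := Finset.smul_sum

lemma sum_range_inv_eq_one (hT : 1 ≤ T) : ∑ _k ∈ Finset.range T, (T : ℝ)⁻¹ = 1 := by
  have : (T : ℝ) ≠ 0 := by exact_mod_cast (by omega : T ≠ 0)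
  simp [this]

lemma average_mem (hX : Convex ℝ X) (hT : 1 ≤ T) (hx : ∀ k < T, x k ∈ X) : average T x ∈ X := by
  rw [average_eq_sum]
  exact hX.sum_mem (fun _ _ => by positivity) (sum_range_inv_eq_one hT)
    fun k hk => hx k (Finset.mem_range.1 hk)

lemma average_congr {y : ℕ → EuclideanSpace ℝ (Fin d)} (h : ∀ k < T, x k = y k) :
    average T x = average T y := by
  unfold average
  rw [Finset.sum_congr rfl fun k hk => h k (Finset.mem_range.1 hk)]

lemma map_average_le {F : EuclideanSpace ℝ (Fin d) → ℝ} (hF : ConvexOn ℝ X F) (hT : 1 ≤ T)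
    (hx : ∀ k < T, x k ∈ X) : T * F (average T x) ≤ ∑ k ∈ Finset.range T, F (x k) := by
  have hT0 : (0 : ℝ) < T := by exact_mod_cast (by omega : 0 < T)
  have h := hF.map_sum_le (t := Finset.range T) (w := fun _ => (T : ℝ)⁻¹) (p := x)
    (fun _ _ => by positivity) (sum_range_inv_eq_one hT) fun k hk => hx k (Finset.mem_range.1 hk)
  rw [← average_eq_sum] at h
  simp only [smul_eq_mul] at h
  rw [← Finset.mul_sum] at h
  calc T * F (average T x) ≤ T * ((T : ℝ)⁻¹ * ∑ k ∈ Finset.range T, F (x k)) := by gcongr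
    _ = _ := by field_simp

end Average

/-! ### The regret bound and the choice of stepsize. -/

section Regret

variable {d : ℕ} [NeZero d] {Ξ : Type*} [MeasurableSpace Ξ]
  {X : Set (EuclideanSpace ℝ (Fin d))} {τ κ ν p : ℝ} {𝒟 : Measure Ξ} [IsProbabilityMeasure 𝒟]
  {f : EuclideanSpace ℝ (Fin d) → Ξ → ℝ} {Mξ : Ξ → ℝ} {M₂ : ℝ}
  {δ Ψ : EuclideanSpace ℝ (Fin d) → ℝ} {Δ : ℝ}
  {Ω : Type*} [MeasurableSpace Ω] {P : Measure Ω} [IsProbabilityMeasure P]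

/-- The regret bound for an arbitrary nonnegative stepsize. -/
lemma IsRegular.regret_le (H : IsRegular X τ κ 𝒟 f Mξ M₂ δ Δ) (hd : 2 ≤ d) (hp1 : 1 ≤ p)
    (hp2 : p ≤ 2) {q : ℝ≥0∞} (hpq : (ENNReal.ofReal p).HolderConjugate q)
    (hΨ : IsUniformlyConvex 1 ((1 + κ) / κ) p Ψ) (hXc : IsCompact X) (hX : Convex ℝ X)
    {z x₀ : EuclideanSpace ℝ (Fin d)} (hz : z ∈ X) (hx₀ : x₀ ∈ X) {D : ℝ}
    (hD : ∀ x ∈ X, ‖x - z‖ ≤ D) (hν : 0 ≤ ν) {T : ℕ} (hT : 1 ≤ T)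
    {e : ℕ → Ω → EuclideanSpace ℝ (Fin d)} {ξ : ℕ → Ω → Ξ}
    (he : ∀ k < T, Measurable (e k)) (hξ : ∀ k < T, Measurable (ξ k))
    (hlaw : ∀ k < T, P.map (fun ω => (e k ω, ξ k ω)) = (uniformSphere d).prod 𝒟)
    (hindep : iIndepFun (fun (k : Fin T) (ω : Ω) => (e k ω, ξ k ω)) P)
    {x : ℕ → Ω → EuclideanSpace ℝ (Fin d)}
    (hrun : ∀ᵐ ω ∂P, IsRun X f δ Ψ τ ν T x₀ (fun k => e k ω) (fun k => ξ k ω) (fun k => x k ω)) :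
    Integrable (fun ω => objective 𝒟 f (average T (fun k => x k ω))) P ∧
    ν * T * (∫ ω, objective 𝒟 f (average T (fun k => x k ω)) ∂P - objective 𝒟 f z -
        (2 * M₂ * τ + √d * Δ / τ * D)) ≤
      bregman Ψ z x₀ + ν ^ (1 + κ) / (1 + κ) * (T * sigmaConst d q κ M₂ Δ τ ^ (1 + κ)) := by
  have hκ0 := H.kappa_pos
  have hq := two_le_of_holderConjugate hp2 hpq
  -- The continuous argmin map makes the recursion measurable. From here on the orbit `Y` is used,
  -- which agrees almost surely with the given iterates.
  obtain ⟨S, hSc, hSX, hS⟩ := hΨ.exists_continuous_argmin hκ0 H.kappa_le_one hp1 hp2 hXc hX ⟨z, hz⟩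
  set G := fun w : EuclideanSpace ℝ (Fin d) × EuclideanSpace ℝ (Fin d) × Ξ =>
      S (gradient Ψ w.1 - ν • gradEst f δ τ w.1 w.2.2 w.2.1)
  have hG : Measurable G := by
    have h1 := measurable_gradEst H.continuous H.measurable H.noise_measurable τ
    have h2 := measurable_gradient Ψ
    have h3 := hSc.measurable
    fun_prop
  set Z : ℕ → Ω → EuclideanSpace ℝ (Fin d) × Ξ := fun k ω => (e k ω, ξ k ω)
  have hZ : ∀ k < T, Measurable (Z k) := fun k hk => (he k hk).prodMk (hξ k hk)
  set Y : ℕ → Ω → EuclideanSpace ℝ (Fin d) := fun k ω => orbit G x₀ (fun i => Z i ω) k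
  have hY : ∀ k < T, Measurable (Y k) ∧ IndepFun (Y k) (Z k) P := fun k hk =>
    measurable_and_indepFun_orbit hG x₀ hZ hindep hk
  have hYX : ∀ k ω, Y k ω ∈ X := fun k ω => by
    cases k with
    | zero => exact hx₀
    | succ k => exact hSX _
  have hxY : ∀ᵐ ω ∂P, ∀ k ≤ T, x k ω = Y k ω := by
    filter_upwards [hrun] with ω hω k hk using hω.eq_orbit hS hk
  have hA : Measurable fun ω => average T (fun k => Y k ω) :=
    (Finset.measurable_sum _ fun k hk => (hY k (Finset.mem_range.1 hk)).1).const_smul (T : ℝ)⁻¹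
  have hAX : ∀ ω, average T (fun k => Y k ω) ∈ X := fun ω => average_mem hX hT fun k _ => hYX k ω
  have hAe : (fun ω => objective 𝒟 f (average T (fun k => x k ω))) =ᵐ[P]
      fun ω => objective 𝒟 f (average T (fun k => Y k ω)) := by
    filter_upwards [hxY] with ω hω
    rw [average_congr fun k hk => hω k hk.le]
  have hAi : Integrable (fun ω => objective 𝒟 f (average T (fun k => Y k ω))) P :=
    H.integrable_objective_comp hz hD hA hAX
  refine ⟨hAi.congr hAe.symm, ?_⟩
  rw [integral_congr_ae hAe]
  set g : ℕ → Ω → ℝ := fun k ω => inner ℝ (gradEst f δ τ (Y k ω) (Z k ω).2 (Z k ω).1) (Y k ω - z)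
  set h : ℕ → Ω → ℝ := fun k ω => qNorm q (gradEst f δ τ (Y k ω) (Z k ω).2 (Z k ω).1) ^ (1 + κ)
  have hg : ∀ k ∈ Finset.range T, Integrable (g k) P ∧ ∫ ω, objective 𝒟 f (Y k ω) ∂P -
      objective 𝒟 f z - (2 * M₂ * τ + √d * Δ / τ * D) ≤ ∫ ω, g k ω ∂P := fun k hk => by
    have hk := Finset.mem_range.1 hk
    exact H.integral_inner_gradEst_ge hXc hz hD (hY k hk).1 (hYX k) (hZ k hk) (hlaw k hk) (hY k hk).2
  have hh : ∀ k ∈ Finset.range T, Integrable (h k) P ∧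
      ∫ ω, h k ω ∂P ≤ sigmaConst d q κ M₂ Δ τ ^ (1 + κ) := fun k hk => by
    have hk := Finset.mem_range.1 hk
    exact H.integral_qNorm_gradEst_comp_le hd hq hXc (hY k hk).1 (hYX k) (hZ k hk) (hlaw k hk)
      (hY k hk).2
  have hpath : ∀ᵐ ω ∂P, ν * ∑ k ∈ Finset.range T, g k ω ≤
      bregman Ψ z x₀ + ν ^ (1 + κ) / (1 + κ) * ∑ k ∈ Finset.range T, h k ω := by
    filter_upwards [hrun, hxY] with ω hω hxω
    have h1 := hω.sum_inner_le hκ0 H.kappa_le_one hp1 hp2 hpq hΨ hX hν hz le_rfl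
    have h2 := hΨ.bregman_nonneg hκ0 (x T ω) z
    have e1 : ∑ k ∈ Finset.range T, inner ℝ (gradEst f δ τ (x k ω) (ξ k ω) (e k ω)) (x k ω - z) =
        ∑ k ∈ Finset.range T, g k ω := Finset.sum_congr rfl fun k hk => by
      rw [hxω k (Finset.mem_range.1 hk).le]
    have e2 : ∑ k ∈ Finset.range T, qNorm q (gradEst f δ τ (x k ω) (ξ k ω) (e k ω)) ^ (1 + κ) =
        ∑ k ∈ Finset.range T, h k ω := Finset.sum_congr rfl fun k hk => by
      rw [hxω k (Finset.mem_range.1 hk).le]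
    rw [e1, e2] at h1
    linarith
  have ig : Integrable (fun ω => ∑ k ∈ Finset.range T, g k ω) P :=
    integrable_finsetSum _ fun k hk => (hg k hk).1
  have ih : Integrable (fun ω => ∑ k ∈ Finset.range T, h k ω) P :=
    integrable_finsetSum _ fun k hk => (hh k hk).1
  have hint := integral_mono_ae (ig.const_mul ν)
    ((integrable_const (bregman Ψ z x₀)).add (ih.const_mul (ν ^ (1 + κ) / (1 + κ)))) hpath
  rw [integral_const_mul, integral_finsetSum _ fun k hk => (hg k hk).1,
    integral_add' (integrable_const _) (ih.const_mul _), integral_const, probReal_univ, one_smul,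
    integral_const_mul, integral_finsetSum _ fun k hk => (hh k hk).1] at hint
  have iF : ∀ k ∈ Finset.range T, Integrable (fun ω => objective 𝒟 f (Y k ω)) P := fun k hk =>
    H.integrable_objective_comp hz hD (hY k (Finset.mem_range.1 hk)).1 (hYX k)
  have hJ : T * ∫ ω, objective 𝒟 f (average T (fun k => Y k ω)) ∂P ≤
      ∑ k ∈ Finset.range T, ∫ ω, objective 𝒟 f (Y k ω) ∂P := by
    rw [← integral_const_mul, ← integral_finsetSum _ iF]
    exact integral_mono (hAi.const_mul _) (integrable_finsetSum _ iF) fun ω =>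
      map_average_le (H.convexOn_objective hX) hT fun k _ => hYX k ω
  have hs1 := Finset.sum_le_sum fun k hk => (hg k hk).2
  have hs2 := Finset.sum_le_sum fun k hk => (hh k hk).2
  simp only [Finset.sum_sub_distrib, Finset.sum_const, Finset.card_range, nsmul_eq_mul] at hs1 hs2
  calc ν * T * (∫ ω, objective 𝒟 f (average T (fun k => Y k ω)) ∂P - objective 𝒟 f z -
        (2 * M₂ * τ + √d * Δ / τ * D))
      = ν * (T * ∫ ω, objective 𝒟 f (average T (fun k => Y k ω)) ∂P - T * objective 𝒟 f z -
        T * (2 * M₂ * τ + √d * Δ / τ * D)) := by ring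
    _ ≤ ν * ∑ k ∈ Finset.range T, ∫ ω, g k ω ∂P := by
        gcongr
        linarith
    _ ≤ _ := hint
    _ ≤ _ := by gcongr

/-- Optimising the stepsize in the regret bound. -/
lemma le_of_stepSize {κ R σ u B : ℝ} {T : ℕ} (hκ : 0 < κ) (hT : 1 ≤ T) (hR : 0 < R) (hσ : 0 < σ)
    (hB : R ^ ((1 + κ) / κ) = (1 + κ) / κ * B)
    (h : stepSize κ R σ T * T * u ≤
      B + stepSize κ R σ T ^ (1 + κ) / (1 + κ) * (T * σ ^ (1 + κ))) :
    u ≤ R * σ / (T : ℝ) ^ (κ / (1 + κ)) := by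
  have hT0 : (0 : ℝ) < T := by exact_mod_cast (by omega : 0 < T)
  have hρ : 0 < R ^ (1 / κ) := by positivity
  have e1 : R ^ ((1 + κ) / κ) = R * R ^ (1 / κ) := by
    rw [← Real.rpow_one_add' hR.le (by positivity)]; congr 1; field_simp; ring
  have e2 : (R ^ (1 / κ)) ^ (1 + κ) = R * R ^ (1 / κ) := by
    rw [← e1, ← Real.rpow_mul hR.le]; congr 1; field_simp
  have e3 : stepSize κ R σ T * T = R ^ (1 / κ) / σ * (T : ℝ) ^ (κ / (1 + κ)) := by
    rw [stepSize, mul_assoc, ← Real.rpow_add_one hT0.ne']; congr 2; field_simp; ring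
  have e4 : stepSize κ R σ T ^ (1 + κ) * (T * σ ^ (1 + κ)) = R * R ^ (1 / κ) := by
    rw [stepSize, Real.mul_rpow (by positivity) (by positivity),
      Real.div_rpow hρ.le hσ.le, e2, ← Real.rpow_mul hT0.le,
      show -(1 / (1 + κ)) * (1 + κ) = -1 by field_simp, Real.rpow_neg_one]
    have : σ ^ (1 + κ) ≠ 0 := by positivity
    field_simp
  rw [e3, div_mul_eq_mul_div (_ ^ (1 + κ)), e4] at h
  rw [e1] at hB
  have hB' : B = κ / (1 + κ) * (R * R ^ (1 / κ)) := by rw [hB]; field_simp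
  -- The stepsize makes the initial divergence and the gradient moments contribute the shares
  -- `κ/(1+κ)` and `1/(1+κ)` of the same quantity.
  have e5 : B + R * R ^ (1 / κ) / (1 + κ) = R * R ^ (1 / κ) := by rw [hB']; field_simp; ring
  rw [e5] at h
  rw [le_div_iff₀ (by positivity)]
  have h2 : R ^ (1 / κ) * (u * (T : ℝ) ^ (κ / (1 + κ))) ≤ R ^ (1 / κ) * (R * σ) := by
    calc R ^ (1 / κ) * (u * (T : ℝ) ^ (κ / (1 + κ)))
        = σ * (R ^ (1 / κ) / σ * (T : ℝ) ^ (κ / (1 + κ)) * u) := by field_simp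
      _ ≤ σ * (R * R ^ (1 / κ)) := by gcongr
      _ = _ := by ring
  exact le_of_mul_le_mul_left h2 hρ

end Regret

end ZORSMD

end

noncomputable section

namespace ZORSMD

/-! ### The expected gap, including degenerate stepsizes. -/

section Gap

variable {d : ℕ} [NeZero d] {Ξ : Type*} [MeasurableSpace Ξ]
  {X : Set (EuclideanSpace ℝ (Fin d))} {τ κ p : ℝ} {𝒟 : Measure Ξ} [IsProbabilityMeasure 𝒟]
  {f : EuclideanSpace ℝ (Fin d) → Ξ → ℝ} {Mξ : Ξ → ℝ} {M₂ : ℝ}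
  {δ Ψ : EuclideanSpace ℝ (Fin d) → ℝ} {Δ : ℝ}
  {Ω : Type*} [MeasurableSpace Ω] {P : Measure Ω} [IsProbabilityMeasure P]

omit [NeZero d] [MeasurableSpace Ξ] in
/-- With vanishing initial distance the algorithm stays at the reference point. -/
lemma IsRun.eq_of_initialDist_eq_zero {q : ℝ≥0∞} {z x₀ : EuclideanSpace ℝ (Fin d)} {σ : ℝ} {T : ℕ}
    {e : ℕ → EuclideanSpace ℝ (Fin d)} {ξ : ℕ → Ξ} {x : ℕ → EuclideanSpace ℝ (Fin d)}
    (h : IsRun X f δ Ψ τ (stepSize κ (initialDist κ Ψ z x₀) σ T) T x₀ e ξ x)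
    (hR : initialDist κ Ψ z x₀ = 0) (hκ0 : 0 < κ) (hκ1 : κ ≤ 1) (hp1 : 1 ≤ p) (hp2 : p ≤ 2)
    (hpq : (ENNReal.ofReal p).HolderConjugate q) (hΨ : IsUniformlyConvex 1 ((1 + κ) / κ) p Ψ)
    (hX : Convex ℝ X) (hz : z ∈ X) {n : ℕ} (hn : n ≤ T) : x n = z := by
  have hB := hΨ.initialDist_rpow hκ0 x₀ z
  have hr : (1 + κ) / κ ≠ 0 := by positivity
  rw [hR, Real.zero_rpow hr, eq_comm, mul_eq_zero] at hB
  have hB := hB.resolve_left hr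
  -- With zero stepsize the telescoped inequality only says that `D_Ψ(z, ·)` does not grow, so it
  -- stays zero and uniform convexity pins every iterate to `z`.
  have hν : stepSize κ (initialDist κ Ψ z x₀) σ T = 0 := by
    rw [stepSize, hR, Real.zero_rpow (by positivity), zero_div, zero_mul]
  rw [hν] at h
  have h1 := h.sum_inner_le hκ0 hκ1 hp1 hp2 hpq hΨ hX le_rfl hz hn
  rw [Real.zero_rpow (by positivity), hB, zero_div, zero_mul, zero_mul, add_zero, add_zero] at h1
  have h2 := hΨ.norm_rpow_le_bregman hκ0 hp1 hp2 (x n) z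
  have h3 : κ / (1 + κ) * ‖x n - z‖ ^ ((1 + κ) / κ) ≤ 0 := by linarith
  by_contra hne
  have h4 : 0 < ‖x n - z‖ := norm_pos_iff.2 (sub_ne_zero.2 hne)
  have : 0 < κ / (1 + κ) * ‖x n - z‖ ^ ((1 + κ) / κ) := by positivity
  linarith

omit [NeZero d] in
lemma sigmaConst_pos (hd : 2 ≤ d) {q : ℝ≥0∞} (hq : 2 ≤ q) (hM : 0 < M₂) (hΔ : 0 ≤ Δ)
    (hτ : 0 < τ) : 0 < sigmaConst d q κ M₂ Δ τ := by
  have := aConst_pos hd hq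
  have hd0 : (0 : ℝ) < d := by exact_mod_cast (by omega : 0 < d)
  unfold sigmaConst
  positivity

/-- The expected optimality gap of the averaged iterate. -/
lemma IsRegular.gap_le (H : IsRegular X τ κ 𝒟 f Mξ M₂ δ Δ) (hd : 2 ≤ d) (hp1 : 1 ≤ p)
    (hp2 : p ≤ 2) {q : ℝ≥0∞} (hpq : (ENNReal.ofReal p).HolderConjugate q)
    (hΨ : IsUniformlyConvex 1 ((1 + κ) / κ) p Ψ) (hXc : IsCompact X) (hX : Convex ℝ X)
    {z x₀ : EuclideanSpace ℝ (Fin d)} (hz : z ∈ X) {T : ℕ} (hT : 1 ≤ T)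
    {e : ℕ → Ω → EuclideanSpace ℝ (Fin d)} {ξ : ℕ → Ω → Ξ}
    (he : ∀ k < T, Measurable (e k)) (hξ : ∀ k < T, Measurable (ξ k))
    (hlaw : ∀ k < T, P.map (fun ω => (e k ω, ξ k ω)) = (uniformSphere d).prod 𝒟)
    (hindep : iIndepFun (fun (k : Fin T) (ω : Ω) => (e k ω, ξ k ω)) P)
    {x : ℕ → Ω → EuclideanSpace ℝ (Fin d)}
    (hrun : ∀ᵐ ω ∂P, IsRun X f δ Ψ τ
      (stepSize κ (initialDist κ Ψ z x₀) (sigmaConst d q κ M₂ Δ τ) T) T x₀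
      (fun k => e k ω) (fun k => ξ k ω) (fun k => x k ω)) :
    Integrable (fun ω => objective 𝒟 f (average T (fun k => x k ω))) P ∧
    ∫ ω, objective 𝒟 f (average T (fun k => x k ω)) ∂P - objective 𝒟 f z ≤
      2 * M₂ * τ + √d * Δ / τ * bregmanDiam κ Ψ X + initialDist κ Ψ z x₀ *
        sigmaConst d q κ M₂ Δ τ / (T : ℝ) ^ (κ / (1 + κ)) ∧
    ∫ ω, objective 𝒟 f (average T (fun k => x k ω)) ∂P - objective 𝒟 f z ≤
      M₂ * bregmanDiam κ Ψ X := by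
  have hκ0 := H.kappa_pos
  have hκ1 := H.kappa_le_one
  have hτ := H.tau_pos
  have hΔ := H.noise_nonneg
  have hM₂ := H.bound_nonneg
  have hq := two_le_of_holderConjugate hp2 hpq
  have hR0 := hΨ.initialDist_nonneg hκ0 x₀ z
  have hσ0 := IsRegular.sigmaConst_nonneg (κ := κ) hd hq hM₂ hΔ hτ
  have hD : ∀ y ∈ X, ‖y - z‖ ≤ bregmanDiam κ Ψ X := fun y hy =>
    (norm_le_pNorm hp1 hp2 _).trans (hΨ.pNorm_sub_le_bregmanDiam hκ0 hXc hy hz)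
  have hD0 : 0 ≤ bregmanDiam κ Ψ X := (norm_nonneg _).trans (hD z hz)
  have hx₀ : x₀ ∈ X := hrun.exists.choose_spec.start_mem
  have hν : 0 ≤ stepSize κ (initialDist κ Ψ z x₀) (sigmaConst d q κ M₂ Δ τ) T := by
    unfold stepSize; positivity
  obtain ⟨hi, hreg⟩ := H.regret_le hd hp1 hp2 hpq hΨ hXc hX hz hx₀ hD hν hT he hξ hlaw hindep hrun
  have hpos : 0 ≤ 2 * M₂ * τ + √d * Δ / τ * bregmanDiam κ Ψ X + initialDist κ Ψ z x₀ *
      sigmaConst d q κ M₂ Δ τ / (T : ℝ) ^ (κ / (1 + κ)) := by positivity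
  have of_ae : ∀ c : ℝ, (∀ᵐ ω ∂P, objective 𝒟 f (average T (fun k => x k ω)) ≤
      objective 𝒟 f z + c) →
      ∫ ω, objective 𝒟 f (average T (fun k => x k ω)) ∂P - objective 𝒟 f z ≤ c := fun c hc => by
    have := integral_mono_ae hi (integrable_const _) hc
    rw [integral_const, probReal_univ, one_smul] at this
    linarith
  -- A fallback by Lipschitz continuity alone. It settles the case `σ_q = 0` here, and the case of a
  -- large target accuracy in the complexity bound.
  have hlip : ∫ ω, objective 𝒟 f (average T (fun k => x k ω)) ∂P - objective 𝒟 f z ≤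
      M₂ * bregmanDiam κ Ψ X := by
    refine of_ae _ ?_
    filter_upwards [hrun] with ω hω
    have hm : average T (fun k => x k ω) ∈ X := average_mem hX hT fun k hk => hω.mem hk.le
    have h1 := (le_abs_self _).trans (H.abs_objective_sub_le hm hz)
    have h2 : M₂ * ‖average T (fun k => x k ω) - z‖ ≤ M₂ * bregmanDiam κ Ψ X :=
      mul_le_mul_of_nonneg_left (hD _ hm) hM₂
    linarith
  refine ⟨hi, ?_, hlip⟩
  -- Dividing the regret bound by the stepsize requires `R₀ > 0` and `σ_q > 0`. If `R₀ = 0` the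
  -- average is `z` itself; if `σ_q = 0` then `M₂ = 0` and the fallback gives a nonpositive gap.
  rcases hR0.eq_or_lt with hR | hR
  · refine le_trans (of_ae 0 ?_) hpos
    filter_upwards [hrun] with ω hω
    have h1 : average T (fun k => x k ω) = z := by
      rw [average_congr (y := fun _ => z) fun k hk =>
        hω.eq_of_initialDist_eq_zero hR.symm hκ0 hκ1 hp1 hp2 hpq hΨ hX hz hk.le,
        average_eq_sum, ← Finset.sum_smul, sum_range_inv_eq_one hT, one_smul]
    rw [h1, add_zero]
  rcases hσ0.eq_or_lt with hσ | hσ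
  · have h0 : M₂ = 0 := by
      by_contra hne
      exact (sigmaConst_pos (κ := κ) hd hq (hM₂.lt_of_ne' hne) hΔ hτ).ne hσ
    rw [h0, zero_mul] at hlip
    exact hlip.trans hpos
  have h1 := le_of_stepSize hκ0 hT hR hσ (hΨ.initialDist_rpow hκ0 x₀ z) hreg
  linarith

end Gap

/-! ### Arithmetic of the final constants. -/

section Constants

variable {d : ℕ} {κ M₂ Δ τ : ℝ}

/-- Superadditivity of the power `1+κ` merges the two terms before the root is taken, and
`2^(κ/(1+κ)) ≤ √2` because `κ ≤ 1`. -/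
lemma sigmaConst_le (hd : 2 ≤ d) {q : ℝ≥0∞} (hq : 2 ≤ q) (hκ0 : 0 < κ) (hκ1 : κ ≤ 1) (hM : 0 ≤ M₂)
    (hΔ : 0 ≤ Δ) (hτ : 0 < τ) : sigmaConst d q κ M₂ Δ τ ≤
      √2 * (√d / 2 ^ (1 / 4 : ℝ) * aConst d q * M₂ + d * aConst d q * Δ / τ) := by
  have ha := aConst_pos hd hq
  have hA : 0 ≤ √d / 2 ^ (1 / 4 : ℝ) * aConst d q * M₂ := by positivity
  have hB : 0 ≤ d * aConst d q * Δ / τ := by positivity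
  unfold sigmaConst
  set A := √d / 2 ^ (1 / 4 : ℝ) * aConst d q * M₂
  set B := d * aConst d q * Δ / τ
  have h1 : A ^ (1 + κ) + B ^ (1 + κ) ≤ (A + B) ^ (1 + κ) :=
    Real.add_rpow_le_rpow_add hA hB (by linarith)
  calc (2 ^ κ * A ^ (1 + κ) + 2 ^ κ * B ^ (1 + κ)) ^ (1 / (1 + κ))
      = (2 ^ κ * (A ^ (1 + κ) + B ^ (1 + κ))) ^ (1 / (1 + κ)) := by rw [mul_add]
    _ ≤ (2 ^ κ * (A + B) ^ (1 + κ)) ^ (1 / (1 + κ)) := by gcongr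
    _ = 2 ^ (κ / (1 + κ)) * (A + B) := by
        rw [Real.mul_rpow (by positivity) (by positivity), ← Real.rpow_mul (by positivity),
          ← Real.rpow_mul (by positivity), mul_one_div_cancel (by positivity), Real.rpow_one,
          mul_one_div]
    _ ≤ 2 ^ (1 / 2 : ℝ) * (A + B) := by
        gcongr ?_ * _
        refine Real.rpow_le_rpow_of_exponent_le (by norm_num) ?_
        rw [div_le_div_iff₀ (by positivity) (by norm_num)]
        linarith
    _ = _ := by rw [Real.sqrt_eq_rpow]

lemma sqrt_two_mul_div_le (c : ℝ) (hc : 0 ≤ c) : √2 * (c / 2 ^ (1 / 4 : ℝ)) ≤ 1.19 * c := by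
  have h0 : (0 : ℝ) < 2 ^ (1 / 4 : ℝ) := by positivity
  have h1 : ((2 : ℝ) ^ (1 / 4 : ℝ)) ^ 2 = √2 := by
    rw [← Real.rpow_natCast, ← Real.rpow_mul (by norm_num), Real.sqrt_eq_rpow]; norm_num
  have h2 : √2 ≤ 1.4143 := by rw [Real.sqrt_le_left (by norm_num)]; norm_num
  have h3 : (2 : ℝ) ^ (1 / 4 : ℝ) ≤ 1.19 := by nlinarith
  calc √2 * (c / 2 ^ (1 / 4 : ℝ)) = 2 ^ (1 / 4 : ℝ) * c := by rw [← h1]; field_simp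
    _ ≤ _ := by gcongr

/-- The bound at the optimal smoothing radius. -/
lemma gap_bound_optimal {s a D R w σ : ℝ} {n : ℕ} (hs : s = √n) (ha : 0 ≤ a) (hD : 0 ≤ D) (hR : 0 ≤ R)
    (hw : 0 < w) (hM : 0 ≤ M₂) (hΔ : 0 ≤ Δ) (hτ : 0 < τ)
    (hσ : σ ≤ √2 * (s / 2 ^ (1 / 4 : ℝ) * a * M₂ + n * a * Δ / τ))
    (hτe : τ = √((s * Δ * D + 4 * R * n * a * Δ * w⁻¹) / (2 * M₂))) :
    2 * M₂ * τ + s * Δ / τ * D + R * σ / w ≤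
      √(8 * M₂ * s * Δ * D) + √(32 * M₂ * R * n * a * Δ / w) + 2 * s * a * M₂ * R / w := by
  have hs0 : 0 ≤ s := hs ▸ Real.sqrt_nonneg _
  -- If `M₂` were zero, division by zero would give the value `0`, so the prescribed radius would
  -- vanish, against `τ > 0`.
  have hM0 : 0 < M₂ := by
    refine hM.lt_of_ne' fun h => ?_
    rw [h, mul_zero, div_zero, Real.sqrt_zero] at hτe
    exact hτ.ne' hτe
  set Q := s * Δ * D + 4 * R * n * a * Δ * w⁻¹ with hQ
  have hQ0 : 0 ≤ Q := by positivity
  have hτ2 : τ ^ 2 * (2 * M₂) = Q := by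
    rw [hτe, Real.sq_sqrt (by positivity)]; field_simp
  have h2 : √2 ≤ 1.4143 := by rw [Real.sqrt_le_left (by norm_num)]; norm_num
  -- The constants `2^(1/4)` and `√2` are rounded up to `2` and `4` to match the coefficients in the
  -- prescribed radius and the target bound.
  have h1 : σ ≤ 2 * (s * a * M₂) + 4 * (n * a * Δ / τ) := by
    have h3 := sqrt_two_mul_div_le (s * a * M₂) (by positivity)
    have h4 : 0 ≤ s * a * M₂ := by positivity
    have h5 : 0 ≤ n * a * Δ / τ := by positivity
    have e1 : √2 * (s / 2 ^ (1 / 4 : ℝ) * a * M₂ + n * a * Δ / τ) =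
      √2 * (s * a * M₂ / 2 ^ (1 / 4 : ℝ)) + √2 * (n * a * Δ / τ) := by ring
    have h6 : √2 * (n * a * Δ / τ) ≤ 1.4143 * (n * a * Δ / τ) := by gcongr
    linarith
  have h3 : 2 * M₂ * τ + Q / τ ≤ √(8 * M₂ * s * Δ * D) + √(32 * M₂ * R * n * a * Δ / w) := by
    -- The radius minimises `2 M₂ τ + Q/τ`: both summands are equal there, so the sum is `4 M₂ τ`.
    have e1 : 2 * M₂ * τ + Q / τ = √(8 * M₂ * Q) := by
      rw [← hτ2, show 8 * M₂ * (τ ^ 2 * (2 * M₂)) = (4 * M₂ * τ) ^ 2 by ring,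
        Real.sqrt_sq (by positivity)]
      field_simp; norm_num
    have e2 : 8 * M₂ * Q = 8 * M₂ * s * Δ * D + 32 * M₂ * R * n * a * Δ / w := by
      rw [hQ]; field_simp; ring
    rw [e1, e2]
    refine Real.sqrt_le_iff.2 ⟨by positivity, ?_⟩
    rw [add_sq, Real.sq_sqrt (by positivity), Real.sq_sqrt (by positivity)]
    have : 0 ≤ 2 * √(8 * M₂ * s * Δ * D) * √(32 * M₂ * R * n * a * Δ / w) := by positivity
    linarith
  calc 2 * M₂ * τ + s * Δ / τ * D + R * σ / w
      ≤ 2 * M₂ * τ + s * Δ / τ * D + R * (2 * (s * a * M₂) + 4 * (n * a * Δ / τ)) / w := by gcongr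
    _ = (2 * M₂ * τ + Q / τ) + 2 * s * a * M₂ * R / w := by rw [hQ]; field_simp; ring
    _ ≤ _ := by gcongr

/-- The accuracy reached after sufficiently many iterations. -/
lemma gap_bound_complexity {s a D R w σ ε : ℝ} {n : ℕ} (hs : s = √n) (ha : 0 ≤ a)
    (hR : 0 ≤ R) (hw : 0 < w) (hM : 0 ≤ M₂) (hΔ : 0 ≤ Δ) (hτ : 0 < τ)
    (hσ : σ ≤ √2 * (s / 2 ^ (1 / 4 : ℝ) * a * M₂ + n * a * Δ / τ)) (hε : 0 < ε)
    (hτe : 6 * M₂ * τ = ε) (hΔe : 36 * M₂ * s * D * Δ ≤ ε ^ 2)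
    (hwe : 6 * s * a * M₂ * R / ε ≤ w) (hMD : ε < M₂ * D) :
    2 * M₂ * τ + s * Δ / τ * D + R * σ / w ≤ ε := by
  have hs0 : 0 ≤ s := hs ▸ Real.sqrt_nonneg _
  have hn : (n : ℝ) = s * s := by rw [hs, Real.mul_self_sqrt (Nat.cast_nonneg n)]
  have hM0 : 0 < M₂ := by
    refine hM.lt_of_ne' fun h => ?_
    rw [h] at hτe; linarith
  have hτ' : τ = ε / (6 * M₂) := by rw [← hτe]; field_simp
  have h2 : √2 ≤ 1.4143 := by rw [Real.sqrt_le_left (by norm_num)]; norm_num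
  rw [div_le_iff₀ hε] at hwe
  -- The noise hypothesis controls only the product of `Δ` with `D`; `ε < M₂ D` turns it into a
  -- bound on `Δ` alone. The shares then add up to `ε/3 + ε/6 + 1.19 ε/6 + 1.4143 ε/36 < ε`.
  have h36 : 36 * (s * Δ) ≤ ε := by
    have h3 : 36 * (s * Δ) * ε ≤ ε * ε := by
      calc 36 * (s * Δ) * ε ≤ 36 * (s * Δ) * (M₂ * D) := by gcongr
        _ = 36 * M₂ * s * D * Δ := by ring
        _ ≤ ε * ε := by rwa [← sq]
    exact le_of_mul_le_mul_right h3 hε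
  have t1 : 2 * M₂ * τ = ε / 3 := by linarith
  have t2 : s * Δ / τ * D ≤ ε / 6 := by
    rw [hτ', show s * Δ / (ε / (6 * M₂)) * D = 36 * M₂ * s * D * Δ / (6 * ε) by field_simp; ring,
      div_le_div_iff₀ (by positivity) (by norm_num)]
    nlinarith
  have h3 := sqrt_two_mul_div_le (s * a * M₂) (by positivity)
  have t3 : R * σ ≤ (1.19 * ε / 6 + 1.4143 * (s * Δ)) * w := by
    have h5 : 0 ≤ n * a * Δ / τ := by positivity
    have e1 : √2 * (s / 2 ^ (1 / 4 : ℝ) * a * M₂ + n * a * Δ / τ) =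
      √2 * (s * a * M₂ / 2 ^ (1 / 4 : ℝ)) + √2 * (n * a * Δ / τ) := by ring
    have h6 : √2 * (n * a * Δ / τ) ≤ 1.4143 * (n * a * Δ / τ) := by gcongr
    have e2 : n * a * Δ / τ = (6 * s * a * M₂) * (s * Δ) / ε := by rw [hτ', hn]; field_simp
    have h7 : σ ≤ 1.19 * (s * a * M₂) + 1.4143 * ((6 * s * a * M₂) * (s * Δ) / ε) := by
      rw [← e2]; linarith
    calc R * σ ≤ R * (1.19 * (s * a * M₂) + 1.4143 * ((6 * s * a * M₂) * (s * Δ) / ε)) := by gcongr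
      _ = (1.19 / 6 + 1.4143 * (s * Δ) / ε) * (6 * s * a * M₂ * R) := by field_simp
      _ ≤ (1.19 / 6 + 1.4143 * (s * Δ) / ε) * (w * ε) := by gcongr
      _ = _ := by field_simp
  have t4 : R * σ / w ≤ 1.19 * ε / 6 + 1.4143 * (s * Δ) := by rwa [div_le_iff₀ hw]
  linarith

end Constants

/-! ### Extending the objective beyond `X_τ`. -/

section Transfer

variable {d : ℕ} {Ξ : Type*} {X : Set (EuclideanSpace ℝ (Fin d))} {τ ν : ℝ}
  {f g : EuclideanSpace ℝ (Fin d) → Ξ → ℝ} {δ Ψ : EuclideanSpace ℝ (Fin d) → ℝ} {T : ℕ}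
  {x₀ : EuclideanSpace ℝ (Fin d)} {e : ℕ → EuclideanSpace ℝ (Fin d)} {ξ : ℕ → Ξ}
  {x : ℕ → EuclideanSpace ℝ (Fin d)}

/-- A run only depends on the objective on the enlarged feasible set. -/
lemma IsRun.congr (h : IsRun X f δ Ψ τ ν T x₀ e ξ x) (he : ∀ k < T, ‖e k‖ = 1)
    (hfg : ∀ y ∈ enlarged X τ, ∀ s, g y s = f y s) : IsRun X g δ Ψ τ ν T x₀ e ξ x where
  start_mem := h.start_mem
  start_min := h.start_min
  zero := h.zero
  succ_mem := h.succ_mem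
  succ_min k hk := by
    have hx := h.mem hk.le
    have e1 : gradEst g δ τ (x k) (ξ k) (e k) = gradEst f δ τ (x k) (ξ k) (e k) := by
      unfold gradEst oracle
      rw [hfg _ (add_smul_mem_enlarged hx (he k hk)), hfg _ (sub_smul_mem_enlarged hx (he k hk))]
    rw [e1]
    exact h.succ_min k hk

/-- Because `τ > 0`, the enlarged set contains two distinct points `x ± τe`, and the Lipschitz
inequality between them fixes the sign of the constant. -/
lemma lipschitz_const_nonneg [NeZero d] (hτ : 0 < τ) {φ : EuclideanSpace ℝ (Fin d) → ℝ} {L : ℝ}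
    (hL : ∀ y ∈ enlarged X τ, ∀ z ∈ enlarged X τ, |φ y - φ z| ≤ L * ‖y - z‖)
    {x : EuclideanSpace ℝ (Fin d)} (hx : x ∈ X) : 0 ≤ L := by
  obtain ⟨e, he⟩ := exists_norm_eq (EuclideanSpace ℝ (Fin d)) (zero_le_one (α := ℝ))
  have h1 := (abs_nonneg _).trans (abs_two_point_sub_le hτ hL hx he)
  by_contra h
  nlinarith

/-- Precomposition with the retraction onto `X_τ` leaves the objective unchanged there and makes it
continuous and measurable everywhere, as joint measurability requires. -/
lemma exists_isRegular [NeZero d] [MeasurableSpace Ξ] {κ Δ M₂ : ℝ} {𝒟 : Measure Ξ} {Mξ : Ξ → ℝ}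
    (hκ0 : 0 < κ) (hκ1 : κ ≤ 1) (hXc : IsCompact X) (hX : Convex ℝ X) (hne : X.Nonempty)
    (hτ : 0 < τ) (hfmeas : ∀ x ∈ enlarged X τ, Measurable (f x))
    (hfint : ∀ x ∈ X, Integrable (f x) 𝒟)
    (hfconv : ∀ s, ConvexOn ℝ (enlarged X τ) (fun x => f x s)) (hM₂ : 0 ≤ M₂)
    (hLip : ∀ s, ∀ x ∈ enlarged X τ, ∀ y ∈ enlarged X τ, |f x s - f y s| ≤ Mξ s * ‖x - y‖)
    (hMint : Integrable (fun s => Mξ s ^ (1 + κ)) 𝒟)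
    (hM : ∫ s, Mξ s ^ (1 + κ) ∂𝒟 ≤ M₂ ^ (1 + κ)) (hδmeas : Measurable δ) (hΔ : 0 ≤ Δ)
    (hδ : ∀ x ∈ enlarged X τ, |δ x| ≤ Δ) :
    ∃ g : EuclideanSpace ℝ (Fin d) → Ξ → ℝ, (∀ y ∈ enlarged X τ, g y = f y) ∧
      IsRegular X τ κ 𝒟 g Mξ M₂ δ Δ := by
  obtain ⟨x, hx⟩ := hne
  obtain ⟨ρ, hρc, hρm, hρe⟩ := exists_continuous_retraction (isCompact_enlarged hXc (τ := τ))
    (convex_enlarged hX) ⟨x, mem_enlarged hx⟩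
  have hM0 : ∀ s, 0 ≤ Mξ s := fun s => lipschitz_const_nonneg hτ (hLip s) hx
  have hfg : ∀ y ∈ enlarged X τ, f (ρ y) = f y := fun y hy => by rw [hρe y hy]
  refine ⟨fun y => f (ρ y), hfg, ?_⟩
  exact
    { tau_pos := hτ
      kappa_pos := hκ0
      kappa_le_one := hκ1
      continuous := fun s => by
        have h1 : LipschitzOnWith ⟨Mξ s, hM0 s⟩ (fun y => f y s) (enlarged X τ) :=
          LipschitzOnWith.of_dist_le_mul fun y hy z hz => by
            rw [Real.dist_eq, dist_eq_norm]; exact hLip s y hy z hz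
        exact h1.continuousOn.comp_continuous hρc hρm
      measurable := fun y => hfmeas _ (hρm y)
      integrable := fun y hy => by rw [hfg y (mem_enlarged hy)]; exact hfint y hy
      convexOn := fun s => (hfconv s).congr fun y hy => by simp only [hfg y hy]
      lipschitz_nonneg := hM0
      lipschitz := fun s y hy z hz => by rw [hfg y hy, hfg z hz]; exact hLip s y hy z hz
      moment_integrable := hMint
      bound_nonneg := hM₂
      moment_le := hM
      noise_measurable := hδmeas
      noise_nonneg := hΔ
      noise_le := hδ }

end Transfer

end ZORSMD

end

/-! ### Assembly of the bounds. -/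

theorem mainTheorem1
    {d : ℕ} (hd : 2 ≤ d)
    {Ξ : Type*} [MeasurableSpace Ξ] (𝒟 : Measure Ξ) [IsProbabilityMeasure 𝒟]
    {Ω : Type*} [MeasurableSpace Ω] (P : Measure Ω) [IsProbabilityMeasure P]
    -- exponents
    (κ : ℝ) (hκ0 : 0 < κ) (hκ1 : κ ≤ 1)
    (p : ℝ) (hp1 : 1 ≤ p) (hp2 : p ≤ 2)
    (q : ℝ≥0∞) (hpq : (ENNReal.ofReal p).HolderConjugate q)
    -- feasible set and smoothing radius
    (X : Set (EuclideanSpace ℝ (Fin d))) (hXc : IsCompact X) (hXconv : Convex ℝ X)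
    (τ : ℝ) (hτ : 0 < τ)
    -- stochastic objective: finite expectation, convexity, Lipschitz continuity, moment bound
    (f : EuclideanSpace ℝ (Fin d) → Ξ → ℝ)
    (hfmeas : ∀ x ∈ ZORSMD.enlarged X τ, Measurable (f x))
    (hfint : ∀ x ∈ X, Integrable (f x) 𝒟)
    (hfconv : ∀ s, ConvexOn ℝ (ZORSMD.enlarged X τ) (fun x => f x s))
    (Mξ : Ξ → ℝ) (M₂ : ℝ) (hM₂ : 0 ≤ M₂)
    (hLip : ∀ s, ∀ x ∈ ZORSMD.enlarged X τ, ∀ y ∈ ZORSMD.enlarged X τ,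
      |f x s - f y s| ≤ Mξ s * ‖x - y‖)
    (hMint : Integrable (fun s => Mξ s ^ (1 + κ)) 𝒟)
    (hM : ∫ s, Mξ s ^ (1 + κ) ∂𝒟 ≤ M₂ ^ (1 + κ))
    -- oracle noise
    (δ : EuclideanSpace ℝ (Fin d) → ℝ) (hδmeas : Measurable δ)
    (Δ : ℝ) (hΔ : 0 ≤ Δ) (hδ : ∀ x ∈ ZORSMD.enlarged X τ, |δ x| ≤ Δ)
    -- prox-function
    (Ψ : EuclideanSpace ℝ (Fin d) → ℝ)
    (hΨ : ZORSMD.IsUniformlyConvex 1 ((1 + κ) / κ) p Ψ)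
    -- solution and starting point, with the resulting constants
    (xs x₀ : EuclideanSpace ℝ (Fin d))
    (hxs : xs ∈ X) (hxsmin : IsMinOn (ZORSMD.objective 𝒟 f) X xs)
    (R₀ : ℝ) (hR₀ : R₀ = ZORSMD.initialDist κ Ψ xs x₀)
    (D : ℝ) (hD : D = ZORSMD.bregmanDiam κ Ψ X)
    -- independent samples and the run of the algorithm
    (T : ℕ) (hT : 1 ≤ T)
    (e : ℕ → Ω → EuclideanSpace ℝ (Fin d)) (ξ : ℕ → Ω → Ξ)
    (he : ∀ k < T, Measurable (e k)) (hξ : ∀ k < T, Measurable (ξ k))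
    (hlaw : ∀ k < T,
      P.map (fun ω => (e k ω, ξ k ω)) = (ZORSMD.uniformSphere d).prod 𝒟)
    (hindep : iIndepFun (fun (k : Fin T) (ω : Ω) => (e k ω, ξ k ω)) P)
    (x : ℕ → Ω → EuclideanSpace ℝ (Fin d))
    (hrun : ∀ ω, ZORSMD.IsRun X f δ Ψ τ
      (ZORSMD.stepSize κ R₀ (ZORSMD.sigmaConst d q κ M₂ Δ τ) T) T x₀
      (fun k => e k ω) (fun k => ξ k ω) (fun k => x k ω)) :
    -- the expectation of `f(x̄_T)` is well defined
    Integrable (fun ω => ZORSMD.objective 𝒟 f (ZORSMD.average T (fun k => x k ω))) P ∧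
    -- the bound for an arbitrary smoothing radius
    (∫ ω, ZORSMD.objective 𝒟 f (ZORSMD.average T (fun k => x k ω)) ∂P
        - ZORSMD.objective 𝒟 f xs
      ≤ 2 * M₂ * τ + √d * Δ / τ * D
        + R₀ * ZORSMD.sigmaConst d q κ M₂ Δ τ / (T : ℝ) ^ (κ / (1 + κ))) ∧
    -- the bound for the optimised smoothing radius
    (τ = √((√d * Δ * D
        + 4 * R₀ * d * ZORSMD.aConst d q * Δ * (T : ℝ) ^ (-(κ / (1 + κ)))) / (2 * M₂)) →
      ∫ ω, ZORSMD.objective 𝒟 f (ZORSMD.average T (fun k => x k ω)) ∂P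
          - ZORSMD.objective 𝒟 f xs
        ≤ √(8 * M₂ * √d * Δ * D)
          + √(32 * M₂ * R₀ * d * ZORSMD.aConst d q * Δ / (T : ℝ) ^ (κ / (1 + κ)))
          + 2 * √d * ZORSMD.aConst d q * M₂ * R₀ / (T : ℝ) ^ (κ / (1 + κ))) ∧
    -- the iteration complexity for accuracy `ε` at noise level of order `ε² / (M₂ √d D)`
    (∀ ε : ℝ, 0 < ε → 6 * M₂ * τ = ε → 36 * M₂ * √d * D * Δ ≤ ε ^ 2 →
      (6 * √d * ZORSMD.aConst d q * M₂ * R₀ / ε) ^ ((1 + κ) / κ) ≤ (T : ℝ) →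
      ∫ ω, ZORSMD.objective 𝒟 f (ZORSMD.average T (fun k => x k ω)) ∂P
          - ZORSMD.objective 𝒟 f xs ≤ ε) := by
  have : NeZero d := ⟨by omega⟩
  obtain ⟨g, hgf, H⟩ := ZORSMD.exists_isRegular hκ0 hκ1 hXc hXconv ⟨xs, hxs⟩ hτ hfmeas hfint hfconv
    hM₂ hLip hMint hM hδmeas hΔ hδ
  have hq := ZORSMD.two_le_of_holderConjugate hp2 hpq
  have hobj : ∀ y ∈ X, ZORSMD.objective 𝒟 g y = ZORSMD.objective 𝒟 f y := fun y hy => by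
    unfold ZORSMD.objective
    rw [hgf y (ZORSMD.mem_enlarged hy)]
  have havg : ∀ ω, ZORSMD.objective 𝒟 g (ZORSMD.average T (fun k => x k ω)) =
      ZORSMD.objective 𝒟 f (ZORSMD.average T (fun k => x k ω)) := fun ω =>
    hobj _ (ZORSMD.average_mem hXconv hT fun k hk => (hrun ω).mem hk.le)
  -- The law puts the directions on the sphere only almost surely, so the run transfers to the
  -- extended objective almost surely as well.
  have he1 : ∀ᵐ ω ∂P, ∀ k < T, ‖e k ω‖ = 1 := by
    rw [MeasureTheory.ae_all_iff]
    intro k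
    by_cases hk : k < T
    · filter_upwards [ZORSMD.IsRegular.ae_norm_eq_one ((he k hk).prodMk (hξ k hk)) (hlaw k hk)]
        with ω hω _ using hω
    · exact Filter.Eventually.of_forall fun ω h => absurd h hk
  subst hR₀ hD
  obtain ⟨hi, hgap, hgapD⟩ := H.gap_le hd hp1 hp2 hpq hΨ hXc hXconv hxs hT he hξ hlaw hindep
    (x₀ := x₀) (x := x) (by
      filter_upwards [he1] with ω hω
      exact (hrun ω).congr hω fun y hy s => by rw [hgf y hy])
  simp only [havg, hobj xs hxs] at hi hgap hgapD
  have hT0 : (0 : ℝ) < T := by exact_mod_cast (by omega : 0 < T)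
  have ha := (ZORSMD.aConst_pos hd hq).le
  have hR := hΨ.initialDist_nonneg hκ0 x₀ xs
  have hD : 0 ≤ ZORSMD.bregmanDiam κ Ψ X :=
    (ZORSMD.pNorm_nonneg _ _).trans (hΨ.pNorm_sub_le_bregmanDiam hκ0 hXc hxs hxs)
  have hσ := ZORSMD.sigmaConst_le hd hq hκ0 hκ1 hM₂ hΔ hτ
  have hw : 0 < (T : ℝ) ^ (κ / (1 + κ)) := Real.rpow_pos_of_pos hT0 _
  refine ⟨hi, hgap, fun hτe => ?_, fun ε hε hτe hΔe hTe => ?_⟩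
  · rw [Real.rpow_neg hT0.le] at hτe
    exact hgap.trans (ZORSMD.gap_bound_optimal rfl ha hD hR hw hM₂ hΔ hτ hσ hτe)
  -- If `ε` exceeds the total variation allowed by the Lipschitz bound, the fallback estimate
  -- suffices; otherwise the noise hypothesis yields a usable bound on `Δ`.
  · rcases le_or_gt (M₂ * ZORSMD.bregmanDiam κ Ψ X) ε with hMD | hMD
    · exact hgapD.trans hMD
    · refine hgap.trans (ZORSMD.gap_bound_complexity rfl ha hR hw hM₂ hΔ hτ hσ hε hτe hΔe ?_ hMD)
      have hN : 0 ≤ 6 * √d * ZORSMD.aConst d q * M₂ * ZORSMD.initialDist κ Ψ xs x₀ / ε := by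
        positivity
      calc 6 * √d * ZORSMD.aConst d q * M₂ * ZORSMD.initialDist κ Ψ xs x₀ / ε
          = ((6 * √d * ZORSMD.aConst d q * M₂ * ZORSMD.initialDist κ Ψ xs x₀ / ε) ^
              ((1 + κ) / κ)) ^ (κ / (1 + κ)) := by
            rw [← Real.rpow_mul hN, show (1 + κ) / κ * (κ / (1 + κ)) = 1 by field_simp,
              Real.rpow_one]
        _ ≤ (T : ℝ) ^ (κ / (1 + κ)) :=
            Real.rpow_le_rpow (Real.rpow_nonneg hN _) hTe (by positivity)
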